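/- **3M-DAPs.** A three-matrix division and assignment problem (3M-DAP) $P=(T;U,V)$ is given by dimensions $s_t\times t$, $s_u\times u$, $s_v\times v$ and rational row sums $x_t,x_u,x_v$ with $t\ge 2$, $u\ge 2$, $v\ge 1$; $s_t>0$, $s_u>0$, $s_v\ge 0$; $s_v v\le (t-2)s_t$ if $v=1$; $s_uu+s_vv=s_tt$; $s_ux_u+s_vx_v=s_tx_t$; and $x_u/u<x_v/v$. A feasible solution fills $T,U,V$ with real numbers so that every row of $T$, $U$, $V$ sums to $x_t$, $x_u$, $x_v$ respectively and the multiset of entries of $T$ equals that of $U$ and $V$ together. $f(P)$ is the maximum, over feasible solutions, of the smallest entry of $T$. Put $n_u=s_uu$, $\lambda=x_u-x_v$, $\gamma=x_t/t$, $a=x_u/u$. **The recursive algorithm $\mathcal R$** (whenever a value, a grouping or an order is left open below, any choice is allowed). Let $$x_\infty=\frac{(\lambda+\gamma(v-1)t)\,u}{(v-1)t+u-v},\qquad x_b=\frac{(\lambda+\gamma(v-1)t)\,ub+\gamma tu}{((v-1)t+u-v)\,b+t}\quad(b=0,1,2,\dots).$$ * If $x_u\le x_\infty$, apply $\mathcal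 Z_1$. * If $x_u>x_\infty$ and $x_u=x_b$ for some integer $b\ge 0$: put $h=s_t-(v-1)s_v$ and $b^*=s_v/h$, set all entries of $U$ to $a$, complete one $b^*$-pair $(A,B)$ all of whose given entries are $a$, and let $T$ and $V$ consist of $h$ copies of $A$ and of $B$. * Otherwise let $h=s_t-(v-1)s_v$, $b=\lceil s_v/h\rceil$, and apply $\mathcal R$ to the reduced problem $P'=(T';U',V')$ with $(s_t',t',x_t')=(s_u,u,x_u)$, $s_u'=s_v-(b-1)h$, $u'=[(v-1)b+1]t-bv$, $x_u'=[(v-1)b+1]x_t-bx_v$, $s_v'=bh-s_v$, $v'=[(v-1)(b-1)+1]t-(b-1)v$, $x_v'=[(v-1)(b-1)+1]x_t-(b-1)x_v$. Let $U=T'$. For each row of $U'$ complete a $b$-pair, and for each row of $V'$ a $(b-1)$-pair, whose given entries are the entries of that row in any order; $T$ consists of the rows of all the $A$, and $V$ of the rows of all the $B$. *Completing a $k$-pair* ($A$ is $[(v-1)k+1]\times t$, $B$ is $k\times v$, and $[(v-1)k+1]t-kv$ entries of $A$ are given). If $k=0$, $A$ is the row of given entries. If $v=1$, $A$ is the row of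 given entries together with $k$ entries $x_v$, and $B$ has $k$ rows $[x_v]$. Otherwise put $t-1$ given entries in each of the first $k(v-2)+2$ rows of $A$ and $t-2$ in each of the other $k-1$ rows, in order. For $1\le i\le k(v-2)+2$ let $w_i$ be the entry that completes row $i$ of $A$. If $k=1$, the row of $B$ is $w_1,\dots,w_v$. If $k>1$, $B$ has first row $w_1,\dots,w_{v-1},y_1$; rows $z_{i},w_{i(v-2)+2},\dots,w_{i(v-2)+v-1},y_{i+1}$ for $1\le i\le k-2$; and last row $z_{k-1},w_{(k-1)(v-2)+2},\dots,w_{k(v-2)+2}$; where successively $y_i$ is chosen so that row $i$ of $B$ sums to $x_v$, and $z_i$ so that row $k(v-2)+2+i$ of $A$, into which $y_i,z_i$ are put, sums to $x_t$. *Algorithm $\mathcal Z_1$.* Set all entries of $U$ to $a$; write $n_u=q_ts_t+r_t$ with $0\le r_t<s_t$. (i) $r_t=0$: set all entries of $V$ to $x_v/v$; each row of $T$ is $q_t$ entries $a$ and $t-q_t$ entries $x_v/v$. (ii) $r_t>0$, $q_t<t-2$: put $q_t+1$ entries $a$ in $r_t$ rows of $T$ and $q_t$ in the others; fill the rest by applying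 $\mathcal S$ to the problem whose $T$-matrix is $V$, whose $U$-matrix is the unfilled part of the other $s_t-r_t$ rows, and whose $V$-matrix is the unfilled part of the first $r_t$ rows. (iii) Otherwise put $\rho=x_t-(t-1)a$; $r_t$ rows of $T$ are $t-1$ entries $a$ and one $\rho$; the other rows get $t-2$ entries $a$, leaving a two-column matrix $T'$ with row sum $x_t-(t-2)a=2\sigma$. Write $r_t=q_vs_v+r_v$ with $0\le r_v<s_v$. If $r_v=0$, set all of $T'$ to $\sigma$ and let each row of $V$ be $q_v$ entries $\rho$ and $v-q_v$ entries $\sigma$. If $r_v>0$, put $q_v+1$ entries $\rho$ in $r_v$ rows of $V$ and $q_v$ in the others, and fill the rest by applying $\mathcal E$ to $(T';U',V')$, where $U'$ and $V'$ are the unfilled parts of those $r_v$ rows and of the other rows of $V$. (The row sums of an unfilled part are what remains of the required row sums.) *Algorithm $\mathcal S$* (for $u=v+1$). If $t$ is even apply $\mathcal E$. If $t$ is odd and $s_t\ge(u-2)s_u+(v-2)s_v$: if $n_u<s_t$, set all entries of $U$ to $a$, put one of them in each of $n_u$ rows of $T$, and fill the rest by $\mathcal E$ with $T$-matrix $V$,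 $U$-matrix the untouched rows of $T$ and $V$-matrix the unfilled part of the touched rows; if $n_u=s_t$, set all of $U$ and the first column of $T$ to $a$ and everything else to $x_v/v$; if $n_u>s_t$, put $r=(s_t-s_u)/2$, set the first column of $T$, $r$ full rows of $U$ and one entry of each other row of $U$ to $a$, and fill the rest by $\mathcal E$, applied to the unfilled part of $T$, the unfilled two-column part of $U$ (row sum $2x_u/3$), and $V$. If $t$ is odd and $s_t<(u-2)s_u+(v-2)s_v$: choose $\mu$ with $\lambda<\mu\le x_t/t$, fill the first column of $T$ with $\mu$, and insert these $s_t$ values into the first column of $U$, the first column of $V$, the second column of $U$, the second column of $V$, and so on, row by row. If all rows of $U$ and $V$ then have equally many unfilled entries, fill the rest by $\mathcal E$; otherwise fill the rest by $\mathcal E^+$, each row of $U$ and $V$ being a sink. *Algorithms $\mathcal E$, $\mathcal E^+$* ($t$ even; sinks are the rows of $U$ and $V$, respectively any vectors with $u_j$ entries and required sum $x_j$). In every sink set all entries but two to $x_t/t$; divide the rows of $T$ into pairs with sum $2x_t/t$, set $\frac12\sum_j(u_j-2)$ of the pairs to $[x_t/t,x_t/t]$, and fill the remaining pairs and the remaining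 two entries of every sink by the greedy algorithm $\mathcal G$, respectively $\mathcal G^+$. The pairs are grouped into rows of $T$ by $t/2$. *Algorithms $\mathcal G$, $\mathcal G^+$* ($s$ source rows and $s$ sinks, all with two entries; source row sum $x_t$, sink sums $x_j$, which for $\mathcal G$ are $x_u$ or $x_v$). Let $y_1=x_t/2$. For $i=1,\dots,s$: choose an unused sink $j$, let $z_i=x_j-y_i$, assign $[y_i,z_i]$ to $j$, and let $y_{i+1}=x_t-z_i$. In $\mathcal G$ the sink is a row of $U$ if $x_u-y_i>(x_u+x_t-x_v)/2$ and otherwise a row of $V$. In $\mathcal G^+$, if $d_1<\dots<d_r$ are the distinct demands of the unused sinks and $d_{r+1}=\infty$, it is any sink with demand $d_k$, where $k$ is least with $y_i<\frac12(d_k+d_{k+1}-x_t)$. Finally let $\varepsilon=(\min_iz_i-\min_iy_i)/2$, add $\varepsilon$ to every $y_i$ and subtract $\varepsilon$ from every $z_i$. The source rows are $[y_1,z_s]$ and $[y_{i+1},z_i]$, $1\le i<s$. **Theorem.** For every 3M-DAP $P$ the algorithm $\mathcal R$ terminates with some output, and every filling $(T;U,V)$ which it can return is an optimal solution of $P$: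 it is feasible, and its smallest entry $g(P)$ is the maximum of the smallest entry over all feasible solutions, i.e. $f(P)=g(P)$. -/

import Mathlib

/-! Three-matrix division and assignment problems and the recursive algorithm that solves them.

Nothing in these problems depends on the order of the rows of a matrix or on the order of the
entries in a row.  A filled matrix is therefore recorded as the multiset of its rows, each row being
the multiset of its entries. -/

namespace ThreeMatrix

/-- The data of a problem `(T; U, V)`: the matrices `T`, `U`, `V` have dimensions `st × t`, `su × u`,
`sv × v`, and every row of `T`, `U`, `V` has to sum to `xt`, `xu`, `xv` respectively. -/
structure Problem where
  st : ℕ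
  t : ℕ
  xt : ℝ
  su : ℕ
  u : ℕ
  xu : ℝ
  sv : ℕ
  v : ℕ
  xv : ℝ

/-- A filled matrix, as the multiset of its rows. -/
abbrev Rows := Multiset (Multiset ℝ)

/-- Filled matrices `T`, `U`, `V`. -/
structure Filling where
  T : Rows
  U : Rows
  V : Rows

/-- `M` has `s` rows, each with `c` entries and row sum `x`. -/
def IsMatrix (s c : ℕ) (x : ℝ) (M : Rows) : Prop :=
  M.card = s ∧ ∀ r ∈ M, r.card = c ∧ r.sum = x

/-- `q` is the smallest entry of the matrix `T`. -/
def Filling.IsSmallestPiece (F : Filling) (q : ℝ) : Prop :=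
  IsLeast {y : ℝ | y ∈ F.T.join} q

namespace Problem

/-- The requirements on the data of a three-matrix division and assignment problem (3M-DAP). -/
structure Is3MDAP (P : Problem) : Prop where
  xt_rational : ∃ q : ℚ, (q : ℝ) = P.xt
  xu_rational : ∃ q : ℚ, (q : ℝ) = P.xu
  xv_rational : ∃ q : ℚ, (q : ℝ) = P.xv
  two_le_t : 2 ≤ P.t
  two_le_u : 2 ≤ P.u
  one_le_v : 1 ≤ P.v
  v_eq_one : P.v = 1 → P.sv * P.v ≤ (P.t - 2) * P.st
  st_pos : 0 < P.st
  su_pos : 0 < P.su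
  entries_eq : P.su * P.u + P.sv * P.v = P.st * P.t
  sums_eq : P.su * P.xu + P.sv * P.xv = P.st * P.xt
  average_lt : P.xu / P.u < P.xv / P.v

/-- Feasible solutions: all rows have the required lengths and sums, and the multiset of entries of
`T` is the multiset of entries of `U` and `V` together. -/
def IsFeasible (P : Problem) (F : Filling) : Prop :=
  IsMatrix P.st P.t P.xt F.T ∧ IsMatrix P.su P.u P.xu F.U ∧ IsMatrix P.sv P.v P.xv F.V ∧
    F.T.join = F.U.join + F.V.join

/-- The values attained by the objective "smallest entry of `T`" on feasible solutions. -/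
def objectiveValues (P : Problem) : Set ℝ :=
  {q | ∃ F, P.IsFeasible F ∧ F.IsSmallestPiece q}

/-- The optimal value `f(P)`. -/
noncomputable def f (P : Problem) : ℝ := sSup P.objectiveValues

/-! ### Greedy algorithms for problems in which all rows have two entries -/

end Problem

/-- The shift `ε` that equalises the minima of `y_0, …, y_{s-1}` and `z_0, …, z_{s-1}`. -/
noncomputable def shift (s : ℕ) (y z : ℕ → ℝ) : ℝ :=
  ((⨅ i : Fin s, z i) - (⨅ i : Fin s, y i)) / 2

/-- The row `[y_i, z_i]` of `U` or `V`, after the shift. -/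
noncomputable def sinkRow (s : ℕ) (y z : ℕ → ℝ) (i : ℕ) : Multiset ℝ :=
  {y i + shift s y z, z i - shift s y z}

/-- The rows `[y_0, z_{s-1}]` and `[y_{i+1}, z_i]` of `T`, after the shift. -/
noncomputable def sourceRows (s : ℕ) (y z : ℕ → ℝ) : Rows :=
  {y 0 + shift s y z, z (s - 1) - shift s y z} ::ₘ
    (Multiset.range (s - 1)).map fun i => {y (i + 1) + shift s y z, z i - shift s y z}

namespace Problem

/-- A piece `y` goes to `U` (and otherwise to `V`) if the remaining piece `xu - y` of that row of `U`
exceeds `(xu + xt - xv) / 2`. -/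
def ToU (P : Problem) (y : ℝ) : Prop := P.xu - y > (P.xu + P.xt - P.xv) / 2

open Classical in
/-- The piece put next to the piece `y` in a row of `U` or `V`. -/
noncomputable def partner (P : Problem) (y : ℝ) : ℝ :=
  if P.ToU y then P.xu - y else P.xv - y

/-- The pieces `y_0 = xt / 2`, `y_{i+1} = xt - z_i`, where `z_i` is the partner of `y_i`. -/
noncomputable def greedyY (P : Problem) : ℕ → ℝ
  | 0 => P.xt / 2
  | i + 1 => P.xt - P.partner (greedyY P i)

/-- The pieces `z_i`. -/
noncomputable def greedyZ (P : Problem) (i : ℕ) : ℝ := P.partner (P.greedyY i)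

open Classical in
/-- The greedy algorithm, for `t = u = v = 2`. -/
noncomputable def greedy (P : Problem) : Filling where
  T := sourceRows P.st P.greedyY P.greedyZ
  U := ((Multiset.range P.st).filter fun i => P.ToU (P.greedyY i)).map
    (sinkRow P.st P.greedyY P.greedyZ)
  V := ((Multiset.range P.st).filter fun i => ¬ P.ToU (P.greedyY i)).map
    (sinkRow P.st P.greedyY P.greedyZ)

end Problem

/-- The pieces `y_0 = xt / 2`, `y_{i+1} = xt - z_i`, where `z_i = d_i - y_i`. -/
noncomputable def chainY (xt : ℝ) (d : ℕ → ℝ) : ℕ → ℝ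
  | 0 => xt / 2
  | i + 1 => xt - (d i - chainY xt d i)

/-- `d` is the smallest of the values `d_1 < d_2 < ⋯ < d_r` in `D` such that
`y < (d_k + d_{k+1} - xt) / 2`, where `d_{r+1} = ∞`.  (As the right-hand side increases with
`d_{k+1}`, the inequality for the next larger value is the inequality for all larger values.) -/
def IsGreedyChoice (xt : ℝ) (D : Set ℝ) (y d : ℝ) : Prop :=
  IsLeast {c : ℝ | c ∈ D ∧ ∀ e ∈ D, c < e → y < (c + e - xt) / 2} d

/-- The greedy algorithm for a DAP with one source matrix `T` of two columns, with row sum `xt`, and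
sinks `j : ι` with two entries and demand `x j` each.  The bijection `σ` lists the sinks in the order
in which the algorithm serves them; at every step a sink is chosen among those not yet served.
`T` is the resulting source matrix and `R j` the resulting row of sink `j`. -/
def GeneralGreedy {ι : Type} [Fintype ι] (xt : ℝ) (x : ι → ℝ) (T : Rows) (R : ι → Multiset ℝ) :
    Prop :=
  ∃ (σ : Fin (Fintype.card ι) ≃ ι) (d : ℕ → ℝ),
    (∀ i : Fin (Fintype.card ι), d i = x (σ i)) ∧
    (∀ i, IsGreedyChoice xt {c | ∃ j, i ≤ j ∧ x (σ j) = c} (chainY xt d i) (x (σ i))) ∧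
    T = sourceRows (Fintype.card ι) (chainY xt d) (fun i => d i - chainY xt d i) ∧
    ∀ i, R (σ i) = sinkRow (Fintype.card ι) (chainY xt d) (fun i => d i - chainY xt d i) i

/-! ### Problems in which the rows of `T` have even length -/

/-- The rows of `T` (`n` of them) arise by joining the rows in `M` in groups of `k`. -/
def IsGrouping (k n : ℕ) (M T : Rows) : Prop :=
  ∃ G : Multiset Rows, G.card = n ∧ (∀ g ∈ G, g.card = k) ∧ G.join = M ∧
    T = G.map Multiset.join

namespace Problem

/-- The subproblem with two columns that is left when all but two entries in every row of `U` and `V`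
are set to `xt / t` and rows of `T` are cut into pairs. -/
noncomputable def evenSub (P : Problem) : Problem where
  st := P.su + P.sv
  t := 2
  xt := 2 * (P.xt / P.t)
  su := P.su
  u := 2
  xu := P.xu - ((P.u : ℝ) - 2) * (P.xt / P.t)
  sv := P.sv
  v := 2
  xv := P.xv - ((P.v : ℝ) - 2) * (P.xt / P.t)

/-- The algorithm for even `t` can produce the filling `F`. -/
def EvenAlgorithm (P : Problem) (F : Filling) : Prop :=
  IsGrouping (P.t / 2) P.st
    (P.evenSub.greedy.T + Multiset.replicate (((P.u - 2) * P.su + (P.v - 2) * P.sv) / 2)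
      {P.xt / P.t, P.xt / P.t}) F.T ∧
  F.U = P.evenSub.greedy.U.map (fun r => r + Multiset.replicate (P.u - 2) (P.xt / P.t)) ∧
  F.V = P.evenSub.greedy.V.map (fun r => r + Multiset.replicate (P.v - 2) (P.xt / P.t))

end Problem

/-- The algorithm for a DAP with one source matrix `T`, of dimensions `st × t` with `t` even and row
sum `xt`, and sinks `j : ι` with `len j` entries and demand `x j`, can produce the source matrix `T`
and the sink rows `R j`. -/
def GeneralEvenAlgorithm {ι : Type} [Fintype ι] (st t : ℕ) (xt : ℝ) (len : ι → ℕ) (x : ι → ℝ)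
    (T : Rows) (R : ι → Multiset ℝ) : Prop :=
  ∃ (T₂ : Rows) (R₂ : ι → Multiset ℝ),
    GeneralGreedy (2 * (xt / t)) (fun j => x j - ((len j : ℝ) - 2) * (xt / t)) T₂ R₂ ∧
    IsGrouping (t / 2) st
      (T₂ + Multiset.replicate ((∑ j, (len j - 2)) / 2) {xt / t, xt / t}) T ∧
    ∀ j, R j = R₂ j + Multiset.replicate (len j - 2) (xt / t)

/-! ### Problems with `u = v + 1` -/

namespace Problem

/-- The number of the `st` pieces of size `μ` that are put into the row with index `i`, where the
rows of `U` followed by the rows of `V` are indexed by `0, …, su + sv - 1`, and the pieces are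
inserted into the first column of `U`, the first column of `V`, the second column of `U`, the second
column of `V`, and so on. -/
def fillCount (P : Problem) (i : ℕ) : ℕ := Nat.count (fun n => n % (P.su + P.sv) = i) P.st

/-- The algorithm for `u = v + 1` can produce the filling `F`. -/
inductive SuccAlgorithm (P : Problem) : Filling → Prop
  | even (F : Filling) (ht : Even P.t) (hF : P.EvenAlgorithm F) : SuccAlgorithm P F
  | odd_lt (F G : Filling) (ht : ¬ Even P.t)
      (hs : (P.u - 2) * P.su + (P.v - 2) * P.sv ≤ P.st) (hn : P.su * P.u < P.st)
      (hG : EvenAlgorithm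
        { st := P.sv, t := P.v, xt := P.xv
          su := P.st - P.su * P.u, u := P.t, xu := P.xt
          sv := P.su * P.u, v := P.t - 1, xv := P.xt - P.xu / P.u } G)
      (hT : F.T = G.U + G.V.map (fun r => (P.xu / P.u) ::ₘ r))
      (hU : F.U = Multiset.replicate P.su (Multiset.replicate P.u (P.xu / P.u)))
      (hV : F.V = G.T) : SuccAlgorithm P F
  | odd_eq (F : Filling) (ht : ¬ Even P.t)
      (hs : (P.u - 2) * P.su + (P.v - 2) * P.sv ≤ P.st) (hn : P.su * P.u = P.st)
      (hT : F.T = Multiset.replicate P.st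
        ((P.xu / P.u) ::ₘ Multiset.replicate (P.t - 1) (P.xv / P.v)))
      (hU : F.U = Multiset.replicate P.su (Multiset.replicate P.u (P.xu / P.u)))
      (hV : F.V = Multiset.replicate P.sv (Multiset.replicate P.v (P.xv / P.v))) :
      SuccAlgorithm P F
  | odd_gt (F G : Filling) (r : ℕ) (ht : ¬ Even P.t)
      (hs : (P.u - 2) * P.su + (P.v - 2) * P.sv ≤ P.st) (hn : P.st < P.su * P.u)
      (hr : r = (P.st - P.su) / 2)
      (hG : EvenAlgorithm
        { st := P.st, t := P.t - 1, xt := P.xt - P.xu / P.u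
          su := P.su - r, u := 2, xu := 2 * P.xu / 3
          sv := P.sv, v := P.v, xv := P.xv } G)
      (hT : F.T = G.T.map (fun row => (P.xu / P.u) ::ₘ row))
      (hU : F.U = Multiset.replicate r (Multiset.replicate P.u (P.xu / P.u)) +
        G.U.map (fun row => (P.xu / P.u) ::ₘ row))
      (hV : F.V = G.V) : SuccAlgorithm P F
  | fill_same (F G : Filling) (μ : ℝ) (w : ℕ) (ht : ¬ Even P.t)
      (hs : P.st < (P.u - 2) * P.su + (P.v - 2) * P.sv)
      (hμ : P.xu - P.xv < μ) (hμt : μ ≤ P.xt / P.t)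
      (hw : (∀ i < P.su, P.u - P.fillCount i = w) ∧
        ∀ j < P.sv, P.v - P.fillCount (P.su + j) = w)
      (hG : EvenAlgorithm
        { st := P.st, t := P.t - 1, xt := P.xt - μ
          su := P.su, u := w, xu := P.xu - ((P.u : ℝ) - w) * μ
          sv := P.sv, v := w, xv := P.xv - ((P.v : ℝ) - w) * μ } G)
      (hT : F.T = G.T.map (fun r => μ ::ₘ r))
      (hU : F.U = G.U.map (fun r => r + Multiset.replicate (P.u - w) μ))
      (hV : F.V = G.V.map (fun r => r + Multiset.replicate (P.v - w) μ)) : SuccAlgorithm P F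
  | fill_mixed (F : Filling) (μ : ℝ) (T : Rows) (R : Fin P.su ⊕ Fin P.sv → Multiset ℝ)
      (ht : ¬ Even P.t)
      (hs : P.st < (P.u - 2) * P.su + (P.v - 2) * P.sv)
      (hμ : P.xu - P.xv < μ) (hμt : μ ≤ P.xt / P.t)
      (hw : ¬ ∃ w, (∀ i < P.su, P.u - P.fillCount i = w) ∧
        ∀ j < P.sv, P.v - P.fillCount (P.su + j) = w)
      (hR : GeneralEvenAlgorithm P.st (P.t - 1) (P.xt - μ)
        (Sum.elim (fun i : Fin P.su => P.u - P.fillCount i)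
          (fun j : Fin P.sv => P.v - P.fillCount (P.su + j)))
        (Sum.elim (fun i : Fin P.su => P.xu - P.fillCount i * μ)
          (fun j : Fin P.sv => P.xv - P.fillCount (P.su + j) * μ)) T R)
      (hT : F.T = T.map (fun r => μ ::ₘ r))
      (hU : F.U = Finset.univ.val.map fun i : Fin P.su =>
        R (Sum.inl i) + Multiset.replicate (P.fillCount i) μ)
      (hV : F.V = Finset.univ.val.map fun j : Fin P.sv =>
        R (Sum.inr j) + Multiset.replicate (P.fillCount (P.su + j)) μ) : SuccAlgorithm P F

/-! ### 0-problems of type 1 -/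

/-- The number of completely filled columns of `T` when the entries of `U` are spread evenly over the
rows of `T`. -/
def qt (P : Problem) : ℕ := P.su * P.u / P.st

/-- The number of rows of `T` that receive one more entry of `U`. -/
def rt (P : Problem) : ℕ := P.su * P.u % P.st

/-- The entry that completes a row of `T` which has `t - 1` entries `xu / u`. -/
noncomputable def rho (P : Problem) : ℝ := P.xt - ((P.t : ℝ) - 1) * (P.xu / P.u)

/-- Half of what is left of a row of `T` which has `t - 2` entries `xu / u`. -/
noncomputable def sigma (P : Problem) : ℝ := (P.xt - ((P.t : ℝ) - 2) * (P.xu / P.u)) / 2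

/-- The number of columns of `V` filled with the value `rho`. -/
def qv (P : Problem) : ℕ := P.rt / P.sv

/-- The number of rows of `V` that receive one more entry `rho`. -/
def rv (P : Problem) : ℕ := P.rt % P.sv

/-- The algorithm for 0-problems of type 1 can produce the filling `F`. -/
inductive ZeroAlgorithm₁ (P : Problem) : Filling → Prop
  | balanced (F : Filling) (hr : P.rt = 0)
      (hT : F.T = Multiset.replicate P.st
        (Multiset.replicate P.qt (P.xu / P.u) + Multiset.replicate (P.t - P.qt) (P.xv / P.v)))
      (hU : F.U = Multiset.replicate P.su (Multiset.replicate P.u (P.xu / P.u)))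
      (hV : F.V = Multiset.replicate P.sv (Multiset.replicate P.v (P.xv / P.v))) :
      ZeroAlgorithm₁ P F
  | small (F G : Filling) (hr : P.rt ≠ 0) (hq : P.qt < P.t - 2)
      (hG : SuccAlgorithm
        { st := P.sv, t := P.v, xt := P.xv
          su := P.st - P.rt, u := P.t - P.qt, xu := P.xt - P.qt * (P.xu / P.u)
          sv := P.rt, v := P.t - P.qt - 1, xv := P.xt - (P.qt + 1) * (P.xu / P.u) } G)
      (hT : F.T = G.U.map (fun r => r + Multiset.replicate P.qt (P.xu / P.u)) +
        G.V.map (fun r => r + Multiset.replicate (P.qt + 1) (P.xu / P.u)))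
      (hU : F.U = Multiset.replicate P.su (Multiset.replicate P.u (P.xu / P.u)))
      (hV : F.V = G.T) : ZeroAlgorithm₁ P F
  | large_balanced (F : Filling) (hr : P.rt ≠ 0) (hq : ¬ P.qt < P.t - 2) (hrv : P.rv = 0)
      (hT : F.T = Multiset.replicate P.rt
          (P.rho ::ₘ Multiset.replicate (P.t - 1) (P.xu / P.u)) +
        Multiset.replicate (P.st - P.rt)
          (Multiset.replicate (P.t - 2) (P.xu / P.u) + {P.sigma, P.sigma}))
      (hU : F.U = Multiset.replicate P.su (Multiset.replicate P.u (P.xu / P.u)))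
      (hV : F.V = Multiset.replicate P.sv
        (Multiset.replicate P.qv P.rho + Multiset.replicate (P.v - P.qv) P.sigma)) :
      ZeroAlgorithm₁ P F
  | large (F G : Filling) (hr : P.rt ≠ 0) (hq : ¬ P.qt < P.t - 2) (hrv : P.rv ≠ 0)
      (hG : EvenAlgorithm
        { st := P.st - P.rt, t := 2, xt := P.xt - ((P.t : ℝ) - 2) * (P.xu / P.u)
          su := P.rv, u := P.v - P.qv - 1, xu := P.xv - (P.qv + 1) * P.rho
          sv := P.sv - P.rv, v := P.v - P.qv, xv := P.xv - P.qv * P.rho } G)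
      (hT : F.T = Multiset.replicate P.rt
          (P.rho ::ₘ Multiset.replicate (P.t - 1) (P.xu / P.u)) +
        G.T.map (fun r => r + Multiset.replicate (P.t - 2) (P.xu / P.u)))
      (hU : F.U = Multiset.replicate P.su (Multiset.replicate P.u (P.xu / P.u)))
      (hV : F.V = G.U.map (fun r => r + Multiset.replicate (P.qv + 1) P.rho) +
        G.V.map (fun r => r + Multiset.replicate P.qv P.rho)) : ZeroAlgorithm₁ P F

/-! ### Completing a `b`-pair

A `b`-pair consists of a set `A` of `(v - 1) b + 1` rows of `T` and a set `B` of `b` rows of `V` such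
that the entries of `B` all lie in `A` and the remaining entries of `A` belong to `U`.  The list `l`
contains these remaining entries, in any order.  Indices of entries and rows start at `0`. -/

/-- The number of entries of `U` in a `b`-pair. -/
def pairSize (P : Problem) (b : ℕ) : ℕ := ((P.v - 1) * b + 1) * P.t - b * P.v

/-- The number of rows of `A` that contain exactly one entry of `B`. -/
def wCount (P : Problem) (b : ℕ) : ℕ := b * (P.v - 2) + 2

/-- The `t - 1` entries of `l` in the `i`-th row of `A`, for `i < wCount`. -/
def wBlock (P : Problem) (l : List ℝ) (i : ℕ) : List ℝ := (l.drop (i * (P.t - 1))).take (P.t - 1)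

/-- The `t - 2` entries of `l` in the row of `A` with index `wCount + k`. -/
def zBlock (P : Problem) (b : ℕ) (l : List ℝ) (k : ℕ) : List ℝ :=
  (l.drop (P.wCount b * (P.t - 1) + k * (P.t - 2))).take (P.t - 2)

/-- The last entry `w_i` of the `i`-th row of `A`, for `i < wCount`. -/
noncomputable def pairW (P : Problem) (l : List ℝ) (i : ℕ) : ℝ := P.xt - (P.wBlock l i).sum

/-- The `v - 2` middle entries of the `k`-th row of `B`. -/
noncomputable def middle (P : Problem) (l : List ℝ) (k : ℕ) : Multiset ℝ :=
  (Multiset.range (P.v - 2)).map fun j => P.pairW l (k * (P.v - 2) + 1 + j)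

/-- The first entry of the `k`-th row of `B`: this is `w_0` for `k = 0` and `z_{k-1}` for `k > 0`,
where `z_k = xt - y_k - (sum of the k-th z-block)`. -/
noncomputable def first (P : Problem) (b : ℕ) (l : List ℝ) : ℕ → ℝ
  | 0 => P.pairW l 0
  | k + 1 => P.xt - (P.xv - first P b l k - (P.middle l k).sum) - (P.zBlock b l k).sum

/-- The entry `y_k` which completes the `k`-th row of `B` to the sum `xv`, for `k < b - 1`. -/
noncomputable def pairY (P : Problem) (b : ℕ) (l : List ℝ) (k : ℕ) : ℝ :=
  P.xv - P.first b l k - (P.middle l k).sum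

/-- The last entry of the `k`-th row of `B`: it is `y_k`, except in the last row, where it is the
last one of the entries `w_i`. -/
noncomputable def last (P : Problem) (b : ℕ) (l : List ℝ) (k : ℕ) : ℝ :=
  if k = b - 1 then P.pairW l (b * (P.v - 2) + 1) else P.pairY b l k

/-- The rows of `A` in the completed `b`-pair. -/
noncomputable def pairA (P : Problem) (b : ℕ) (l : List ℝ) : Rows :=
  if b = 0 then {(l : Multiset ℝ)}
  else if P.v = 1 then {(l : Multiset ℝ) + Multiset.replicate b P.xv}
  else
    (Multiset.range (P.wCount b)).map (fun i => P.pairW l i ::ₘ (P.wBlock l i : Multiset ℝ)) +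
    (Multiset.range (b - 1)).map
      (fun k => P.pairY b l k ::ₘ P.first b l (k + 1) ::ₘ (P.zBlock b l k : Multiset ℝ))

/-- The rows of `B` in the completed `b`-pair. -/
noncomputable def pairB (P : Problem) (b : ℕ) (l : List ℝ) : Rows :=
  if P.v = 1 then Multiset.replicate b {P.xv}
  else (Multiset.range b).map fun k => P.first b l k ::ₘ P.last b l k ::ₘ P.middle l k

/-! ### 0-problems of type 2 -/

/-- The number `st - (v - 1) sv`, which is half of `n_u - (t - 2) st - (v - 2) sv`; it is the number
of pairs into which `T` and `V` are divided. -/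
def pairCount (P : Problem) : ℕ := P.st - (P.v - 1) * P.sv

/-- The filling produced by the algorithm for 0-problems of type 2: all entries of `U` are `xu / u`,
and `T` and `V` consist of copies of one `b`-pair, where `b = sv / (st - (v - 1) sv)`. -/
noncomputable def zeroAlgorithm₂ (P : Problem) : Filling where
  T := P.pairCount • P.pairA (P.sv / P.pairCount)
    (List.replicate (P.pairSize (P.sv / P.pairCount)) (P.xu / P.u))
  U := Multiset.replicate P.su (Multiset.replicate P.u (P.xu / P.u))
  V := P.pairCount • P.pairB (P.sv / P.pairCount)
    (List.replicate (P.pairSize (P.sv / P.pairCount)) (P.xu / P.u))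

/-! ### The recursive algorithm -/

/-- The parameter `λ = xu - xv`. -/
noncomputable def lam (P : Problem) : ℝ := P.xu - P.xv

/-- The parameter `γ = xt / t`. -/
noncomputable def gam (P : Problem) : ℝ := P.xt / P.t

/-- The threshold `x_∞`. -/
noncomputable def xInf (P : Problem) : ℝ :=
  (P.lam + P.gam * ((P.v : ℝ) - 1) * P.t) / (((P.v : ℝ) - 1) * P.t + P.u - P.v) * P.u

/-- The numbers `x_b`. -/
noncomputable def xSeq (P : Problem) (b : ℕ) : ℝ :=
  ((P.lam + P.gam * ((P.v : ℝ) - 1) * P.t) * P.u * b + P.gam * P.t * P.u) /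
    ((((P.v : ℝ) - 1) * P.t + P.u - P.v) * b + P.t)

/-- The number `⌈sv / (st - (v - 1) sv)⌉`. -/
noncomputable def bHat (P : Problem) : ℕ :=
  ⌈(P.sv : ℝ) / ((P.st : ℝ) - ((P.v : ℝ) - 1) * P.sv)⌉₊

/-- The reduced problem, with one row of `U` for every `b`-pair and one row of `V` for every
`(b - 1)`-pair. -/
noncomputable def reduced (P : Problem) (b : ℕ) : Problem where
  st := P.su
  t := P.u
  xt := P.xu
  su := P.sv - (b - 1) * P.pairCount
  u := P.pairSize b
  xu := (((P.v : ℝ) - 1) * b + 1) * P.xt - b * P.xv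
  sv := b * P.pairCount - P.sv
  v := P.pairSize (b - 1)
  xv := (((P.v : ℝ) - 1) * ((b : ℝ) - 1) + 1) * P.xt - ((b : ℝ) - 1) * P.xv

/-- `RecursiveAlgorithm P F` says that the recursive algorithm, run on the problem `P`, terminates
and can return the filling `F`.  In the recursive step, `LU` and `LV` list the rows of the matrices
`U` and `V` of the solution of the reduced problem, the entries of each row being taken in any
order. -/
inductive RecursiveAlgorithm : Problem → Filling → Prop
  | zero₁ (P : Problem) (F : Filling) (hx : P.xu ≤ P.xInf) (hF : P.ZeroAlgorithm₁ F) :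
      RecursiveAlgorithm P F
  | zero₂ (P : Problem) (hx : ¬ P.xu ≤ P.xInf) (hb : ∃ b : ℕ, P.xu = P.xSeq b) :
      RecursiveAlgorithm P P.zeroAlgorithm₂
  | step (P : Problem) (F G : Filling) (LU LV : Multiset (List ℝ)) (hx : ¬ P.xu ≤ P.xInf)
      (hb : ¬ ∃ b : ℕ, P.xu = P.xSeq b)
      (hG : RecursiveAlgorithm (P.reduced P.bHat) G)
      (hLU : LU.map (fun l => (l : Multiset ℝ)) = G.U)
      (hLV : LV.map (fun l => (l : Multiset ℝ)) = G.V)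
      (hU : F.U = G.T)
      (hT : F.T = (LU.map (P.pairA P.bHat)).join + (LV.map (P.pairA (P.bHat - 1))).join)
      (hV : F.V = (LU.map (P.pairB P.bHat)).join + (LV.map (P.pairB (P.bHat - 1))).join) :
      RecursiveAlgorithm P F

end Problem

end ThreeMatrix

/-! For a value `g`, measure a row by its excess, the amount by which its sum exceeds that of a
constant row `g` of the same length. Link a row of `T` with a row of `V` when they share an entry. A
component with `k` rows of `V` has at most `(v-1)k+1` rows of `T` (`exists_components`). If equality
holds it is called a tree; it leaves `t + k·dd` entries of total excess `eT + k·eD` for `U`. Were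
all components trees, there would be `h = st-(v-1)sv` of them, with `sv/h` rows of `V` on average.

The two stopping rules of the algorithm say exactly that `h ≤ 0`, or that `sv/h` is an integer
(`xu_le_xInf_iff`, `xu_eq_xSeq_iff`). Then all entries of `U` can be set to their average `xu/u`, an
evident upper bound, and it remains to fill `V` with entries that are no smaller. Otherwise `b-1 <
sv/h < b`. The algorithm uses trees with `b` and with `b-1` rows of `V`, and contracting each tree
to the row of its remaining entries gives the reduced problem, whose source matrix is `U`. It has
fewer entries, so the recursion ends.

The value `g` of the last problem is attained (`RecursiveAlgorithm.spec`): when a pair is completed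
from entries that are at least `g`, the new entries are at least `g` too, because a further row of
`V` does not increase the excess of a tree, `eD g ≤ 0`, or else `b = 1` and the given entries are
not too large (`eD_nonpos_or`, `IsStep.extend`).

No solution is better (`Value.le`). Suppose that all entries of some solution are at least `q > g`.
A tree with more than `b` rows of `V`, or a component that is not a tree, would leave entries of
negative excess for `U` (`IsForest.tree_eq`). A tree with fewer than `b-1` rows would leave more
excess than the rows of `U` that cover its entries possess (`IsTree.cover`). So every component is a
tree with `b-1` or `b` rows of `V`, and contraction gives a solution of the reduced problem with
entries at least `q`, which contradicts induction. Both halves rest on inequalities between excesses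
along the recursion, above all `2·eU ≤ eV` (`two_mul_eU_le_eV`). Problems close to the end of the
recursion, where these may fail, are treated separately. -/

namespace ThreeMatrix

/-! ### Multisets -/

section Multisets

variable {α β : Type*}

/-- A summand `f r` is kept only if the summands treated before do not cover `X` without it. It then
accounts for at least one element of `X`, so at most `X.card` summands are kept. -/
lemma exists_le_card_le_sum_map [DecidableEq β] (f : α → Multiset β) (R : Multiset α) :
    ∀ X : Multiset β, X ≤ (R.map f).sum →
      ∃ R' ≤ R, R'.card ≤ X.card ∧ X ≤ (R'.map f).sum := by
  induction R using Multiset.induction_on with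
  | empty =>
    intro X hX
    exact ⟨0, le_rfl, by simp, hX⟩
  | cons r R ih =>
    intro X hX
    rw [Multiset.map_cons, Multiset.sum_cons] at hX
    by_cases h : X ≤ (R.map f).sum
    · obtain ⟨R', h1, h2, h3⟩ := ih X h
      exact ⟨R', h1.trans (Multiset.le_cons_self _ _), h2, h3⟩
    · have hX' : X - f r ≤ (R.map f).sum := by
        rwa [tsub_le_iff_left]
      obtain ⟨R', h1, h2, h3⟩ := ih _ hX'
      refine ⟨r ::ₘ R', Multiset.cons_le_cons _ h1, ?_, ?_⟩
      · rw [Multiset.card_cons]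
        have hlt : X - f r < X := by
          refine lt_of_le_of_ne tsub_le_self fun he => h ?_
          rwa [he] at hX'
        exact lt_of_le_of_lt h2 (Multiset.card_lt_card hlt)
      · rw [Multiset.map_cons, Multiset.sum_cons]
        exact tsub_le_iff_left.mp h3

lemma exists_le_card_le_join [DecidableEq β] (R : Multiset (Multiset β)) (X : Multiset β)
    (h : X ≤ R.join) : ∃ R' ≤ R, R'.card ≤ X.card ∧ X ≤ R'.join := by
  have := exists_le_card_le_sum_map (fun r => r) R X (by simpa [Multiset.join] using h)
  simpa [Multiset.join] using this

lemma join_sum (C : Multiset (Multiset (Multiset β))) :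
    C.sum.join = (C.map Multiset.join).sum := by
  induction C using Multiset.induction_on with
  | empty => simp
  | cons a C ih => simp [ih]

lemma sum_map_sub [DecidableEq β] (C : Multiset α) (f g : α → Multiset β)
    (h : ∀ c ∈ C, g c ≤ f c) :
    (C.map fun c => f c - g c).sum = (C.map f).sum - (C.map g).sum := by
  have key : (C.map fun c => f c - g c).sum + (C.map g).sum = (C.map f).sum := by
    rw [← Multiset.sum_map_add]
    refine congrArg _ (Multiset.map_congr rfl fun c hc => ?_)
    exact tsub_add_cancel_of_le (h c hc)
  rw [← key, add_tsub_cancel_right]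

/-- The rows of `T` and `V` fall into groups such that the entries of the rows of `V` in a group
are entries of the rows of `T` in the group, and such that every group has at most as many rows of
`T` as a tree. -/
lemma exists_components [DecidableEq β] {v : ℕ} (hv : 1 ≤ v) (T V : Multiset (Multiset β))
    (hV : ∀ r ∈ V, r.card = v) (h : V.join ≤ T.join) :
    ∃ C : Multiset (Multiset (Multiset β) × Multiset (Multiset β)),
      (C.map Prod.fst).sum = T ∧ (C.map Prod.snd).sum = V ∧
      ∀ c ∈ C, c.2.join ≤ c.1.join ∧ 1 ≤ c.1.card ∧ c.1.card ≤ (v - 1) * c.2.card + 1 := by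
  induction V using Multiset.induction_on with
  | empty =>
    refine ⟨T.map fun r => ({r}, 0), ?_, ?_, ?_⟩
    · simp [Multiset.map_map, Multiset.sum_map_singleton]
    · simp [Multiset.map_map]
    · intro c hc
      obtain ⟨r, -, rfl⟩ := Multiset.mem_map.mp hc
      simp
  | cons r V ih =>
    rw [Multiset.join_cons] at h
    obtain ⟨C, h1, h2, h3⟩ := ih (fun s hs => hV s (Multiset.mem_cons_of_mem hs))
      (le_trans (Multiset.le_add_left _ _) h)
    -- The entries still free in the groups are together those of `T` not used by the earlier rows
    -- of `V`, so they contain the new row `r`.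
    have hfree : (C.map fun c => c.1.join - c.2.join).sum = T.join - V.join := by
      rw [sum_map_sub _ _ _ fun c hc => (h3 c hc).1, ← h1, ← h2, join_sum, join_sum,
        Multiset.map_map, Multiset.map_map]
      rfl
    -- At most `v` groups supply the entries of `r`. They are merged into one group, to which `r` is
    -- added.
    obtain ⟨C', hC', hcard, hr⟩ := exists_le_card_le_sum_map
      (fun c : Multiset (Multiset β) × Multiset (Multiset β) => c.1.join - c.2.join) C r (by
        rw [hfree]; exact le_tsub_of_add_le_right h)
    obtain ⟨D, rfl⟩ := Multiset.le_iff_exists_add.mp hC'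
    have h3' : ∀ c ∈ C', c.2.join ≤ c.1.join ∧ 1 ≤ c.1.card ∧
        c.1.card ≤ (v - 1) * c.2.card + 1 :=
      fun c hc => h3 c (Multiset.mem_add.mpr (Or.inl hc))
    have hrv : r.card = v := hV r (Multiset.mem_cons_self _ _)
    refine ⟨((C'.map Prod.fst).sum, r ::ₘ (C'.map Prod.snd).sum) ::ₘ D, ?_, ?_, ?_⟩
    · rw [← h1]; simp
    · rw [← h2]; simp
    · intro c hc
      rcases Multiset.mem_cons.mp hc with rfl | hc
      · refine ⟨?_, ?_, ?_⟩
        · rw [Multiset.join_cons, join_sum, join_sum, Multiset.map_map, Multiset.map_map]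
          rw [sum_map_sub _ _ _ fun c hc => (h3' c hc).1] at hr
          have hle : (C'.map fun c => c.2.join).sum ≤ (C'.map fun c => c.1.join).sum := by
            exact Multiset.sum_map_le_sum_map _ _ fun c hc => (h3' c hc).1
          have := add_le_of_le_tsub_right_of_le hle hr
          simpa [Function.comp_def] using this
        · have hne : C' ≠ 0 := by
            rintro rfl
            simp only [Multiset.map_zero, Multiset.sum_zero, nonpos_iff_eq_zero] at hr
            simp [hr] at hrv
            omega
          obtain ⟨c, hc⟩ := Multiset.exists_mem_of_ne_zero hne
          obtain ⟨E, rfl⟩ := Multiset.exists_cons_of_mem hc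
          have := (h3' c hc).2.1
          simp
          omega
        -- Merging `m ≤ v` groups gives at most `(v-1)·∑k + m` rows of `T`, and `m ≤ (v-1) + 1`,
        -- which is the bound for one more row of `V`.
        · have hs : ∀ E : Multiset (Multiset (Multiset β) × Multiset (Multiset β)),
              (∀ c ∈ E, c.1.card ≤ (v - 1) * c.2.card + 1) →
              (E.map Prod.fst).sum.card ≤ (v - 1) * (E.map Prod.snd).sum.card + E.card := by
            intro E
            induction E using Multiset.induction_on with
            | empty => simp
            | cons a E ihE =>
              intro hE
              have e1 := ihE fun c hc => hE c (Multiset.mem_cons_of_mem hc)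
              have e2 := hE a (Multiset.mem_cons_self _ _)
              simp only [Multiset.map_cons, Multiset.sum_cons, Multiset.card_add,
                Multiset.card_cons]
              nlinarith
          have := hs C' fun c hc => (h3' c hc).2.2
          rw [Multiset.card_cons]
          dsimp only
          have e : (v - 1) * ((C'.map Prod.snd).sum.card + 1) + 1
            = (v - 1) * (C'.map Prod.snd).sum.card + v := by
            rw [Nat.mul_add]; omega
          omega
      · exact h3 c (Multiset.mem_add.mpr (Or.inr hc))

lemma exists_add_card_eq (k : ℕ) (M : Multiset α) (h : k ≤ M.card) :
    ∃ A B : Multiset α, M = A + B ∧ A.card = k := by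
  induction M using Quotient.inductionOn with
  | h l =>
    refine ⟨(l.take k : List α), (l.drop k : List α), ?_, ?_⟩
    · simp
    · simpa using h

/-- A multiset of `n * k` elements can be cut into `n` groups of `k`. -/
lemma exists_groups (k : ℕ) : ∀ (n : ℕ) (M : Multiset α), M.card = n * k →
    ∃ G : Multiset (Multiset α), G.card = n ∧ (∀ g ∈ G, g.card = k) ∧ G.join = M := by
  intro n
  induction n with
  | zero =>
    intro M hM
    refine ⟨0, rfl, by simp, ?_⟩
    rw [Nat.zero_mul, Multiset.card_eq_zero] at hM
    simp [hM]
  | succ n ih =>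
    intro M hM
    obtain ⟨g, M', rfl, hgk⟩ := exists_add_card_eq k M (by rw [hM]; nlinarith)
    obtain ⟨G, h1, h2, h3⟩ := ih M' (by
      rw [Multiset.card_add, hgk] at hM
      nlinarith)
    refine ⟨g ::ₘ G, by simp [h1], ?_, by simp [h3]⟩
    intro x hx
    rcases Multiset.mem_cons.mp hx with rfl | hx
    · exact hgk
    · exact h2 x hx

end Multisets

/-! ### Chains of pieces -/

lemma isMatrix_map {ι : Type*} (I : Multiset ι) (f : ι → Multiset ℝ) {c : ℕ} {x : ℝ}
    (h : ∀ i ∈ I, (f i).card = c ∧ (f i).sum = x) : IsMatrix I.card c x (I.map f) := by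
  refine ⟨by simp, fun r hr => ?_⟩
  obtain ⟨i, hi, rfl⟩ := Multiset.mem_map.mp hr
  exact h i hi

lemma sinkRow_card (s : ℕ) (y z : ℕ → ℝ) (i : ℕ) : (sinkRow s y z i).card = 2 := by
  simp [sinkRow]

lemma sinkRow_sum (s : ℕ) (y z : ℕ → ℝ) (i : ℕ) : (sinkRow s y z i).sum = y i + z i := by
  simp [sinkRow]

/-- The condition `y s = y 0` says that the chain closes to a cycle. This is what gives the extra
row `[y_0, z_{s-1}]` the right sum. -/
lemma sourceRows_isMatrix {s : ℕ} (hs : 0 < s) {y z : ℕ → ℝ} {xt : ℝ}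
    (hy : ∀ i, y (i + 1) = xt - z i) (hcl : y s = y 0) :
    IsMatrix s 2 xt (sourceRows s y z) := by
  refine ⟨?_, ?_⟩
  · simp [sourceRows]
    omega
  · intro r hr
    rcases Multiset.mem_cons.mp hr with rfl | hr
    · refine ⟨by simp, ?_⟩
      have h1 := hy (s - 1)
      rw [show s - 1 + 1 = s by omega, hcl] at h1
      simp [h1]
    · obtain ⟨i, -, rfl⟩ := Multiset.mem_map.mp hr
      refine ⟨by simp, ?_⟩
      simp [hy i]

lemma sourceRows_join {s : ℕ} (hs : 0 < s) (y z : ℕ → ℝ) :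
    (sourceRows s y z).join = ((Multiset.range s).map (sinkRow s y z)).join := by
  obtain ⟨s, rfl⟩ := Nat.exists_eq_succ_of_ne_zero hs.ne'
  have key : ∀ (ε : ℝ) (n : ℕ),
      ({y 0 + ε, z n - ε} : Multiset ℝ) +
        ((Multiset.range n).map fun i => ({y (i + 1) + ε, z i - ε} : Multiset ℝ)).join =
      ((Multiset.range (n + 1)).map fun i => ({y i + ε, z i - ε} : Multiset ℝ)).join := by
    intro ε n
    induction n with
    | zero => simp
    | succ n ih =>
      rw [Multiset.range_succ (n + 1), Multiset.map_cons, Multiset.join_cons, ← ih,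
        Multiset.range_succ n, Multiset.map_cons, Multiset.join_cons]
      simp only [Multiset.insert_eq_cons, ← Multiset.singleton_add]
      abel
  have := key (shift (s + 1) y z) s
  rw [sourceRows, Multiset.join_cons]
  exact this

/-- The shift moves both minima to their mean, so a common lower bound of the `y i` and `z i`
survives. -/
lemma sinkRow_ge {s : ℕ} {y z : ℕ → ℝ} {m : ℝ} (h : ∀ i < s, m ≤ y i ∧ m ≤ z i) {i : ℕ}
    (hi : i < s) : ∀ x ∈ sinkRow s y z i, m ≤ x := by
  have : Nonempty (Fin s) := ⟨⟨i, hi⟩⟩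
  have hz : m ≤ ⨅ i : Fin s, z i := le_ciInf fun j => (h j j.2).2
  have hy : m ≤ ⨅ i : Fin s, y i := le_ciInf fun j => (h j j.2).1
  have hz' : (⨅ i : Fin s, z i) ≤ z i := ciInf_le (Set.finite_range _).bddBelow (⟨i, hi⟩ : Fin s)
  have hy' : (⨅ i : Fin s, y i) ≤ y i := ciInf_le (Set.finite_range _).bddBelow (⟨i, hi⟩ : Fin s)
  intro x hx
  simp only [sinkRow, Multiset.insert_eq_cons, Multiset.mem_cons, Multiset.mem_singleton] at hx
  rcases hx with rfl | rfl <;> simp only [shift] <;> linarith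

namespace Problem

/-! ### The greedy algorithm -/

/-- A row of `U` raises `y` by `xt - xu`, a row of `V` lowers it by `xv - xt`. The threshold in
`ToU` is the point at which exactly one of the two moves stays in the half-open interval of length
`xv - xu` centred at `xt / 2`. -/
lemma greedyY_mem (P : Problem) (h1 : P.xu < P.xt) (h2 : P.xt < P.xv) (i : ℕ) :
    (P.xt + P.xu - P.xv) / 2 ≤ P.greedyY i ∧ P.greedyY i < (P.xt + P.xv - P.xu) / 2 := by
  induction i with
  | zero => simp only [greedyY]; constructor <;> linarith
  | succ i ih =>
    rw [greedyY, partner]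
    by_cases h : P.ToU (P.greedyY i)
    · rw [if_pos h]
      unfold ToU at h
      constructor <;> linarith
    · rw [if_neg h]
      unfold ToU at h
      constructor <;> linarith

lemma greedyY_eq (P : Problem) (i : ℕ) [DecidablePred fun j => P.ToU (P.greedyY j)]
    [DecidablePred fun j => ¬ P.ToU (P.greedyY j)] :
    P.greedyY i = P.xt / 2
      + (((Multiset.range i).filter fun j => P.ToU (P.greedyY j)).card : ℝ) * (P.xt - P.xu)
      - (((Multiset.range i).filter fun j => ¬ P.ToU (P.greedyY j)).card : ℝ) * (P.xv - P.xt) := by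
  induction i with
  | zero => simp [greedyY]
  | succ i ih =>
    have e : P.greedyY (i + 1) = P.xt - P.partner (P.greedyY i) := rfl
    rw [e, Multiset.range_succ, Multiset.filter_cons, Multiset.filter_cons]
    simp only [partner]
    by_cases h : P.ToU (P.greedyY i)
    · simp [h]; linarith
    · simp [h]; linarith

/-- `greedy` never asks whether a row of the desired kind is left. If `U` is chosen `k` times in
`st` steps, the last piece is `xt/2 + (k - su)(xv - xu)`, and the interval of `greedyY_mem` allows
only `k = su`. The chain then closes as well. -/
lemma card_filter_toU (P : Problem) (hst : P.st = P.su + P.sv) (h1 : P.xu < P.xt)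
    (h2 : P.xt < P.xv) (hsum : P.su * P.xu + P.sv * P.xv = P.st * P.xt)
    [DecidablePred fun j => P.ToU (P.greedyY j)]
    [DecidablePred fun j => ¬ P.ToU (P.greedyY j)] :
    ((Multiset.range P.st).filter fun j => P.ToU (P.greedyY j)).card = P.su ∧
    ((Multiset.range P.st).filter fun j => ¬ P.ToU (P.greedyY j)).card = P.sv ∧
    P.greedyY P.st = P.greedyY 0 := by
  have htot : ((Multiset.range P.st).filter fun j => P.ToU (P.greedyY j)).card +
      ((Multiset.range P.st).filter fun j => ¬ P.ToU (P.greedyY j)).card = P.su + P.sv := by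
    rw [← hst, ← Multiset.card_add, ← Multiset.card_range P.st]
    have := Multiset.filter_add_not (fun j => P.ToU (P.greedyY j)) (Multiset.range P.st)
    rw [Multiset.card_range]
    conv_rhs => rw [← Multiset.card_range P.st, ← this]
    congr
  have hY := P.greedyY_eq P.st
  have hb := P.greedyY_mem h1 h2 P.st
  set k := ((Multiset.range P.st).filter fun j => P.ToU (P.greedyY j)).card with hk
  set l := ((Multiset.range P.st).filter fun j => ¬ P.ToU (P.greedyY j)).card with hl
  have hst' : (P.st : ℝ) = P.su + P.sv := by exact_mod_cast hst
  have htot' : (k : ℝ) + l = P.su + P.sv := by exact_mod_cast htot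
  have e : P.greedyY P.st = P.xt / 2 + ((k : ℝ) - P.su) * (P.xv - P.xu) := by
    rw [hY]
    have : (l : ℝ) = P.su + P.sv - k := by linarith
    rw [this]
    rw [hst'] at hsum
    linear_combination -hsum
  have hkk : k = P.su := by
    rcases lt_trichotomy k P.su with h | h | h
    · have : (k : ℝ) + 1 ≤ P.su := by exact_mod_cast h
      nlinarith
    · exact h
    · have : (P.su : ℝ) + 1 ≤ k := by exact_mod_cast h
      nlinarith
  refine ⟨hkk, by omega, ?_⟩
  rw [e, hkk]
  simp [greedyY]

/-- The greedy algorithm produces feasible solutions without small pieces. -/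
lemma greedy_spec (P : Problem) (hst : P.st = P.su + P.sv) (hpos : 0 < P.st) (h1 : P.xu < P.xt)
    (h2 : P.xt < P.xv) (hsum : P.su * P.xu + P.sv * P.xv = P.st * P.xt) :
    IsMatrix P.st 2 P.xt P.greedy.T ∧ IsMatrix P.su 2 P.xu P.greedy.U ∧
    IsMatrix P.sv 2 P.xv P.greedy.V ∧ P.greedy.T.join = P.greedy.U.join + P.greedy.V.join ∧
    ∀ x ∈ P.greedy.T.join, (P.xt + P.xu - P.xv) / 2 ≤ x := by
  classical
  obtain ⟨hU, hV, hcl⟩ := P.card_filter_toU hst h1 h2 hsum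
  have hjoin := sourceRows_join hpos P.greedyY P.greedyZ
  refine ⟨sourceRows_isMatrix hpos (fun i => rfl) hcl, ?_, ?_, ?_, ?_⟩
  · have := isMatrix_map ((Multiset.range P.st).filter fun i => P.ToU (P.greedyY i))
      (sinkRow P.st P.greedyY P.greedyZ) (c := 2) (x := P.xu) (fun i hi => ?_)
    · rw [hU] at this
      convert this
      simp only [greedy]
    · refine ⟨sinkRow_card _ _ _ _, ?_⟩
      rw [sinkRow_sum, greedyZ, partner, if_pos (Multiset.mem_filter.mp hi).2]
      ring
  · have := isMatrix_map ((Multiset.range P.st).filter fun i => ¬ P.ToU (P.greedyY i))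
      (sinkRow P.st P.greedyY P.greedyZ) (c := 2) (x := P.xv) (fun i hi => ?_)
    · rw [hV] at this
      convert this
      simp only [greedy]
    · refine ⟨sinkRow_card _ _ _ _, ?_⟩
      rw [sinkRow_sum, greedyZ, partner, if_neg (Multiset.mem_filter.mp hi).2]
      ring
  · simp only [greedy]
    rw [hjoin, ← Multiset.join_add, ← Multiset.map_add, Multiset.filter_add_not]
  · intro x hx
    simp only [greedy] at hx
    rw [hjoin, Multiset.mem_join] at hx
    obtain ⟨r, hr, hx⟩ := hx
    obtain ⟨i, hi, rfl⟩ := Multiset.mem_map.mp hr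
    refine sinkRow_ge (fun j hj => ⟨(P.greedyY_mem h1 h2 j).1, ?_⟩) (Multiset.mem_range.mp hi) x hx
    -- Since `z_j = xt - y_{j+1}`, the upper bound for the next `y` is a lower bound for `z_j`.
    have e : P.greedyY (j + 1) = P.xt - P.greedyZ j := rfl
    have := (P.greedyY_mem h1 h2 (j + 1)).2
    linarith

end Problem

/-! ### Joining pairs to rows -/

lemma IsGrouping.join {k n : ℕ} {M T : Rows} (h : IsGrouping k n M T) : T.join = M.join := by
  obtain ⟨G, -, -, rfl, rfl⟩ := h
  exact (join_sum G).symm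

lemma IsGrouping.isMatrix {k n c : ℕ} {x : ℝ} {M T : Rows} (h : IsGrouping k n M T)
    (hM : ∀ r ∈ M, r.card = c ∧ r.sum = x) : IsMatrix n (k * c) (k * x) T := by
  obtain ⟨G, rfl, hk, rfl, rfl⟩ := h
  refine isMatrix_map G _ fun g hg => ?_
  have hgM : ∀ r ∈ g, r.card = c ∧ r.sum = x := fun r hr =>
    hM r (Multiset.mem_join.mpr ⟨g, hg, hr⟩)
  rw [← hk g hg]
  clear hk hM hg
  induction g using Multiset.induction_on with
  | empty => simp
  | cons r g ih =>
    have e := ih fun s hs => hgM s (Multiset.mem_cons_of_mem hs)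
    have e' := hgM r (Multiset.mem_cons_self _ _)
    rw [Multiset.join_cons, Multiset.card_add, Multiset.sum_add, e.1, e.2, e'.1, e'.2,
      Multiset.card_cons]
    refine ⟨by ring, ?_⟩
    push_cast
    ring

lemma exists_isGrouping {k n : ℕ} {M : Rows} (h : M.card = n * k) : ∃ T, IsGrouping k n M T := by
  obtain ⟨G, h1, h2, h3⟩ := exists_groups k n M h
  exact ⟨_, G, h1, h2, h3, rfl⟩

/-! ### The greedy algorithm for arbitrary demands -/

/-- `D` holds the demands of the unused sinks and `L` bounds their spread. If `d` is not the largest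
demand, the inequality defining the choice bounds the next piece above; if `d` is not the smallest,
the failure of that inequality at a smaller demand bounds it below. For extreme `d` the hypotheses
`hpos` and `hneg` take over. -/
lemma abs_chain_step {L xt y : ℝ} {D : Set ℝ} {d s : ℝ} (hD : D.Finite)
    (hL : ∀ a ∈ D, ∀ b ∈ D, a - b ≤ L) (hg : IsGreedyChoice xt D y d)
    (hy : |y - xt / 2| ≤ L / 2)
    (hpos : (∀ c ∈ D, xt ≤ c) → d - xt ≤ y - xt / 2)
    (hneg : (∀ c ∈ D, c ≤ xt) → y - xt / 2 ≤ d - xt) (hs : s = y + (xt - d)) :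
    |s - xt / 2| ≤ L / 2 := by
  obtain ⟨⟨hd, hcond⟩, hleast⟩ := hg
  rw [abs_le] at hy ⊢
  subst hs
  constructor
  · by_contra! hlt
    by_cases hmin : ∀ c ∈ D, d ≤ c
    · have := hpos fun c hc => by linarith [hmin c hc]
      have h0 : 0 ≤ L := by simpa using hL d hd d hd
      linarith
    · push Not at hmin
      obtain ⟨c₀, hc₀, hc₀d⟩ := hmin
      -- `c` is the demand just below `d`. It was not chosen, so some larger demand `e`, necessarily
      -- with `e ≥ d`, has `y ≥ (c + e - xt)/2`.
      obtain ⟨c, ⟨hcD, hcd⟩, hcmax⟩ := Set.exists_max_image (D ∩ Set.Iio d) id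
        (hD.subset Set.inter_subset_left) ⟨c₀, hc₀, hc₀d⟩
      have hnc : ¬ ∀ e ∈ D, c < e → y < (c + e - xt) / 2 := fun h =>
        absurd (hleast ⟨hcD, h⟩) (not_le.mpr hcd)
      push Not at hnc
      obtain ⟨e, heD, hce, hye⟩ := hnc
      have hed : d ≤ e := by
        by_contra! h
        exact absurd (hcmax e ⟨heD, h⟩) (not_le.mpr hce)
      have := hL d hd c hcD
      linarith
  · by_cases hmax : ∀ c ∈ D, c ≤ d
    · rcases le_total xt d with h | h
      · linarith
      · have := hneg fun c hc => (hmax c hc).trans h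
        have h0 : 0 ≤ L := by simpa using hL d hd d hd
        linarith
    · push Not at hmax
      obtain ⟨e, he, hde⟩ := hmax
      have h1 := hcond e he hde
      have h2 := hL e he d hd
      linarith

/-- The deviation of `y_i` from `xt / 2` is the surplus of all sinks not yet served. Its sign is
therefore known when all their demands lie on one side of `xt`, as `abs_chain_step` requires; for `i
= card ι` the sum is empty and the chain closes. -/
lemma chainY_bound {ι : Type} [Fintype ι] {xt L : ℝ} {x : ι → ℝ}
    (σ : Fin (Fintype.card ι) ≃ ι) {d : ℕ → ℝ}
    (hd : ∀ i : Fin (Fintype.card ι), d i = x (σ i))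
    (hg : ∀ i, IsGreedyChoice xt {c | ∃ j, i ≤ j ∧ x (σ j) = c} (chainY xt d i) (x (σ i)))
    (hL0 : 0 ≤ L) (hL : ∀ i j, x i - x j ≤ L) (hsum : ∑ i, x i = Fintype.card ι * xt) :
    ∀ i ≤ Fintype.card ι,
      chainY xt d i - xt / 2 = ∑ j ∈ Finset.Ico i (Fintype.card ι), (d j - xt) ∧
      |chainY xt d i - xt / 2| ≤ L / 2 := by
  intro i
  induction i with
  | zero =>
    intro _
    have h0 : ∑ j ∈ Finset.Ico 0 (Fintype.card ι), (d j - xt) = 0 := by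
      rw [← Finset.range_eq_Ico, ← Fin.sum_univ_eq_sum_range (fun j => d j - xt)]
      have : ∑ j : Fin (Fintype.card ι), (d j - xt) = ∑ i, (x i - xt) := by
        rw [← Equiv.sum_comp σ (fun i => x i - xt)]
        exact Finset.sum_congr rfl fun j _ => by rw [hd]
      rw [this, Finset.sum_sub_distrib, hsum]
      simp
    rw [h0]
    simp [chainY]
    linarith
  | succ i ih =>
    intro hi
    obtain ⟨h1, h2⟩ := ih (by omega)
    have hi' : i < Fintype.card ι := hi
    rw [Finset.sum_eq_sum_Ico_succ_bot hi'] at h1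
    have e : chainY xt d (i + 1) = chainY xt d i + (xt - d i) := by simp only [chainY]; ring
    refine ⟨by rw [e]; linarith, ?_⟩
    have hdi : d i = x (σ ⟨i, hi'⟩) := hd ⟨i, hi'⟩
    have hmem : ∀ j ∈ Finset.Ico (i + 1) (Fintype.card ι),
        d j ∈ {c | ∃ j, (⟨i, hi'⟩ : Fin (Fintype.card ι)) ≤ j ∧ x (σ j) = c} := by
      intro j hj
      rw [Finset.mem_Ico] at hj
      exact ⟨⟨j, hj.2⟩, by rw [Fin.le_def]; simp; omega, (hd ⟨j, hj.2⟩).symm⟩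
    refine abs_chain_step (Set.Finite.subset (Set.finite_range fun j => x (σ j)) ?_) ?_
      (hg ⟨i, hi'⟩) h2 ?_ ?_ (by rw [e, hdi])
    · rintro c ⟨j, -, rfl⟩
      exact ⟨j, rfl⟩
    · rintro a ⟨j, -, rfl⟩ b ⟨k, -, rfl⟩
      exact hL _ _
    · intro h
      have : 0 ≤ ∑ j ∈ Finset.Ico (i + 1) (Fintype.card ι), (d j - xt) :=
        Finset.sum_nonneg fun j hj => by linarith [h _ (hmem j hj)]
      dsimp only
      linarith
    · intro h
      have : ∑ j ∈ Finset.Ico (i + 1) (Fintype.card ι), (d j - xt) ≤ 0 :=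
        Finset.sum_nonpos fun j hj => by linarith [h _ (hmem j hj)]
      dsimp only
      linarith

/-- The greedy algorithm for arbitrary demands produces feasible solutions without small pieces. -/
lemma GeneralGreedy.spec {ι : Type} [Fintype ι] {xt L : ℝ} {x : ι → ℝ} {T : Rows}
    {R : ι → Multiset ℝ} (h : GeneralGreedy xt x T R) (hpos : 0 < Fintype.card ι)
    (hL0 : 0 ≤ L) (hL : ∀ i j, x i - x j ≤ L) (hsum : ∑ i, x i = Fintype.card ι * xt) :
    IsMatrix (Fintype.card ι) 2 xt T ∧ (∀ i, (R i).card = 2 ∧ (R i).sum = x i) ∧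
    T.join = ∑ i, R i ∧ ∀ y ∈ T.join, (xt - L) / 2 ≤ y := by
  obtain ⟨σ, d, hd, hg, rfl, hR⟩ := h
  have hb := chainY_bound σ hd hg hL0 hL hsum
  have hjoin := sourceRows_join hpos (chainY xt d) (fun i => d i - chainY xt d i)
  have hcl : chainY xt d (Fintype.card ι) = chainY xt d 0 := by
    have := (hb _ le_rfl).1
    simp only [Finset.Ico_self, Finset.sum_empty] at this
    simp only [chainY]
    linarith
  refine ⟨sourceRows_isMatrix hpos (fun i => rfl) hcl, ?_, ?_, ?_⟩
  · intro i
    obtain ⟨i, rfl⟩ := σ.surjective i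
    rw [hR, sinkRow_card, sinkRow_sum, hd]
    exact ⟨rfl, by ring⟩
  · rw [hjoin, ← Equiv.sum_comp σ R]
    simp_rw [hR]
    rw [Fin.sum_univ_eq_sum_range
      (fun i => sinkRow (Fintype.card ι) (chainY xt d) (fun i => d i - chainY xt d i) i)]
    rfl
  · intro y hy
    rw [hjoin, Multiset.mem_join] at hy
    obtain ⟨r, hr, hy⟩ := hy
    obtain ⟨i, hi, rfl⟩ := Multiset.mem_map.mp hr
    refine sinkRow_ge (fun j hj => ⟨?_, ?_⟩) (Multiset.mem_range.mp hi) y hy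
    · have := (abs_le.mp (hb j hj.le).2).1
      linarith
    · have := (abs_le.mp (hb (j + 1) hj).2).2
      have e : chainY xt d (j + 1) = xt - (d j - chainY xt d j) := rfl
      linarith

lemma chainY_congr {xt : ℝ} {d d' : ℕ → ℝ} {k : ℕ} (h : ∀ i < k, d i = d' i) :
    chainY xt d k = chainY xt d' k := by
  induction k with
  | zero => rfl
  | succ k ih =>
    simp only [chainY]
    rw [ih fun i hi => h i (by omega), h k (by omega)]

/-- The largest element of `D` satisfies the condition vacuously. -/
lemma exists_isGreedyChoice {D : Set ℝ} (hD : D.Finite) (hne : D.Nonempty) (xt y : ℝ) :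
    ∃ d, IsGreedyChoice xt D y d := by
  obtain ⟨M, hM, hmax⟩ := Set.exists_max_image D id hD hne
  obtain ⟨d, hd, hmin⟩ := Set.exists_min_image
    {c : ℝ | c ∈ D ∧ ∀ e ∈ D, c < e → y < (c + e - xt) / 2} id
    (hD.subset fun c hc => hc.1) ⟨M, hM, fun e he hlt => absurd (hmax e he) (not_le.mpr hlt)⟩
  exact ⟨d, hd, fun c hc => hmin c hc⟩

/-- The order of service is built by transpositions: the sink selected in step `k` is swapped into
position `k`. This changes neither the earlier positions nor the set of sinks available at any
earlier step. `seq` extends the list of demands by zeros. -/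
lemma exists_generalGreedy {ι : Type} [Fintype ι] (xt : ℝ) (x : ι → ℝ) :
    ∃ (T : Rows) (R : ι → Multiset ℝ), GeneralGreedy xt x T R := by
  classical
  let n := Fintype.card ι
  let seq : (Fin n ≃ ι) → ℕ → ℝ := fun σ i => if h : i < n then x (σ ⟨i, h⟩) else 0
  have key : ∀ k ≤ n, ∃ σ : Fin n ≃ ι, ∀ i : Fin n, (i : ℕ) < k →
      IsGreedyChoice xt {c | ∃ j, i ≤ j ∧ x (σ j) = c} (chainY xt (seq σ) i) (x (σ i)) := by
    intro k
    induction k with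
    | zero => exact fun _ => ⟨(Fintype.equivFin ι).symm, fun i hi => absurd hi (by omega)⟩
    | succ k ih =>
      intro hk
      obtain ⟨σ, hσ⟩ := ih (by omega)
      let k' : Fin n := ⟨k, hk⟩
      have hfin : ∀ i : Fin n, {c | ∃ j, i ≤ j ∧ x (σ j) = c}.Finite := fun i =>
        Set.Finite.subset (Set.finite_range fun j => x (σ j)) (by
          rintro c ⟨j, -, rfl⟩
          exact ⟨j, rfl⟩)
      obtain ⟨d, hd⟩ := exists_isGreedyChoice (hfin k') ⟨_, k', le_rfl, rfl⟩ xt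
        (chainY xt (seq σ) k)
      obtain ⟨j, hj, hjd⟩ := hd.1.1
      have hfix : ∀ i : Fin n, i < k' → Equiv.swap k' j i = i := fun i hi =>
        Equiv.swap_apply_of_ne_of_ne hi.ne (hi.trans_le hj).ne
      have hle : ∀ i l : Fin n, i ≤ k' → i ≤ l → i ≤ Equiv.swap k' j l := by
        intro i l hi hl
        rcases eq_or_ne l k' with rfl | h1
        · rw [Equiv.swap_apply_left]; exact hi.trans hj
        rcases eq_or_ne l j with rfl | h2
        · rwa [Equiv.swap_apply_right]
        · rwa [Equiv.swap_apply_of_ne_of_ne h1 h2]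
      refine ⟨(Equiv.swap k' j).trans σ, fun i hi => ?_⟩
      have hik : i ≤ k' := by rw [Fin.le_def]; simp [k']; omega
      have hset : {c | ∃ l, i ≤ l ∧ x (((Equiv.swap k' j).trans σ) l) = c} =
          {c | ∃ l, i ≤ l ∧ x (σ l) = c} := by
        ext c
        constructor
        · rintro ⟨l, hl, rfl⟩
          exact ⟨Equiv.swap k' j l, hle i l hik hl, rfl⟩
        · rintro ⟨l, hl, rfl⟩
          refine ⟨Equiv.swap k' j l, hle i l hik hl, ?_⟩
          simp
      have hchain : chainY xt (seq ((Equiv.swap k' j).trans σ)) i = chainY xt (seq σ) i := by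
        refine chainY_congr fun l hl => ?_
        have hln : l < n := by omega
        simp only [seq, hln, dif_pos, Equiv.trans_apply]
        rw [hfix]
        rw [Fin.lt_def]
        simp only [k']
        omega
      rw [hset, hchain]
      rcases hik.lt_or_eq with hlt | rfl
      · rw [Equiv.trans_apply, hfix i hlt]
        exact hσ i hlt
      · rw [Equiv.trans_apply, Equiv.swap_apply_left, hjd]
        exact hd
  obtain ⟨σ, hσ⟩ := key n le_rfl
  refine ⟨_, fun a => sinkRow n (chainY xt (seq σ)) (fun i => seq σ i - chainY xt (seq σ) i)
    (σ.symm a), σ, seq σ, ?_, fun i => hσ i i.2, rfl, ?_⟩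
  · intro i
    simp [seq, n]
  · intro i
    simp
    rfl

/-! ### Rows of even length -/

lemma IsMatrix.add_const {s c : ℕ} {x : ℝ} {M : Rows} (h : IsMatrix s c x M) (r : Multiset ℝ) :
    IsMatrix s (c + r.card) (x + r.sum) (M.map fun a => a + r) := by
  obtain ⟨rfl, h⟩ := h
  refine isMatrix_map M _ fun a ha => ?_
  rw [Multiset.card_add, Multiset.sum_add, (h a ha).1, (h a ha).2]
  exact ⟨rfl, rfl⟩

lemma IsMatrix.add_replicate {s c n c' : ℕ} {x μ x' : ℝ} {M : Rows} (h : IsMatrix s c x M)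
    (hc : c + n = c') (hx : x + n * μ = x') :
    IsMatrix s c' x' (M.map fun a => a + Multiset.replicate n μ) := by
  have := h.add_const (Multiset.replicate n μ)
  simp only [Multiset.card_replicate, Multiset.sum_replicate, nsmul_eq_mul] at this
  rwa [hc, hx] at this

lemma IsMatrix.cons {s c c' : ℕ} {x μ x' : ℝ} {M : Rows} (h : IsMatrix s c x M)
    (hc : c + 1 = c') (hx : x + μ = x') :
    IsMatrix s c' x' (M.map fun a => μ ::ₘ a) := by
  have := h.add_const {μ}
  simp only [Multiset.card_singleton, Multiset.sum_singleton, hc, hx] at this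
  convert this using 3
  rw [add_comm, Multiset.singleton_add]

lemma isMatrix_replicate {s c : ℕ} {x : ℝ} {r : Multiset ℝ} (hc : r.card = c) (hx : r.sum = x) :
    IsMatrix s c x (Multiset.replicate s r) := by
  refine ⟨by simp, fun a ha => ?_⟩
  rw [Multiset.eq_of_mem_replicate ha]
  exact ⟨hc, hx⟩

lemma IsMatrix.add {s s' c : ℕ} {x : ℝ} {M N : Rows} (hM : IsMatrix s c x M)
    (hN : IsMatrix s' c x N) : IsMatrix (s + s') c x (M + N) := by
  refine ⟨by rw [Multiset.card_add, hM.1, hN.1], fun r hr => ?_⟩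
  rcases Multiset.mem_add.mp hr with h | h
  · exact hM.2 r h
  · exact hN.2 r h

lemma join_map_add_const (M : Rows) (r : Multiset ℝ) :
    (M.map fun a => a + r).join = M.join + M.card • r := by
  induction M using Multiset.induction_on with
  | empty => simp
  | cons a M ih =>
    rw [Multiset.map_cons, Multiset.join_cons, ih, Multiset.join_cons, Multiset.card_cons, succ_nsmul]
    abel

lemma join_map_cons (M : Rows) (μ : ℝ) :
    (M.map fun a => μ ::ₘ a).join = M.join + Multiset.replicate M.card μ := by
  have := join_map_add_const M {μ}
  rw [Multiset.nsmul_singleton] at this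
  rw [← this]
  congr 1
  refine Multiset.map_congr rfl fun a _ => ?_
  rw [add_comm, Multiset.singleton_add]

lemma join_map_add_replicate (M : Rows) (n : ℕ) (μ : ℝ) :
    (M.map fun a => a + Multiset.replicate n μ).join =
      M.join + Multiset.replicate (M.card * n) μ := by
  rw [join_map_add_const, ← Multiset.nsmul_singleton, smul_smul, Multiset.nsmul_singleton]

lemma join_replicate (n : ℕ) (r : Multiset ℝ) :
    (Multiset.replicate n r : Rows).join = n • r := by
  rw [Multiset.join, Multiset.sum_replicate]

lemma join_replicate_replicate (s n : ℕ) (μ : ℝ) :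
    (Multiset.replicate s (Multiset.replicate n μ) : Rows).join = Multiset.replicate (s * n) μ := by
  rw [Multiset.join, Multiset.sum_replicate, ← Multiset.nsmul_singleton, smul_smul,
    Multiset.nsmul_singleton]

lemma lt_average {a b c p q : ℝ} (hp : 0 < p) (hq : 0 < q) (hab : a < b)
    (h : p * a + q * b = (p + q) * c) : a < c ∧ c < b := by
  constructor <;> by_contra! hc
  · nlinarith
  · nlinarith

namespace Problem

/-- As `t` is even, so is the number of constant entries outside the two-column subproblem, and the
division by 2 in the algorithm is exact. -/
lemma evenAlgorithm_card {P : Problem} (ht : Even P.t) (hu : 2 ≤ P.u) (hv : 2 ≤ P.v)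
    (he : P.su * P.u + P.sv * P.v = P.st * P.t) :
    P.su + P.sv + ((P.u - 2) * P.su + (P.v - 2) * P.sv) / 2 = P.st * (P.t / 2) ∧
    2 * (((P.u - 2) * P.su + (P.v - 2) * P.sv) / 2) = P.su * (P.u - 2) + P.sv * (P.v - 2) := by
  obtain ⟨k, hk⟩ := ht
  have e1 : P.su * P.u = (P.u - 2) * P.su + 2 * P.su := by
    rw [← add_mul, Nat.sub_add_cancel hu, mul_comm]
  have e2 : P.sv * P.v = (P.v - 2) * P.sv + 2 * P.sv := by
    rw [← add_mul, Nat.sub_add_cancel hv, mul_comm]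
  have e3 : P.st * P.t = 2 * (P.st * k) := by rw [hk]; ring
  rw [show P.t / 2 = k by omega, mul_comm P.su (P.u - 2), mul_comm P.sv (P.v - 2)]
  omega

/-- Let `γ = xt/t`. The two-column subproblem has row sum `2γ`, and its demands differ by the
difference of the excesses of a row of `U` and a row of `V` over `γ`. So `greedy_spec` bounds the
pieces below by `γ` plus half of that negative difference; `m ≤ xt/t` takes care of the constant
pieces. -/
lemma EvenAlgorithm.spec {P : Problem} {F : Filling} (h : P.EvenAlgorithm F) (ht : Even P.t)
    (hu : 2 ≤ P.u) (hv : 2 ≤ P.v) (hsu : 0 < P.su) (hsv : 0 < P.sv)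
    (he : P.su * P.u + P.sv * P.v = P.st * P.t)
    (hs : P.su * P.xu + P.sv * P.xv = P.st * P.xt)
    (hlt : P.xu - P.u * (P.xt / P.t) < P.xv - P.v * (P.xt / P.t)) :
    P.IsFeasible F ∧ ∀ m, m ≤ P.xt / P.t →
      2 * m ≤ 2 * (P.xt / P.t) + (P.xu - P.u * (P.xt / P.t)) - (P.xv - P.v * (P.xt / P.t)) →
      ∀ y ∈ F.T.join, m ≤ y := by
  obtain ⟨hT, hU, hV⟩ := h
  have htt : 0 < P.st * P.t := by
    rw [← he]
    have : 0 < P.su * P.u := Nat.mul_pos hsu (by omega)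
    omega
  have htpos : 0 < P.t := Nat.pos_of_mul_pos_left htt
  have ht0 : (P.t : ℝ) ≠ 0 := by positivity
  set γ := P.xt / P.t with hγ
  have hxt : P.xt = P.t * γ := by rw [hγ]; field_simp
  have he' : (P.su : ℝ) * P.u + P.sv * P.v = P.st * P.t := by exact_mod_cast he
  have hsub : ((P.su : ℝ) * (P.xu - ((P.u : ℝ) - 2) * γ) + P.sv * (P.xv - ((P.v : ℝ) - 2) * γ)) =
      (P.su + P.sv) * (2 * γ) := by
    rw [hxt] at hs
    linear_combination hs - γ * he'
  have hav := lt_average (a := P.xu - ((P.u : ℝ) - 2) * γ) (b := P.xv - ((P.v : ℝ) - 2) * γ)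
    (c := 2 * γ) (p := P.su) (q := P.sv) (by exact_mod_cast hsu) (by exact_mod_cast hsv)
    (by linarith) hsub
  obtain ⟨g1, g2, g3, g4, g5⟩ := P.evenSub.greedy_spec rfl
    (show 0 < P.su + P.sv by omega) hav.1 hav.2 (by
      simp only [evenSub]; push_cast; exact hsub)
  have hrep : (P.u : ℝ) - 2 = ((P.u - 2 : ℕ) : ℝ) := by push_cast [hu]; ring
  have hrep' : (P.v : ℝ) - 2 = ((P.v - 2 : ℕ) : ℝ) := by push_cast [hv]; ring
  obtain ⟨c1, c2⟩ := evenAlgorithm_card ht hu hv he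
  refine ⟨⟨?_, ?_, ?_, ?_⟩, ?_⟩
  · have := hT.isMatrix (c := 2) (x := 2 * γ) fun r hr => by
      rcases Multiset.mem_add.mp hr with hr | hr
      · exact g1.2 r hr
      · rw [Multiset.eq_of_mem_replicate hr]
        simp only [Multiset.insert_eq_cons, Multiset.card_cons, Multiset.card_singleton,
          Multiset.sum_cons, Multiset.sum_singleton]
        exact ⟨trivial, by ring⟩
    have e : P.t / 2 * 2 = P.t := Nat.div_mul_cancel ht.two_dvd
    have e' : ((P.t / 2 : ℕ) : ℝ) * (2 * γ) = P.xt := by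
      rw [← mul_assoc, ← Nat.cast_two (R := ℝ), ← Nat.cast_mul, e, hxt]
    rwa [e, e'] at this
  · rw [hU]
    refine g2.add_replicate (Nat.add_sub_cancel' hu) ?_
    rw [← hrep]
    simp only [evenSub]
    ring
  · rw [hV]
    refine g3.add_replicate (Nat.add_sub_cancel' hv) ?_
    rw [← hrep']
    simp only [evenSub]
    ring
  · rw [hT.join, hU, hV, Multiset.join_add, g4, join_map_add_replicate, join_map_add_replicate,
      g2.1, g3.1]
    have : ({γ, γ} : Multiset ℝ) = Multiset.replicate 2 γ := rfl
    rw [this, join_replicate_replicate, mul_comm _ 2, c2, Multiset.replicate_add]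
    simp only [evenSub]
    abel
  · intro m hm1 hm2 y hy
    rw [hT.join, Multiset.join_add, Multiset.mem_add] at hy
    rcases hy with hy | hy
    · have := g5 y hy
      simp only [evenSub] at this
      linarith
    · rw [Multiset.mem_join] at hy
      obtain ⟨r, hr, hy⟩ := hy
      rw [Multiset.eq_of_mem_replicate hr] at hy
      simp at hy
      linarith

lemma exists_evenAlgorithm {P : Problem} (ht : Even P.t)
    (hu : 2 ≤ P.u) (hv : 2 ≤ P.v)
    (he : P.su * P.u + P.sv * P.v = P.st * P.t) (hsu : 0 < P.su) : ∃ F, P.EvenAlgorithm F := by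
  obtain ⟨T, hT⟩ := exists_isGrouping (k := P.t / 2) (n := P.st)
    (M := P.evenSub.greedy.T + Multiset.replicate (((P.u - 2) * P.su + (P.v - 2) * P.sv) / 2)
      {P.xt / P.t, P.xt / P.t}) (by
    rw [Multiset.card_add, Multiset.card_replicate, ← (evenAlgorithm_card ht hu hv he).1]
    congr 1
    simp only [greedy, sourceRows, evenSub, Multiset.card_cons, Multiset.card_map,
      Multiset.card_range]
    omega)
  exact ⟨⟨T, _, _⟩, hT, rfl, rfl⟩

end Problem

lemma sum_mul_cast_sub_two {ι : Type} [Fintype ι] (len : ι → ℕ) (hlen : ∀ j, 2 ≤ len j) :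
    ∑ j, len j = 2 * Fintype.card ι + ∑ j, (len j - 2) := by
  have : ∀ j, len j = 2 + (len j - 2) := fun j => by have := hlen j; omega
  conv_lhs => rw [Finset.sum_congr rfl fun j _ => this j]
  rw [Finset.sum_add_distrib]
  simp [mul_comm]

/-- Here `L` bounds the spread of the excesses of all sinks over `xt/t`, which is the spread of the
demands in the two-column subproblem. -/
lemma GeneralEvenAlgorithm.spec {ι : Type} [Fintype ι] {st t : ℕ} {xt : ℝ} {len : ι → ℕ}
    {x : ι → ℝ} {T : Rows} {R : ι → Multiset ℝ} (h : GeneralEvenAlgorithm st t xt len x T R)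
    (ht : Even t) (hpos : 0 < Fintype.card ι) (hlen : ∀ j, 2 ≤ len j)
    (he : ∑ j, len j = st * t) (hs : ∑ j, x j = st * xt) {L : ℝ} (hL0 : 0 ≤ L)
    (hL : ∀ i j, (x i - len i * (xt / t)) - (x j - len j * (xt / t)) ≤ L) :
    IsMatrix st t xt T ∧ (∀ j, (R j).card = len j ∧ (R j).sum = x j) ∧ T.join = ∑ j, R j ∧
    ∀ m, 2 * m ≤ 2 * (xt / t) - L → ∀ y ∈ T.join, m ≤ y := by
  obtain ⟨T₂, R₂, hg, hT, hR⟩ := h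
  have hcount := sum_mul_cast_sub_two len hlen
  have htpos : 0 < t := by
    rcases Nat.eq_zero_or_pos t with rfl | h
    · omega
    · exact h
  have ht0 : (t : ℝ) ≠ 0 := by positivity
  set γ := xt / t with hγ
  have hxt : xt = t * γ := by rw [hγ]; field_simp
  have hcast : ∀ j, ((len j - 2 : ℕ) : ℝ) = (len j : ℝ) - 2 := fun j => by
    push_cast [hlen j]; ring
  have hsum : ∑ j, (x j - ((len j : ℝ) - 2) * γ) = Fintype.card ι * (2 * γ) := by
    have he' : ∑ j, (len j : ℝ) = st * t := by exact_mod_cast he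
    rw [Finset.sum_sub_distrib, hs, ← Finset.sum_mul, Finset.sum_sub_distrib, he', hxt]
    simp
    ring
  obtain ⟨g1, g2, g3, g4⟩ := hg.spec hpos hL0 (fun i j => by have := hL i j; linarith) hsum
  refine ⟨?_, ?_, ?_, ?_⟩
  · have := hT.isMatrix (c := 2) (x := 2 * γ) fun r hr => by
      rcases Multiset.mem_add.mp hr with hr | hr
      · exact g1.2 r hr
      · rw [Multiset.eq_of_mem_replicate hr]
        simp only [Multiset.insert_eq_cons, Multiset.card_cons, Multiset.card_singleton,
          Multiset.sum_cons, Multiset.sum_singleton]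
        exact ⟨trivial, by ring⟩
    have e : t / 2 * 2 = t := Nat.div_mul_cancel ht.two_dvd
    have e' : ((t / 2 : ℕ) : ℝ) * (2 * γ) = xt := by
      rw [← mul_assoc, ← Nat.cast_two (R := ℝ), ← Nat.cast_mul, e, hxt]
    rwa [e, e'] at this
  · intro j
    rw [hR, Multiset.card_add, Multiset.sum_add, (g2 j).1, (g2 j).2, Multiset.card_replicate,
      Multiset.sum_replicate, nsmul_eq_mul, hcast]
    exact ⟨Nat.add_sub_cancel' (hlen j), by ring⟩
  · rw [hT.join, Multiset.join_add, g3]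
    simp_rw [hR]
    rw [Finset.sum_add_distrib]
    congr 1
    have : ({γ, γ} : Multiset ℝ) = Multiset.replicate 2 γ := rfl
    rw [this, join_replicate_replicate]
    have e : (∑ j, (len j - 2)) / 2 * 2 = ∑ j, (len j - 2) := by
      obtain ⟨k, hk⟩ := ht
      have : st * t = 2 * (st * k) := by rw [hk]; ring
      omega
    rw [e]
    simp_rw [← Multiset.nsmul_singleton]
    rw [Finset.sum_nsmul_assoc]
  · intro m hm y hy
    rw [hT.join, Multiset.join_add, Multiset.mem_add] at hy
    rcases hy with hy | hy
    · have := g4 y hy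
      linarith
    · rw [Multiset.mem_join] at hy
      obtain ⟨r, hr, hy⟩ := hy
      rw [Multiset.eq_of_mem_replicate hr] at hy
      simp at hy
      linarith

lemma exists_generalEvenAlgorithm {ι : Type} [Fintype ι] {st t : ℕ} (xt : ℝ) {len : ι → ℕ}
    (x : ι → ℝ) (ht : Even t) (hpos : 0 < Fintype.card ι) (hlen : ∀ j, 2 ≤ len j)
    (he : ∑ j, len j = st * t) :
    ∃ (T : Rows) (R : ι → Multiset ℝ), GeneralEvenAlgorithm st t xt len x T R := by
  obtain ⟨T₂, R₂, hg⟩ := exists_generalGreedy (2 * (xt / t))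
    (fun j => x j - ((len j : ℝ) - 2) * (xt / t))
  have hcard : T₂.card = Fintype.card ι := by
    obtain ⟨σ, d, -, -, rfl, -⟩ := hg
    simp [sourceRows]
    omega
  obtain ⟨T, hT⟩ := exists_isGrouping (k := t / 2) (n := st)
    (M := T₂ + Multiset.replicate ((∑ j, (len j - 2)) / 2) {xt / t, xt / t}) (by
      rw [Multiset.card_add, Multiset.card_replicate, hcard]
      have hcount := sum_mul_cast_sub_two len hlen
      obtain ⟨k, hk⟩ := ht
      have : st * t = 2 * (st * k) := by rw [hk]; ring
      rw [show t / 2 = k by omega]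
      omega)
  exact ⟨T, _, T₂, R₂, hg, hT, fun j => rfl⟩

/-! ### Problems with `u = v + 1` -/

namespace Problem

/-- The data of a problem with `u = v + 1`. -/
structure IsSucc (P : Problem) : Prop where
  u_eq : P.u = P.v + 1
  two_le_t : 2 ≤ P.t
  two_le_v : 2 ≤ P.v
  su_pos : 0 < P.su
  sv_pos : 0 < P.sv
  entries_eq : P.su * P.u + P.sv * P.v = P.st * P.t
  sums_eq : P.su * P.xu + P.sv * P.xv = P.st * P.xt
  average_lt : P.xu / P.u < P.xv / P.v

lemma fillCount_eq (P : Problem) {i : ℕ} (hi : i < P.su + P.sv) :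
    P.fillCount i = P.st / (P.su + P.sv) + if i < P.st % (P.su + P.sv) then 1 else 0 := by
  have := Nat.count_modEq_card P.st (r := P.su + P.sv) (by omega) i
  rw [Nat.mod_eq_of_lt hi] at this
  rw [← this, fillCount]
  congr
  funext n
  rw [Nat.ModEq, Nat.mod_eq_of_lt hi]

lemma sum_fillCount (P : Problem) (h : 0 < P.su + P.sv) :
    ∑ i : Fin P.su, P.fillCount i + ∑ j : Fin P.sv, P.fillCount (P.su + j) = P.st := by
  rw [Fin.sum_univ_eq_sum_range (fun i => P.fillCount i) P.su,
    Fin.sum_univ_eq_sum_range (fun j => P.fillCount (P.su + j)) P.sv,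
    ← Finset.sum_range_add]
  rw [Finset.sum_congr rfl fun i hi => P.fillCount_eq (Finset.mem_range.mp hi)]
  rw [Finset.sum_add_distrib, Finset.sum_const, Finset.card_range, smul_eq_mul,
    Finset.sum_ite, Finset.sum_const_zero, add_zero, Finset.sum_const, smul_eq_mul, mul_one]
  have hlt := Nat.mod_lt P.st h
  have : (Finset.range (P.su + P.sv)).filter (fun i => i < P.st % (P.su + P.sv)) =
      Finset.range (P.st % (P.su + P.sv)) := by
    ext i
    simp
    omega
  rw [this, Finset.card_range, Nat.div_add_mod]

variable {P : Problem}

namespace IsSucc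

/-- The pieces `μ` run out before they reach the last two columns, so every row keeps the two free
entries that the even algorithm needs. -/
lemma fillCount_le (h : P.IsSucc) (hs : P.st < (P.u - 2) * P.su + (P.v - 2) * P.sv) :
    (∀ i < P.su, P.fillCount i + 2 ≤ P.u) ∧ ∀ j < P.sv, P.fillCount (P.su + j) + 2 ≤ P.v := by
  have hu := h.u_eq
  have hv := h.two_le_v
  have hlt := Nat.mod_lt P.st (show P.su + P.sv > 0 by have := h.su_pos; omega)
  have hdm := Nat.div_add_mod P.st (P.su + P.sv)
  set q := P.st / (P.su + P.sv)
  set r := P.st % (P.su + P.sv)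
  obtain ⟨w, hw⟩ := Nat.exists_eq_add_of_le hv
  rw [hu, hw, show 2 + w + 1 - 2 = w + 1 by omega, show 2 + w - 2 = w by omega] at hs
  have hq : q ≤ w := by
    by_contra! hc
    have : (P.su + P.sv) * (w + 1) ≤ (P.su + P.sv) * q := Nat.mul_le_mul_left _ hc
    nlinarith
  have hqr : q = w → r < P.su := by
    rintro rfl
    nlinarith
  constructor
  · intro i hi
    rw [P.fillCount_eq (by omega)]
    split_ifs <;> omega
  · intro j hj
    rw [P.fillCount_eq (by omega)]
    split_ifs with hc
    · have : q ≠ w := fun e => by have := hqr e; omega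
      omega
    · omega

/-- The inequalities between the averages. -/
lemma averages (h : P.IsSucc) :
    0 < P.st ∧ (P.v : ℝ) ≠ 0 ∧ P.xu = (P.v + 1) * (P.xu / P.u) ∧ P.xv = P.v * (P.xv / P.v) ∧
    P.xt = P.t * (P.xt / P.t) ∧ P.xu / P.u < P.xt / P.t ∧ P.xt / P.t < P.xv / P.v ∧
    P.xu - P.xv < P.xu / P.u := by
  obtain ⟨hu, ht, hv, hsu, hsv, he, hs, hav⟩ := h
  have hst : 0 < P.st := by
    rcases Nat.eq_zero_or_pos P.st with h0 | h0
    · rw [h0, hu] at he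
      have : 0 < P.su * (P.v + 1) := by positivity
      omega
    · exact h0
  have hv0 : (0 : ℝ) < P.v := by exact_mod_cast (show 0 < P.v by omega)
  have ht0 : (0 : ℝ) < P.t := by exact_mod_cast (show 0 < P.t by omega)
  have hu0 : (P.u : ℝ) = P.v + 1 := by exact_mod_cast hu
  have e1 : P.xu = (P.v + 1) * (P.xu / P.u) := by rw [hu0]; field_simp
  have e2 : P.xv = P.v * (P.xv / P.v) := by field_simp
  have e3 : P.xt = P.t * (P.xt / P.t) := by field_simp
  set a := P.xu / P.u
  set c := P.xv / P.v
  set γ := P.xt / P.t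
  have he' : (P.su : ℝ) * (P.v + 1) + P.sv * P.v = P.st * P.t := by
    rw [hu] at he
    exact_mod_cast he
  have := lt_average (a := a) (b := c) (c := γ) (p := P.su * (P.v + 1)) (q := P.sv * P.v)
    (by positivity) (by positivity) hav (by
      rw [he']
      rw [e1, e2, e3] at hs
      linear_combination hs)
  refine ⟨hst, hv0.ne', e1, e2, e3, this.1, this.2, ?_⟩
  -- With `a = xu/u < c = xv/v` one has `xu - xv = (v+1)a - vc = a - v(c-a) < a`.
  rw [e1, e2]
  nlinarith

/-- In the case of few remaining pieces the matrices `U` and `V` have three and two columns. -/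
lemma v_eq_two (h : P.IsSucc) (ht : ¬ Even P.t)
    (hs : (P.u - 2) * P.su + (P.v - 2) * P.sv ≤ P.st) : P.v = 2 ∧ P.u = 3 := by
  have h3 : 3 ≤ P.t := by
    have := h.two_le_t
    rcases this.lt_or_eq with h | h
    · exact h
    · exact absurd (h ▸ even_two) ht
  have hu := h.u_eq
  have he := h.entries_eq
  have hsu := h.su_pos
  obtain ⟨w, hw⟩ := Nat.exists_eq_add_of_le h.two_le_v
  rw [hu, hw, show 2 + w + 1 - 2 = w + 1 by omega, show 2 + w - 2 = w by omega] at hs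
  rw [hu, hw] at he
  -- With `v = w + 2`, three times the bound `hs` together with `3·st ≤ st·t` gives `3(w+1)su +
  -- 3w·sv ≤ (w+3)su + (w+2)sv`, which fails for `w ≥ 1`.
  have h3' : P.st * 3 ≤ P.st * P.t := Nat.mul_le_mul_left _ h3
  rcases Nat.eq_zero_or_pos w with h0 | h0
  · omega
  · exfalso
    obtain ⟨z, rfl⟩ : ∃ z, w = z + 1 := ⟨w - 1, by omega⟩
    nlinarith

end IsSucc

/-- Averages of a matrix from which a column with small entries is removed. -/
lemma le_average_of_remove {xt t μ : ℝ} (ht : 1 < t) (hμ : μ ≤ xt / t) :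
    xt / t ≤ (xt - μ) / (t - 1) := by
  have h0 : 0 < t - 1 := by linarith
  have h1 : 0 < t := by linarith
  rw [le_div_iff₀ h0]
  have : xt / t * t = xt := by field_simp
  linarith

lemma IsFeasible.mem_join {F : Filling} (h : P.IsFeasible F) {y : ℝ} :
    y ∈ F.T.join ↔ y ∈ F.U.join ∨ y ∈ F.V.join := by
  rw [h.2.2.2, Multiset.mem_add]

lemma mem_join_replicate_replicate {s n : ℕ} {a y : ℝ}
    (h : y ∈ (Multiset.replicate s (Multiset.replicate n a) : Rows).join) : y = a := by
  rw [join_replicate_replicate] at h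
  exact Multiset.eq_of_mem_replicate h

namespace IsSucc

/-- For `u = v + 1` the excesses over `γ = xt/t` differ by `xu - xv - γ`, so the pieces are at least
`(γ + (xu - xv))/2`, and `xu - xv < γ`. The bound `xu - xv` is the one that `spec_small` needs:
there this difference is the common entry of `U`. -/
lemma spec_even {F : Filling} (h : P.IsSucc) (ht : Even P.t) (hF : P.EvenAlgorithm F) :
    P.IsFeasible F ∧ ∀ y ∈ F.T.join, P.xu - P.xv ≤ y := by
  obtain ⟨-, -, e1, e2, e3, h1, h2, h3⟩ := h.averages
  have hu : (P.u : ℝ) = P.v + 1 := by exact_mod_cast h.u_eq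
  obtain ⟨k1, k2⟩ := hF.spec ht (by have := h.u_eq; have := h.two_le_v; omega) h.two_le_v h.su_pos
    h.sv_pos h.entries_eq h.sums_eq (by rw [hu]; linarith)
  exact ⟨k1, k2 _ (by linarith) (by rw [hu]; linarith)⟩

lemma odd_three_le (h : P.IsSucc) (ht : ¬ Even P.t) : 3 ≤ P.t := by
  have := h.two_le_t
  rcases this.lt_or_eq with h | h
  · exact h
  · exact absurd (h ▸ even_two) ht

lemma even_t_sub_one (h : P.IsSucc) (ht : ¬ Even P.t) : Even (P.t - 1) := by
  have := h.odd_three_le ht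
  rw [Nat.even_iff] at ht ⊢
  omega

/-- The even problem in the case that `U` has fewer entries than `T` has rows. -/
noncomputable def subLt (P : Problem) : Problem where
  st := P.sv
  t := P.v
  xt := P.xv
  su := P.st - P.su * P.u
  u := P.t
  xu := P.xt
  sv := P.su * P.u
  v := P.t - 1
  xv := P.xt - P.xu / P.u

lemma subLt_entries (h : P.IsSucc) (hn : P.su * P.u < P.st) :
    (P.st - P.su * P.u) * P.t + P.su * P.u * (P.t - 1) = P.sv * P.v := by
  have he := h.entries_eq
  obtain ⟨k, hk⟩ := Nat.exists_eq_add_of_lt hn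
  obtain ⟨w, hw⟩ : ∃ w, P.t = w + 1 := ⟨P.t - 1, by have := h.two_le_t; omega⟩
  rw [hk, hw] at he ⊢
  rw [show P.su * P.u + k + 1 - P.su * P.u = k + 1 by omega, Nat.add_sub_cancel]
  have : P.su * P.u + P.sv * P.v =
      ((k + 1) * (w + 1) + P.su * P.u * w) + P.su * P.u := by rw [he]; ring
  omega

/-- With `V` as source matrix, the two kinds of rows of `T` have excesses over `c = xv/v` that
differ by `c - a`, where `a = xu/u`. The pieces are therefore at least `(a + c)/2 > a > xu - xv`. -/
lemma spec_odd_lt {F G : Filling} (h : P.IsSucc) (ht : ¬ Even P.t)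
    (hs : (P.u - 2) * P.su + (P.v - 2) * P.sv ≤ P.st) (hn : P.su * P.u < P.st)
    (hG : (subLt P).EvenAlgorithm G)
    (hT : F.T = G.U + G.V.map (fun r => (P.xu / P.u) ::ₘ r))
    (hU : F.U = Multiset.replicate P.su (Multiset.replicate P.u (P.xu / P.u)))
    (hV : F.V = G.T) : P.IsFeasible F ∧ ∀ y ∈ F.T.join, P.xu - P.xv ≤ y := by
  obtain ⟨hst, -, e1, e2, e3, h1, h2, h3⟩ := h.averages
  obtain ⟨hv2, hu3⟩ := h.v_eq_two ht hs
  have ht3 := h.odd_three_le ht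
  have ht1 : ((P.t - 1 : ℕ) : ℝ) = P.t - 1 := by push_cast [show 1 ≤ P.t by omega]; ring
  have hu : (P.u : ℝ) = P.v + 1 := by exact_mod_cast h.u_eq
  have hxu : (P.u : ℝ) * (P.xu / P.u) = P.xu := by rw [← hu] at e1; exact e1.symm
  obtain ⟨k1, k2⟩ := hG.spec (by simp only [subLt, hv2]; exact even_two)
    (by simp only [subLt]; omega) (by simp only [subLt]; omega) (by simp only [subLt]; omega)
    (by simp only [subLt, hu3]; have := h.su_pos; omega)
    (h.subLt_entries hn) (by
      simp only [subLt]
      rw [Nat.cast_sub hn.le]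
      push_cast
      have := h.sums_eq
      linear_combination - this + (-P.su : ℝ) * hxu) (by
      simp only [subLt]
      rw [ht1]
      linarith)
  obtain ⟨f1, f2, f3, f4⟩ := k1
  have hfeas : P.IsFeasible F := by
    refine ⟨?_, ?_, ?_, ?_⟩
    · rw [hT]
      have := f2.add (f3.cons (c' := P.t) (μ := P.xu / P.u) (x' := P.xt)
        (by simp only [subLt]; omega) (by simp only [subLt]; ring))
      simp only [subLt] at this
      rwa [Nat.sub_add_cancel hn.le] at this
    · rw [hU]
      exact isMatrix_replicate (by simp) (by rw [Multiset.sum_replicate, nsmul_eq_mul, hxu])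
    · rw [hV]
      exact f1
    · rw [hT, hU, hV, Multiset.join_add, join_map_cons, f4, f3.1, join_replicate_replicate]
      simp only [subLt]
      abel
  refine ⟨hfeas, fun y hy => ?_⟩
  rcases hfeas.mem_join.mp hy with hy | hy
  · rw [hU] at hy
    rw [mem_join_replicate_replicate hy]
    exact h3.le
  · rw [hV] at hy
    refine k2 _ ?_ ?_ y hy
    · simp only [subLt]; linarith
    · simp only [subLt]
      rw [ht1]
      linarith

lemma spec_odd_eq {F : Filling} (h : P.IsSucc) (hn : P.su * P.u = P.st)
    (hT : F.T = Multiset.replicate P.st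
      ((P.xu / P.u) ::ₘ Multiset.replicate (P.t - 1) (P.xv / P.v)))
    (hU : F.U = Multiset.replicate P.su (Multiset.replicate P.u (P.xu / P.u)))
    (hV : F.V = Multiset.replicate P.sv (Multiset.replicate P.v (P.xv / P.v))) :
    P.IsFeasible F ∧ ∀ y ∈ F.T.join, P.xu - P.xv ≤ y := by
  obtain ⟨hst, -, e1, e2, e3, h1, h2, h3⟩ := h.averages
  have ht2 := h.two_le_t
  have ht1 : ((P.t - 1 : ℕ) : ℝ) = P.t - 1 := by push_cast [show 1 ≤ P.t by omega]; ring
  have hu : (P.u : ℝ) = P.v + 1 := by exact_mod_cast h.u_eq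
  have hxu : (P.u : ℝ) * (P.xu / P.u) = P.xu := by rw [← hu] at e1; exact e1.symm
  have hnv : P.sv * P.v = P.st * (P.t - 1) := by
    have he := h.entries_eq
    obtain ⟨w, hw⟩ : ∃ w, P.t = w + 1 := ⟨P.t - 1, by omega⟩
    rw [hn, hw] at he
    rw [hw, Nat.add_sub_cancel]
    nlinarith
  have hfeas : P.IsFeasible F := by
    refine ⟨?_, ?_, ?_, ?_⟩
    · rw [hT]
      refine isMatrix_replicate (by simp; omega) ?_
      rw [Multiset.sum_cons, Multiset.sum_replicate, nsmul_eq_mul]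
      have hs := h.sums_eq
      have hn' : (P.su : ℝ) * P.u = P.st := by exact_mod_cast hn
      have hnv' : (P.sv : ℝ) * P.v = P.st * ((P.t - 1 : ℕ) : ℝ) := by exact_mod_cast hnv
      have hst' : (P.st : ℝ) ≠ 0 := by positivity
      apply mul_left_cancel₀ hst'
      linear_combination hs - (P.xv / P.v) * hnv' - (P.xu / P.u) * hn' + (P.su : ℝ) * hxu - (P.sv : ℝ) * e2
    · rw [hU]
      exact isMatrix_replicate (by simp) (by rw [Multiset.sum_replicate, nsmul_eq_mul, hxu])
    · rw [hV]
      exact isMatrix_replicate (by simp) (by rw [Multiset.sum_replicate, nsmul_eq_mul, ← e2])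
    · rw [hT, hU, hV, join_replicate_replicate, join_replicate_replicate, hnv, hn, Multiset.join,
        Multiset.sum_replicate, ← Multiset.singleton_add, nsmul_add, Multiset.nsmul_singleton,
        ← Multiset.nsmul_singleton _ (P.t - 1), smul_smul, Multiset.nsmul_singleton]
  refine ⟨hfeas, fun y hy => ?_⟩
  rcases hfeas.mem_join.mp hy with hy | hy
  · rw [hU] at hy
    rw [mem_join_replicate_replicate hy]
    exact h3.le
  · rw [hV] at hy
    rw [mem_join_replicate_replicate hy]
    linarith

/-- The even problem in the case that `U` has more entries than `T` has rows. -/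
noncomputable def subGt (P : Problem) (r : ℕ) : Problem where
  st := P.st
  t := P.t - 1
  xt := P.xt - P.xu / P.u
  su := P.su - r
  u := 2
  xu := 2 * P.xu / 3
  sv := P.sv
  v := P.v
  xv := P.xv

/-- Here `3·su + 2·sv = st·t` with `t` odd, so `st` and `su` have the same parity and `r` is an
exact half. -/
lemma subGt_counts (h : P.IsSucc) (ht : ¬ Even P.t)
    (hs : (P.u - 2) * P.su + (P.v - 2) * P.sv ≤ P.st) (hn : P.st < P.su * P.u) {r : ℕ}
    (hr : r = (P.st - P.su) / 2) :
    2 * r + P.su = P.st ∧ r < P.su ∧ (P.su - r) * 2 + P.sv * P.v = P.st * (P.t - 1) := by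
  obtain ⟨hv2, hu3⟩ := h.v_eq_two ht hs
  have he := h.entries_eq
  obtain ⟨k, hk⟩ := Nat.not_even_iff_odd.mp ht
  rw [hv2, hu3] at he hs
  rw [hu3] at hn
  have e1 : P.st * P.t = 2 * (P.st * k) + P.st := by rw [hk]; ring
  have e2 : P.st * (P.t - 1) = 2 * (P.st * k) := by rw [hk, Nat.add_sub_cancel]; ring
  rw [hv2]
  omega

/-- Let `a = xu/u`, `c = xv/v`, and let `γ'` be the average of `T` without its first column. The
even algorithm guarantees `γ' + a - c`, and this is at least `xu - xv = 3a - 2c` since `γ'` and `c`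
are at least `a`. -/
lemma spec_odd_gt {F G : Filling} {r : ℕ} (h : P.IsSucc) (ht : ¬ Even P.t)
    (hs : (P.u - 2) * P.su + (P.v - 2) * P.sv ≤ P.st) (hn : P.st < P.su * P.u)
    (hr : r = (P.st - P.su) / 2) (hG : (subGt P r).EvenAlgorithm G)
    (hT : F.T = G.T.map (fun row => (P.xu / P.u) ::ₘ row))
    (hU : F.U = Multiset.replicate r (Multiset.replicate P.u (P.xu / P.u)) +
      G.U.map (fun row => (P.xu / P.u) ::ₘ row))
    (hV : F.V = G.V) : P.IsFeasible F ∧ ∀ y ∈ F.T.join, P.xu - P.xv ≤ y := by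
  obtain ⟨hst, -, e1, e2, e3, h1, h2, h3⟩ := h.averages
  obtain ⟨hv2, hu3⟩ := h.v_eq_two ht hs
  obtain ⟨c1, c2, c3⟩ := h.subGt_counts ht hs hn hr
  have ht3 := h.odd_three_le ht
  have ht1 : ((P.t - 1 : ℕ) : ℝ) = P.t - 1 := by push_cast [show 1 ≤ P.t by omega]; ring
  have ht1' : (1 : ℝ) < P.t := by exact_mod_cast (show 1 < P.t by omega)
  have hu : (P.u : ℝ) = 3 := by exact_mod_cast hu3
  have hv : (P.v : ℝ) = 2 := by exact_mod_cast hv2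
  have hxu : (P.u : ℝ) * (P.xu / P.u) = P.xu := by rw [hu]; field_simp
  have hγ := le_average_of_remove ht1' h1.le
  set a := P.xu / P.u with ha
  have hxu3 : P.xu = 3 * a := by rw [hu] at hxu; linarith
  have hxv2 : P.xv = 2 * (P.xv / P.v) := by rw [hv]; ring
  set c := P.xv / P.v
  have hc1 : 2 * (r : ℝ) + P.su = P.st := by exact_mod_cast c1
  obtain ⟨k1, k2⟩ := hG.spec (h.even_t_sub_one ht) (le_refl 2) hv2.ge
    (by simp only [subGt]; omega) h.sv_pos c3 (by
      simp only [subGt]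
      rw [Nat.cast_sub c2.le]
      have := h.sums_eq
      rw [← ha]
      linear_combination this - a * hc1 + (2 / 3 * ((P.su : ℝ) - r) - P.su) * hxu3) (by
      simp only [subGt]
      rw [hxu3, hv, hxv2]
      push_cast
      linarith)
  obtain ⟨f1, f2, f3, f4⟩ := k1
  have hfeas : P.IsFeasible F := by
    refine ⟨?_, ?_, ?_, ?_⟩
    · rw [hT]
      exact f1.cons (by simp only [subGt]; omega) (by simp only [subGt]; rw [← ha]; ring)
    · rw [hU]
      have := (isMatrix_replicate (s := r) (c := P.u) (x := P.xu) (r := Multiset.replicate P.u a)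
        (by simp) (by rw [Multiset.sum_replicate, nsmul_eq_mul, hxu])).add
        (f2.cons (c' := P.u) (x' := P.xu) (μ := a) (by simp only [subGt]; omega)
          (by simp only [subGt]; rw [hxu3]; ring))
      simp only [subGt] at this
      rwa [Nat.add_sub_cancel' c2.le] at this
    · rw [hV]
      exact f3
    · rw [hT, hU, hV, Multiset.join_add, join_map_cons, join_map_cons, f4, f1.1, f2.1,
        join_replicate_replicate]
      have : P.st = r * P.u + (P.su - r) := by rw [hu3]; omega
      simp only [subGt]
      rw [this, Multiset.replicate_add]
      abel
  refine ⟨hfeas, fun y hy => ?_⟩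
  rw [hT, join_map_cons, Multiset.mem_add] at hy
  rcases hy with hy | hy
  · refine k2 _ ?_ ?_ y hy
    · simp only [subGt]
      rw [ht1, ← ha]
      linarith
    · simp only [subGt]
      rw [ht1, hv, ← ha]
      push_cast
      linarith
  · rw [Multiset.eq_of_mem_replicate hy]
    exact h3.le

end IsSucc

end Problem

namespace Problem

variable {P : Problem}

namespace IsSucc

/-- The even problem that remains when equally many pieces `μ` are missing in all rows. -/
noncomputable def subSame (P : Problem) (μ : ℝ) (w : ℕ) : Problem where
  st := P.st
  t := P.t - 1
  xt := P.xt - μ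
  su := P.su
  u := w
  xu := P.xu - ((P.u : ℝ) - w) * μ
  sv := P.sv
  v := w
  xv := P.xv - ((P.v : ℝ) - w) * μ

lemma subSame_counts (h : P.IsSucc) (hs : P.st < (P.u - 2) * P.su + (P.v - 2) * P.sv) {w : ℕ}
    (hw : (∀ i < P.su, P.u - P.fillCount i = w) ∧ ∀ j < P.sv, P.v - P.fillCount (P.su + j) = w) :
    2 ≤ w ∧ w ≤ P.u ∧ w ≤ P.v ∧ P.su * (P.u - w) + P.sv * (P.v - w) = P.st ∧
    P.su * w + P.sv * w = P.st * (P.t - 1) := by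
  obtain ⟨b1, b2⟩ := h.fillCount_le hs
  have k1 := b2 0 h.sv_pos
  have k2 := hw.2 0 h.sv_pos
  have k3 := hw.1 0 h.su_pos
  have hsum := P.sum_fillCount (by have := h.su_pos; omega)
  have e1 : ∀ i : Fin P.su, P.fillCount i = P.u - w := fun i => by
    have := hw.1 i i.2
    have := b1 i i.2
    omega
  have e2 : ∀ j : Fin P.sv, P.fillCount (P.su + j) = P.v - w := fun j => by
    have := hw.2 j j.2
    have := b2 j j.2
    omega
  simp only [e1, e2, Finset.sum_const, Finset.card_univ, Fintype.card_fin, smul_eq_mul] at hsum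
  have hwu : w ≤ P.u := by omega
  have hwv : w ≤ P.v := by omega
  refine ⟨by omega, hwu, hwv, hsum, ?_⟩
  have he := h.entries_eq
  have ht := h.two_le_t
  zify [hwu, hwv, show 1 ≤ P.t by omega] at hsum he ⊢
  linear_combination he - hsum

/-- In the subproblem the excesses of the two kinds of sinks differ by `xu - xv - μ`, and the
average of the rest of `T` is at least `μ`. Hence the pieces are at least `(μ + xu - xv)/2 > xu -
xv`. -/
lemma spec_fill_same {F G : Filling} {μ : ℝ} {w : ℕ} (h : P.IsSucc) (ht : ¬ Even P.t)
    (hs : P.st < (P.u - 2) * P.su + (P.v - 2) * P.sv)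
    (hμ : P.xu - P.xv < μ) (hμt : μ ≤ P.xt / P.t)
    (hw : (∀ i < P.su, P.u - P.fillCount i = w) ∧ ∀ j < P.sv, P.v - P.fillCount (P.su + j) = w)
    (hG : (subSame P μ w).EvenAlgorithm G)
    (hT : F.T = G.T.map (fun r => μ ::ₘ r))
    (hU : F.U = G.U.map (fun r => r + Multiset.replicate (P.u - w) μ))
    (hV : F.V = G.V.map (fun r => r + Multiset.replicate (P.v - w) μ)) :
    P.IsFeasible F ∧ ∀ y ∈ F.T.join, P.xu - P.xv ≤ y := by
  obtain ⟨c1, c2, c3, c4, c5⟩ := h.subSame_counts hs hw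
  have ht3 := h.odd_three_le ht
  have ht1 : ((P.t - 1 : ℕ) : ℝ) = P.t - 1 := by push_cast [show 1 ≤ P.t by omega]; ring
  have ht1' : (1 : ℝ) < P.t := by exact_mod_cast (show 1 < P.t by omega)
  have hγ := le_average_of_remove ht1' hμt
  have hu : (P.u : ℝ) = P.v + 1 := by exact_mod_cast h.u_eq
  have hcu : ((P.u - w : ℕ) : ℝ) = (P.u : ℝ) - w := by push_cast [c2]; ring
  have hcv : ((P.v - w : ℕ) : ℝ) = (P.v : ℝ) - w := by push_cast [c3]; ring
  have c4' : (P.su : ℝ) * (P.u - w) + P.sv * (P.v - w) = P.st := by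
    rw [← hcu, ← hcv]
    exact_mod_cast c4
  obtain ⟨k1, k2⟩ := hG.spec (h.even_t_sub_one ht) c1 c1 h.su_pos h.sv_pos c5 (by
      simp only [subSame]
      linear_combination h.sums_eq - μ * c4') (by
      simp only [subSame]
      rw [hu]
      linarith)
  obtain ⟨f1, f2, f3, f4⟩ := k1
  have hfeas : P.IsFeasible F := by
    refine ⟨?_, ?_, ?_, ?_⟩
    · rw [hT]
      exact f1.cons (by simp only [subSame]; omega) (by simp only [subSame]; ring)
    · rw [hU]
      exact f2.add_replicate (by simp only [subSame]; omega)
        (by rw [hcu]; simp only [subSame]; ring)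
    · rw [hV]
      exact f3.add_replicate (by simp only [subSame]; omega)
        (by rw [hcv]; simp only [subSame]; ring)
    · rw [hT, hU, hV, join_map_cons, join_map_add_replicate, join_map_add_replicate, f4, f1.1,
        f2.1, f3.1]
      simp only [subSame]
      conv_lhs => rw [← c4, Multiset.replicate_add]
      abel
  refine ⟨hfeas, fun y hy => ?_⟩
  rw [hT, join_map_cons, Multiset.mem_add] at hy
  rcases hy with hy | hy
  · refine k2 _ ?_ ?_ y hy
    · simp only [subSame]
      rw [ht1]
      linarith
    · simp only [subSame]
      rw [ht1, hu]
      linarith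
  · rw [Multiset.eq_of_mem_replicate hy]
    exact hμ.le

/-- The pieces are dealt out in rounds, in each of which the rows of `U` come before those of `V`.
The counts thus differ by at most one, and no row of `V` gets more than a row of `U`. -/
lemma fillCount_order :
    (∀ i < P.su, ∀ i' < P.su, (P.fillCount i : ℝ) ≤ P.fillCount i' + 1) ∧
    (∀ i < P.sv, ∀ i' < P.sv, (P.fillCount (P.su + i) : ℝ) ≤ P.fillCount (P.su + i') + 1) ∧
    (∀ i < P.su, ∀ j < P.sv, (P.fillCount (P.su + j) : ℝ) ≤ P.fillCount i) ∧
    (∀ i < P.su, ∀ j < P.sv, (P.fillCount i : ℝ) ≤ P.fillCount (P.su + j) + 1) := by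
  refine ⟨fun i hi i' hi' => ?_, fun i hi i' hi' => ?_, fun i hi j hj => ?_, fun i hi j hj => ?_⟩
  all_goals
    rw [P.fillCount_eq (by omega), P.fillCount_eq (by omega)]
    norm_cast
    split_ifs <;> omega

lemma sum_len (h : P.IsSucc) (hs : P.st < (P.u - 2) * P.su + (P.v - 2) * P.sv) :
    ∑ j, (Sum.elim (fun i : Fin P.su => P.u - P.fillCount i)
      (fun j : Fin P.sv => P.v - P.fillCount (P.su + j))) j = P.st * (P.t - 1) := by
  obtain ⟨b1, b2⟩ := h.fillCount_le hs
  have hsum := P.sum_fillCount (by have := h.su_pos; omega)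
  have ht := h.two_le_t
  have he := h.entries_eq
  rw [Fintype.sum_sum_type]
  simp only [Sum.elim_inl, Sum.elim_inr]
  have e1 : ∑ i : Fin P.su, (P.u - P.fillCount i) + ∑ i : Fin P.su, P.fillCount i
      = P.su * P.u := by
    have : ∀ i : Fin P.su, P.u - P.fillCount i + P.fillCount i = P.u := fun i => by
      have := b1 i i.2
      omega
    rw [← Finset.sum_add_distrib, Finset.sum_congr rfl fun i _ => this i]
    simp
  have e2 : ∑ j : Fin P.sv, (P.v - P.fillCount (P.su + j)) +
      ∑ j : Fin P.sv, P.fillCount (P.su + j) = P.sv * P.v := by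
    have : ∀ j : Fin P.sv, P.v - P.fillCount (P.su + j) + P.fillCount (P.su + j) = P.v :=
      fun j => by
        have := b2 j j.2
        omega
    rw [← Finset.sum_add_distrib, Finset.sum_congr rfl fun j _ => this j]
    simp
  obtain ⟨w, hw⟩ : ∃ w, P.t = w + 1 := ⟨P.t - 1, by omega⟩
  have e3 : P.st * P.t = P.st * w + P.st := by rw [hw]; ring
  rw [hw, Nat.add_sub_cancel]
  omega

lemma two_le_len (h : P.IsSucc) (hs : P.st < (P.u - 2) * P.su + (P.v - 2) * P.sv) :
    ∀ j, 2 ≤ (Sum.elim (fun i : Fin P.su => P.u - P.fillCount i)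
      (fun j : Fin P.sv => P.v - P.fillCount (P.su + j))) j := by
  obtain ⟨b1, b2⟩ := h.fillCount_le hs
  rintro (i | j)
  · have := b1 i i.2
    simp only [Sum.elim_inl]
    omega
  · have := b2 j j.2
    simp only [Sum.elim_inr]
    omega

lemma card_sinks_pos (h : P.IsSucc) : 0 < Fintype.card (Fin P.su ⊕ Fin P.sv) := by
  have := h.su_pos
  simp
  omega

lemma spec_fill_mixed {F : Filling} {μ : ℝ} {T : Rows} {R : Fin P.su ⊕ Fin P.sv → Multiset ℝ}
    (h : P.IsSucc) (ht : ¬ Even P.t)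
    (hs : P.st < (P.u - 2) * P.su + (P.v - 2) * P.sv)
    (hμ : P.xu - P.xv < μ) (hμt : μ ≤ P.xt / P.t)
    (hR : GeneralEvenAlgorithm P.st (P.t - 1) (P.xt - μ)
      (Sum.elim (fun i : Fin P.su => P.u - P.fillCount i)
        (fun j : Fin P.sv => P.v - P.fillCount (P.su + j)))
      (Sum.elim (fun i : Fin P.su => P.xu - P.fillCount i * μ)
        (fun j : Fin P.sv => P.xv - P.fillCount (P.su + j) * μ)) T R)
    (hT : F.T = T.map (fun r => μ ::ₘ r))
    (hU : F.U = Finset.univ.val.map fun i : Fin P.su =>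
      R (Sum.inl i) + Multiset.replicate (P.fillCount i) μ)
    (hV : F.V = Finset.univ.val.map fun j : Fin P.sv =>
      R (Sum.inr j) + Multiset.replicate (P.fillCount (P.su + j)) μ) :
    P.IsFeasible F ∧ ∀ y ∈ F.T.join, P.xu - P.xv ≤ y := by
  obtain ⟨b1, b2⟩ := h.fillCount_le hs
  have hsum := P.sum_fillCount (by have := h.su_pos; omega)
  have ht3 := h.odd_three_le ht
  have ht1 : ((P.t - 1 : ℕ) : ℝ) = P.t - 1 := by push_cast [show 1 ≤ P.t by omega]; ring
  have ht1' : (1 : ℝ) < P.t := by exact_mod_cast (show 1 < P.t by omega)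
  have hγ := le_average_of_remove ht1' hμt
  have hu : (P.u : ℝ) = P.v + 1 := by exact_mod_cast h.u_eq
  have b1' : ∀ i : Fin P.su, ((P.u - P.fillCount i : ℕ) : ℝ) = P.u - P.fillCount i := fun i =>
    Nat.cast_sub (by have := b1 i i.2; omega)
  have b2' : ∀ j : Fin P.sv,
      ((P.v - P.fillCount (P.su + j) : ℕ) : ℝ) = P.v - P.fillCount (P.su + j) := fun j =>
    Nat.cast_sub (by have := b2 j j.2; omega)
  obtain ⟨o1, o2, o3, o4⟩ := fillCount_order (P := P)
  set γ := (P.xt - μ) / ((P.t : ℝ) - 1) with hγdef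
  have hθ : 0 ≤ γ - μ := by linarith
  -- Now `γ` is the average of `T` without its first column. The excess over `γ` of a row with `n`
  -- pieces `μ` is that of the complete row plus `n(γ - μ)`. The largest possible difference comes
  -- from a row of `V` and a row of `U` with equal counts; there it equals `γ - (xu - xv)`.
  have hL : ∀ i j : Fin P.su ⊕ Fin P.sv,
      ((Sum.elim (fun i : Fin P.su => P.xu - P.fillCount i * μ)
        (fun j : Fin P.sv => P.xv - P.fillCount (P.su + j) * μ)) i -
       ((Sum.elim (fun i : Fin P.su => P.u - P.fillCount i)
        (fun j : Fin P.sv => P.v - P.fillCount (P.su + j)) i : ℕ) : ℝ) *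
          ((P.xt - μ) / ((P.t - 1 : ℕ) : ℝ))) -
      ((Sum.elim (fun i : Fin P.su => P.xu - P.fillCount i * μ)
        (fun j : Fin P.sv => P.xv - P.fillCount (P.su + j) * μ)) j -
       ((Sum.elim (fun i : Fin P.su => P.u - P.fillCount i)
        (fun j : Fin P.sv => P.v - P.fillCount (P.su + j)) j : ℕ) : ℝ) *
          ((P.xt - μ) / ((P.t - 1 : ℕ) : ℝ))) ≤ γ - (P.xu - P.xv) := by
    rw [ht1, ← hγdef]
    rintro (i | i) (j | j) <;> simp only [Sum.elim_inl, Sum.elim_inr, b1', b2', hu]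
    · have := mul_le_mul_of_nonneg_right (o1 i i.2 j j.2) hθ
      linarith
    · have := mul_le_mul_of_nonneg_right (o4 i i.2 j j.2) hθ
      linarith
    · have := mul_le_mul_of_nonneg_right (o3 j j.2 i i.2) hθ
      linarith
    · have := mul_le_mul_of_nonneg_right (o2 i i.2 j j.2) hθ
      linarith
  obtain ⟨f1, f2, f3, f4⟩ := hR.spec (h.even_t_sub_one ht) h.card_sinks_pos (h.two_le_len hs)
    (h.sum_len hs) (by
      rw [Fintype.sum_sum_type]
      simp only [Sum.elim_inl, Sum.elim_inr]
      rw [Finset.sum_sub_distrib, Finset.sum_sub_distrib, ← Finset.sum_mul, ← Finset.sum_mul]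
      have hsum' : (∑ i : Fin P.su, (P.fillCount i : ℝ)) +
        ∑ j : Fin P.sv, (P.fillCount (P.su + j) : ℝ) = P.st := by exact_mod_cast hsum
      simp only [Finset.sum_const, Finset.card_univ, Fintype.card_fin, nsmul_eq_mul]
      linear_combination h.sums_eq - μ * hsum') (L := γ - (P.xu - P.xv)) (by linarith) hL
  have hfeas : P.IsFeasible F := by
    refine ⟨?_, ?_, ?_, ?_⟩
    · rw [hT]
      exact f1.cons (by omega) (by ring)
    · rw [hU]
      have := isMatrix_map (Finset.univ : Finset (Fin P.su)).val (fun i : Fin P.su =>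
        R (Sum.inl i) + Multiset.replicate (P.fillCount i) μ) (c := P.u) (x := P.xu)
        fun i _ => by
          have := f2 (Sum.inl i)
          simp only [Sum.elim_inl] at this
          rw [Multiset.card_add, Multiset.sum_add, this.1, this.2, Multiset.card_replicate,
            Multiset.sum_replicate, nsmul_eq_mul]
          have := b1 i i.2
          exact ⟨by omega, by ring⟩
      simpa using this
    · rw [hV]
      have := isMatrix_map (Finset.univ : Finset (Fin P.sv)).val (fun j : Fin P.sv =>
        R (Sum.inr j) + Multiset.replicate (P.fillCount (P.su + j)) μ) (c := P.v) (x := P.xv)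
        fun j _ => by
          have := f2 (Sum.inr j)
          simp only [Sum.elim_inr] at this
          rw [Multiset.card_add, Multiset.sum_add, this.1, this.2, Multiset.card_replicate,
            Multiset.sum_replicate, nsmul_eq_mul]
          have := b2 j j.2
          exact ⟨by omega, by ring⟩
      simpa using this
    · rw [hT, hU, hV, join_map_cons, f3, f1.1, Fintype.sum_sum_type]
      change _ = (∑ i : Fin P.su, (R (Sum.inl i) + Multiset.replicate (P.fillCount i) μ)) +
        ∑ j : Fin P.sv, (R (Sum.inr j) + Multiset.replicate (P.fillCount (P.su + j)) μ)
      rw [Finset.sum_add_distrib, Finset.sum_add_distrib]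
      simp_rw [← Multiset.nsmul_singleton]
      rw [Finset.sum_nsmul_assoc, Finset.sum_nsmul_assoc]
      conv_lhs => rw [← hsum, add_nsmul]
      abel
  refine ⟨hfeas, fun y hy => ?_⟩
  rw [hT, join_map_cons, Multiset.mem_add] at hy
  rcases hy with hy | hy
  · refine f4 _ ?_ y hy
    rw [ht1, ← hγdef]
    linarith
  · rw [Multiset.eq_of_mem_replicate hy]
    exact hμ.le

end IsSucc

/-- The algorithm for `u = v + 1` produces feasible solutions without small pieces. -/
lemma SuccAlgorithm.spec {F : Filling} (hF : P.SuccAlgorithm F) (h : P.IsSucc) :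
    P.IsFeasible F ∧ ∀ y ∈ F.T.join, P.xu - P.xv ≤ y := by
  cases hF with
  | even ht hF => exact h.spec_even ht hF
  | odd_lt G ht hs hn hG hT hU hV => exact h.spec_odd_lt ht hs hn hG hT hU hV
  | odd_eq ht hs hn hT hU hV => exact h.spec_odd_eq hn hT hU hV
  | odd_gt G r ht hs hn hr hG hT hU hV => exact h.spec_odd_gt ht hs hn hr hG hT hU hV
  | fill_same G μ w ht hs hμ hμt hw hG hT hU hV =>
    exact h.spec_fill_same ht hs hμ hμt hw hG hT hU hV
  | fill_mixed μ T R ht hs hμ hμt hw hR hT hU hV =>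
    exact h.spec_fill_mixed ht hs hμ hμt hR hT hU hV

lemma exists_succAlgorithm (h : P.IsSucc) : ∃ F, P.SuccAlgorithm F := by
  have hu := h.u_eq
  have hv := h.two_le_v
  obtain ⟨-, -, -, -, -, h1, -, h3⟩ := h.averages
  by_cases ht : Even P.t
  · obtain ⟨F, hF⟩ := exists_evenAlgorithm ht (by omega) hv h.entries_eq h.su_pos
    exact ⟨F, .even F ht hF⟩
  have ht3 := h.odd_three_le ht
  rcases le_or_gt ((P.u - 2) * P.su + (P.v - 2) * P.sv) P.st with hs | hs
  · obtain ⟨hv2, hu3⟩ := h.v_eq_two ht hs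
    rcases lt_trichotomy (P.su * P.u) P.st with hn | hn | hn
    · obtain ⟨G, hG⟩ := exists_evenAlgorithm (P := IsSucc.subLt P)
        (by simp only [IsSucc.subLt, hv2]; exact even_two)
        (by simp only [IsSucc.subLt]; omega) (by simp only [IsSucc.subLt]; omega)
        (h.subLt_entries hn) (by simp only [IsSucc.subLt]; omega)
      exact ⟨⟨_, _, _⟩, .odd_lt _ G ht hs hn hG rfl rfl rfl⟩
    · exact ⟨⟨_, _, _⟩, .odd_eq _ ht hs hn rfl rfl rfl⟩
    · obtain ⟨c1, c2, c3⟩ := h.subGt_counts ht hs hn rfl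
      obtain ⟨G, hG⟩ := exists_evenAlgorithm (P := IsSucc.subGt P ((P.st - P.su) / 2))
        (h.even_t_sub_one ht) (le_refl 2) hv2.ge c3 (by simp only [IsSucc.subGt]; omega)
      exact ⟨⟨_, _, _⟩, .odd_gt _ G _ ht hs hn rfl hG rfl rfl rfl⟩
  · by_cases hw : ∃ w, (∀ i < P.su, P.u - P.fillCount i = w) ∧
        ∀ j < P.sv, P.v - P.fillCount (P.su + j) = w
    · obtain ⟨w, hw⟩ := hw
      obtain ⟨c1, c2, c3, c4, c5⟩ := h.subSame_counts hs hw
      obtain ⟨G, hG⟩ := exists_evenAlgorithm (P := IsSucc.subSame P (P.xt / P.t) w)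
        (h.even_t_sub_one ht) c1 c1 c5 h.su_pos
      exact ⟨⟨_, _, _⟩, .fill_same _ G (P.xt / P.t) w ht hs (by linarith) le_rfl hw hG rfl rfl rfl⟩
    · obtain ⟨T, R, hR⟩ := exists_generalEvenAlgorithm (P.xt - P.xt / P.t)
        (Sum.elim (fun i : Fin P.su => P.xu - P.fillCount i * (P.xt / P.t))
          (fun j : Fin P.sv => P.xv - P.fillCount (P.su + j) * (P.xt / P.t)))
        (h.even_t_sub_one ht) h.card_sinks_pos (h.two_le_len hs) (h.sum_len hs)
      exact ⟨⟨_, _, _⟩, .fill_mixed _ (P.xt / P.t) T R ht hs (by linarith) le_rfl hw hR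
        rfl rfl rfl⟩

end Problem

/-! ### Excesses over a given value

For a value `g`, the excess of a row is the amount by which its sum exceeds the sum of a row of the
same length with all entries equal to `g`. -/

namespace Problem

/-- The excess of a row of `T`. -/
noncomputable def eT (P : Problem) (g : ℝ) : ℝ := P.xt - P.t * g

/-- The excess of a row of `U`. -/
noncomputable def eU (P : Problem) (g : ℝ) : ℝ := P.xu - P.u * g

/-- The excess of a row of `V`. -/
noncomputable def eV (P : Problem) (g : ℝ) : ℝ := P.xv - P.v * g

/-- The increase of the excess of the remaining entries if a row of `V` is added to a tree. -/
noncomputable def eD (P : Problem) (g : ℝ) : ℝ := ((P.v : ℝ) - 1) * P.eT g - P.eV g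

/-- The increase of the number of remaining entries if a row of `V` is added to a tree. -/
noncomputable def dd (P : Problem) : ℝ := ((P.v : ℝ) - 1) * P.t - P.v

/-- The number of trees. -/
noncomputable def hh (P : Problem) : ℝ := (P.st : ℝ) - ((P.v : ℝ) - 1) * P.sv

variable {P : Problem}

namespace Is3MDAP

lemma casts (h : P.Is3MDAP) : (2 : ℝ) ≤ P.t ∧ (2 : ℝ) ≤ P.u ∧ (1 : ℝ) ≤ P.v ∧
    (1 : ℝ) ≤ P.st ∧ (1 : ℝ) ≤ P.su := by
  have h1 := h.two_le_t
  have h2 := h.two_le_u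
  have h3 := h.one_le_v
  have h4 := h.st_pos
  have h5 := h.su_pos
  exact ⟨by exact_mod_cast h1, by exact_mod_cast h2, by exact_mod_cast h3, by exact_mod_cast h4,
    by exact_mod_cast h5⟩

lemma total (h : P.Is3MDAP) (g : ℝ) :
    P.st * P.eT g = P.su * P.eU g + P.sv * P.eV g := by
  have he : (P.su : ℝ) * P.u + P.sv * P.v = P.st * P.t := by exact_mod_cast h.entries_eq
  simp only [eT, eU, eV]
  linear_combination g * he - h.sums_eq

lemma entries_cast (h : P.Is3MDAP) : (P.su : ℝ) * P.u + P.sv * P.v = P.st * P.t := by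
  exact_mod_cast h.entries_eq

/-- The terms with `g` cancel, so this is the inequality of the averages for every `g`. The next two
lemmas place the average of `T` between those of `U` and `V`, strictly below that of `U` being
excluded once `V` is nonempty. -/
lemma eU_eV (h : P.Is3MDAP) (g : ℝ) : P.v * P.eU g < P.u * P.eV g := by
  obtain ⟨-, h2, h3, -, -⟩ := h.casts
  have := h.average_lt
  rw [div_lt_div_iff₀ (by linarith) (by linarith)] at this
  simp only [eU, eV]
  linarith

lemma eT_eV (h : P.Is3MDAP) (g : ℝ) : P.v * P.eT g < P.t * P.eV g := by
  obtain ⟨-, -, -, h4, h5⟩ := h.casts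
  have e1 := h.total g
  have e2 := h.entries_cast
  have e3 := mul_lt_mul_of_pos_left (h.eU_eV g) (show (0 : ℝ) < P.su by linarith)
  have : (P.st : ℝ) * (P.v * P.eT g) < P.st * (P.t * P.eV g) := by
    have f1 : (P.st : ℝ) * (P.v * P.eT g) = P.v * (P.su * P.eU g + P.sv * P.eV g) := by
      rw [← e1]; ring
    have f2 : (P.st : ℝ) * (P.t * P.eV g) = (P.su * P.u + P.sv * P.v) * P.eV g := by
      rw [e2]; ring
    rw [f1, f2]
    linarith
  exact lt_of_mul_lt_mul_left this (by linarith)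

lemma eU_eT (h : P.Is3MDAP) (hsv : 0 < P.sv) (g : ℝ) : P.t * P.eU g < P.u * P.eT g := by
  obtain ⟨-, -, -, h4, h5⟩ := h.casts
  have e1 := h.total g
  have e2 := h.entries_cast
  have e3 := mul_lt_mul_of_pos_left (h.eU_eV g) (show (0 : ℝ) < P.sv by exact_mod_cast hsv)
  have : (P.st : ℝ) * (P.t * P.eU g) < P.st * (P.u * P.eT g) := by
    have f1 : (P.st : ℝ) * (P.u * P.eT g) = P.u * (P.su * P.eU g + P.sv * P.eV g) := by
      rw [← e1]; ring
    have f2 : (P.st : ℝ) * (P.t * P.eU g) = (P.su * P.u + P.sv * P.v) * P.eU g := by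
      rw [e2]; ring
    rw [f1, f2]
    linarith
  exact lt_of_mul_lt_mul_left this (by linarith)

/-- The total excess of `U` is what `hh` trees with altogether `sv` rows of `V` would leave over.
`su_u` is the same statement for numbers of entries. -/
lemma su_eU (h : P.Is3MDAP) (g : ℝ) : P.su * P.eU g = P.sv * P.eD g + P.hh * P.eT g := by
  have := h.total g
  simp only [eD, hh]
  linear_combination -this

lemma su_u (h : P.Is3MDAP) : (P.su : ℝ) * P.u = P.sv * P.dd + P.hh * P.t := by
  have := h.entries_cast
  simp only [dd, hh]
  linear_combination this

lemma dd_pos (h : P.Is3MDAP) : 0 < P.dd + P.u := by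
  obtain ⟨h1, h2, h3, -, -⟩ := h.casts
  simp only [dd]
  nlinarith

lemma cross_eD (g : ℝ) : P.eT g * P.dd - P.t * P.eD g = P.t * P.eV g - P.v * P.eT g := by
  simp only [eD, dd]
  ring

/-- Sign of the cross product of the vectors of `U` and of a tree. -/
lemma su_cross (h : P.Is3MDAP) (g b : ℝ) :
    P.su * (P.eU g * (b * P.dd + P.t) - P.u * (P.eT g + b * P.eD g)) =
      (b * P.hh - P.sv) * (P.t * P.eV g - P.v * P.eT g) := by
  rw [← cross_eD]
  linear_combination (b * P.dd + P.t) * h.su_eU g - (P.eT g + b * P.eD g) * h.su_u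

lemma su_cross_eD (h : P.Is3MDAP) (g : ℝ) :
    P.su * (P.eU g * P.dd - P.u * P.eD g) = P.hh * (P.t * P.eV g - P.v * P.eT g) := by
  rw [← cross_eD]
  linear_combination P.dd * h.su_eU g - P.eD g * h.su_u

lemma eD_iff (h : P.Is3MDAP) (g : ℝ) : P.eU g * P.dd ≤ P.u * P.eD g ↔ P.hh ≤ 0 := by
  have h1 := h.su_cross_eD g
  have h2 := sub_pos.mpr (h.eT_eV g)
  have h3 : (0 : ℝ) < P.su := by exact_mod_cast h.su_pos
  constructor
  · intro hc
    by_contra! hpos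
    have := mul_pos hpos h2
    nlinarith
  · intro hc
    by_contra! hpos
    have := mul_pos h3 (sub_pos.mpr hpos)
    nlinarith

/-- Cleared of denominators, the inequality compares `xu/u` with the change of sum per entry caused
by a further row of `V` in a tree. By `su_cross_eD` that comparison has the sign of `hh`, so only
the dimensions matter. -/
lemma xu_le_xInf_iff (h : P.Is3MDAP) : P.xu ≤ P.xInf ↔ P.hh ≤ 0 := by
  rw [← h.eD_iff 0]
  have h1 := h.dd_pos
  obtain ⟨ht, -, -, -, -⟩ := h.casts
  have e1 : P.gam * ((P.v : ℝ) - 1) * P.t = ((P.v : ℝ) - 1) * P.xt := by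
    have : (P.t : ℝ) ≠ 0 := by linarith
    simp only [gam]
    field_simp
  have e2 : ((P.v : ℝ) - 1) * P.t + P.u - P.v = P.dd + P.u := by simp only [dd]; ring
  rw [xInf, e1, e2, div_mul_eq_mul_div, le_div_iff₀ h1]
  simp only [lam, eU, eD, eT, eV]
  constructor <;> intro hc <;> linarith

/-- `xu = x_b` means that the entries left over by a tree with `b` rows of `V` have the same average
as `U`. By `su_cross` this happens exactly when `b` is the mean number of rows of `V` per tree. -/
lemma xu_eq_xSeq_iff (h : P.Is3MDAP) (b : ℕ) : P.xu = P.xSeq b ↔ (P.sv : ℝ) = b * P.hh := by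
  have h1 := h.dd_pos
  obtain ⟨ht, -, -, -, h5⟩ := h.casts
  have e1 : P.gam * ((P.v : ℝ) - 1) * P.t = ((P.v : ℝ) - 1) * P.xt := by
    have : (P.t : ℝ) ≠ 0 := by linarith
    simp only [gam]
    field_simp
  have e1' : P.gam * P.t = P.xt := by
    have : (P.t : ℝ) ≠ 0 := by linarith
    simp only [gam]
    field_simp
  have e2 : ((P.v : ℝ) - 1) * P.t + P.u - P.v = P.dd + P.u := by simp only [dd]; ring
  have hden : 0 < (P.dd + P.u) * b + P.t := by
    have : 0 ≤ (P.dd + P.u) * b := by positivity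
    linarith
  rw [xSeq, e1, e1', e2, eq_div_iff hden.ne']
  have hc := h.su_cross 0 b
  have h2 := sub_pos.mpr (h.eT_eV 0)
  have key : P.xu * ((P.dd + P.u) * b + P.t) = (P.lam + ((P.v : ℝ) - 1) * P.xt) * P.u * b + P.xt * P.u
      ↔ P.eU 0 * (b * P.dd + P.t) - P.u * (P.eT 0 + b * P.eD 0) = 0 := by
    simp only [lam, eU, eD, eT, eV]
    constructor <;> intro hc <;> linarith
  rw [key]
  constructor
  · intro h0
    rw [h0, mul_zero] at hc
    rcases mul_eq_zero.mp hc.symm with h3 | h3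
    · linarith
    · linarith
  · intro h0
    rw [h0, sub_self, zero_mul] at hc
    rcases mul_eq_zero.mp hc with h3 | h3
    · linarith
    · exact h3

end Is3MDAP

end Problem

/-! ### 0-problems of type 1 -/

namespace Problem

variable {P : Problem}

namespace Is3MDAP

lemma avg (h : P.Is3MDAP) : P.t * (P.xu / P.u) ≤ P.xt ∧
    (0 < P.sv → P.t * (P.xu / P.u) < P.xt) ∧ (P.u : ℝ) * (P.xu / P.u) = P.xu ∧
    (P.v : ℝ) * (P.xv / P.v) = P.xv := by
  obtain ⟨ht, hu, hv, hst, -⟩ := h.casts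
  have e1 : (P.u : ℝ) * (P.xu / P.u) = P.xu := mul_div_cancel₀ _ (by linarith)
  have e2 : (P.v : ℝ) * (P.xv / P.v) = P.xv := mul_div_cancel₀ _ (by linarith)
  have hlt : 0 < P.sv → P.t * (P.xu / P.u) < P.xt := fun hsv => by
    have := h.eU_eT hsv (P.xu / P.u)
    simp only [eU, eT, e1, sub_self, mul_zero] at this
    have := pos_of_mul_pos_right this (by linarith)
    linarith
  refine ⟨?_, hlt, e1, e2⟩
  rcases Nat.eq_zero_or_pos P.sv with h0 | h0
  · have := h.total (P.xu / P.u)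
    simp only [eU, eT, e1, h0, sub_self, mul_zero, Nat.cast_zero, zero_mul, add_zero] at this
    rcases mul_eq_zero.mp this with h1 | h1 <;> linarith
  · exact (hlt h0).le

/-- The numerical facts about 0-problems of type 1. -/
lemma type_one_counts (h : P.Is3MDAP) (hh : P.hh ≤ 0) :
    2 ≤ P.v ∧ 0 < P.sv ∧ P.su * P.u = P.st * P.qt + P.rt ∧ P.rt < P.st ∧ P.qt + 2 ≤ P.t ∧
    P.st < P.sv * P.v ∧ P.st + P.sv ≤ P.sv * P.v := by
  have hv1 := h.one_le_v
  obtain ⟨w, hw⟩ : ∃ w, P.v = w + 1 := ⟨P.v - 1, by omega⟩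
  have hst := h.st_pos
  have h0 : P.st ≤ w * P.sv := by
    simp only [Problem.hh, hw] at hh
    push_cast at hh
    have : (P.st : ℝ) ≤ w * P.sv := by linarith
    exact_mod_cast this
  have hw0 : 0 < w := by
    rcases Nat.eq_zero_or_pos w with rfl | h1
    · omega
    · exact h1
  have hsv : 0 < P.sv := by
    rcases Nat.eq_zero_or_pos P.sv with h1 | h1
    · rw [h1] at h0; omega
    · exact h1
  have h1 : P.st + P.sv ≤ P.sv * P.v := by rw [hw]; nlinarith
  have hdm : P.su * P.u = P.st * P.qt + P.rt := (Nat.div_add_mod _ _).symm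
  refine ⟨by omega, hsv, hdm, Nat.mod_lt _ hst, ?_, by omega, h1⟩
  have he := h.entries_eq
  -- If the entries of `U` filled `t - 1` columns of `T`, at most `st` places would remain for `V`,
  -- which has more entries than that.
  by_contra! hc
  have : P.st * (P.t - 1) ≤ P.st * P.qt := Nat.mul_le_mul_left _ (by omega)
  obtain ⟨z, hz⟩ : ∃ z, P.t = z + 1 := ⟨P.t - 1, by have := h.two_le_t; omega⟩
  rw [hz, Nat.add_sub_cancel] at this
  rw [hz] at he
  have e : P.st * (z + 1) = P.st * z + P.st := by ring
  omega

lemma replicate_U (h : P.Is3MDAP) :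
    IsMatrix P.su P.u P.xu (Multiset.replicate P.su (Multiset.replicate P.u (P.xu / P.u))) :=
  isMatrix_replicate (by simp)
    (by rw [Multiset.sum_replicate, nsmul_eq_mul, h.avg.2.2.1])

/-- The problem that is left in the case of few entries of `U`. -/
noncomputable def subSmall (P : Problem) : Problem where
  st := P.sv
  t := P.v
  xt := P.xv
  su := P.st - P.rt
  u := P.t - P.qt
  xu := P.xt - P.qt * (P.xu / P.u)
  sv := P.rt
  v := P.t - P.qt - 1
  xv := P.xt - (P.qt + 1) * (P.xu / P.u)

lemma subSmall_isSucc (h : P.Is3MDAP) (hh : P.hh ≤ 0) (hr : P.rt ≠ 0) (hq : P.qt < P.t - 2) :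
    (subSmall P).IsSucc := by
  obtain ⟨hv, hsv, hdm, hrt, hqt, -, -⟩ := h.type_one_counts hh
  obtain ⟨a1, a2, a3, a4⟩ := h.avg
  obtain ⟨k, hk⟩ : ∃ k, P.t = P.qt + 1 + k := ⟨P.t - P.qt - 1, by omega⟩
  have he := h.entries_eq
  have hk' : (P.t : ℝ) = P.qt + 1 + k := by exact_mod_cast hk
  have hk2 : 2 ≤ k := by omega
  have hk2' : (2 : ℝ) ≤ k := by exact_mod_cast hk2
  have hU : P.t - P.qt = k + 1 := by omega
  have hV : P.t - P.qt - 1 = k := by omega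
  refine ⟨?_, hv, ?_, ?_, ?_, ?_, ?_, ?_⟩ <;> simp only [subSmall]
  · omega
  · omega
  · omega
  · omega
  · rw [hU, Nat.add_sub_cancel, mul_comm P.sv]
    zify [hrt.le] at he hdm ⊢
    rw [hk] at he
    push_cast at he ⊢
    linear_combination hdm - he
  · rw [Nat.cast_sub hrt.le]
    have hdm' : (P.su : ℝ) * P.u = P.st * P.qt + P.rt := by exact_mod_cast hdm
    have hs := h.sums_eq
    linear_combination -hs + (P.su : ℝ) * (-a3) + (P.xu / P.u) * hdm'
  · rw [hU, Nat.add_sub_cancel]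
    push_cast
    rw [div_lt_div_iff₀ (by linarith) (by linarith)]
    have := a2 hsv
    rw [hk'] at this
    nlinarith

/-- With `a = xu/u` and `δ = xt - t·a > 0` one has `ρ = a + δ` and `σ = a + δ/2`. The last
expression is the bound that the even algorithm gives in `spec_large`, where the excesses over `σ`
differ by `ρ - σ`; it equals `a + δ/4`. -/
lemma rho_sigma (h : P.Is3MDAP) (hsv : 0 < P.sv) :
    P.xu / P.u < P.sigma ∧ P.sigma < P.rho ∧ P.xu / P.u ≤ 3 / 2 * P.sigma - P.rho / 2 := by
  obtain ⟨a1, a2, a3, a4⟩ := h.avg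
  have := a2 hsv
  simp only [rho, sigma]
  refine ⟨by linarith, by linarith, by linarith⟩

/-- The problem that is left in the case of many entries of `U`. -/
noncomputable def subLarge (P : Problem) : Problem where
  st := P.st - P.rt
  t := 2
  xt := P.xt - ((P.t : ℝ) - 2) * (P.xu / P.u)
  su := P.rv
  u := P.v - P.qv - 1
  xu := P.xv - (P.qv + 1) * P.rho
  sv := P.sv - P.rv
  v := P.v - P.qv
  xv := P.xv - P.qv * P.rho

lemma large_counts (h : P.Is3MDAP) (hh : P.hh ≤ 0) (hq : ¬ P.qt < P.t - 2) :
    P.qt + 2 = P.t ∧ P.rt = P.sv * P.qv + P.rv ∧ P.rv < P.sv ∧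
    P.rt + 2 * (P.st - P.rt) = P.sv * P.v ∧ P.rt < P.st ∧ P.qv + 2 ≤ P.v ∧
    (P.rv ≠ 0 → P.qv + 3 ≤ P.v) := by
  obtain ⟨hv, hsv, hdm, hrt, hqt, -, hle⟩ := h.type_one_counts hh
  have hq' : P.qt + 2 = P.t := by omega
  have he := h.entries_eq
  have hdv : P.rt = P.sv * P.qv + P.rv := (Nat.div_add_mod _ _).symm
  have e : P.st * P.t = P.st * P.qt + 2 * P.st := by rw [← hq']; ring
  have hc : P.rt + 2 * (P.st - P.rt) = P.sv * P.v := by omega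
  have h2 : P.sv * P.qv + P.rv + 2 * P.sv ≤ P.sv * P.v := by omega
  refine ⟨hq', hdv, Nat.mod_lt _ hsv, hc, hrt, ?_, fun hr => ?_⟩
  · have : P.sv * (P.qv + 2) ≤ P.sv * P.v := by rw [mul_add]; omega
    exact Nat.le_of_mul_le_mul_left this hsv
  · have : P.sv * (P.qv + 2) < P.sv * P.v := by rw [mul_add]; omega
    exact Nat.lt_of_mul_lt_mul_left this

lemma subLarge_entries (h : P.Is3MDAP) (hh : P.hh ≤ 0) (hq : ¬ P.qt < P.t - 2) :
    P.rv * (P.v - P.qv - 1) + (P.sv - P.rv) * (P.v - P.qv) = (P.st - P.rt) * 2 := by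
  obtain ⟨l1, l2, l3, l4, l5, l6, l7⟩ := h.large_counts hh hq
  obtain ⟨k, hk⟩ : ∃ k, P.v = P.qv + 1 + k := ⟨P.v - P.qv - 1, by omega⟩
  have hV : P.v - P.qv = k + 1 := by omega
  rw [hV, Nat.add_sub_cancel]
  zify [l3.le, l5.le] at l2 l4 ⊢
  rw [hk] at l4
  push_cast at l4
  linear_combination l2 - l4

lemma spec_small {F G : Filling} (h : P.Is3MDAP) (hh : P.hh ≤ 0) (hr : P.rt ≠ 0)
    (hq : P.qt < P.t - 2) (hG : (subSmall P).SuccAlgorithm G)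
    (hT : F.T = G.U.map (fun r => r + Multiset.replicate P.qt (P.xu / P.u)) +
      G.V.map (fun r => r + Multiset.replicate (P.qt + 1) (P.xu / P.u)))
    (hU : F.U = Multiset.replicate P.su (Multiset.replicate P.u (P.xu / P.u)))
    (hV : F.V = G.T) : P.IsFeasible F ∧ ∀ y ∈ F.V.join, P.xu / P.u ≤ y := by
  obtain ⟨hv, hsv, hdm, hrt, hqt, -, -⟩ := h.type_one_counts hh
  obtain ⟨⟨f1, f2, f3, f4⟩, k⟩ := hG.spec (h.subSmall_isSucc hh hr hq)
  refine ⟨⟨?_, ?_, ?_, ?_⟩, ?_⟩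
  · rw [hT]
    have := (f2.add_replicate (c' := P.t) (n := P.qt) (μ := P.xu / P.u) (x' := P.xt)
      (by simp only [subSmall]; omega) (by simp only [subSmall]; ring)).add
      (f3.add_replicate (c' := P.t) (n := P.qt + 1) (μ := P.xu / P.u) (x' := P.xt)
      (by simp only [subSmall]; omega) (by simp only [subSmall]; push_cast; ring))
    simp only [subSmall] at this
    rwa [Nat.sub_add_cancel hrt.le] at this
  · rw [hU]
    exact h.replicate_U
  · rw [hV]
    exact f1
  · rw [hT, hU, hV, Multiset.join_add, join_map_add_replicate, join_map_add_replicate, f4, f2.1,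
      f3.1, join_replicate_replicate]
    have : P.su * P.u = (P.st - P.rt) * P.qt + P.rt * (P.qt + 1) := by
      zify [hrt.le] at hdm ⊢
      linear_combination hdm
    rw [this, Multiset.replicate_add]
    simp only [subSmall]
    abel
  · intro y hy
    rw [hV] at hy
    -- The two row sums in `subSmall` differ by one entry `xu/u`, so the bound of
    -- `SuccAlgorithm.spec` is `xu/u` itself.
    have := k y hy
    simp only [subSmall] at this
    linarith

lemma spec_balanced {F : Filling} (h : P.Is3MDAP) (hh : P.hh ≤ 0) (hr : P.rt = 0)
    (hT : F.T = Multiset.replicate P.st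
      (Multiset.replicate P.qt (P.xu / P.u) + Multiset.replicate (P.t - P.qt) (P.xv / P.v)))
    (hU : F.U = Multiset.replicate P.su (Multiset.replicate P.u (P.xu / P.u)))
    (hV : F.V = Multiset.replicate P.sv (Multiset.replicate P.v (P.xv / P.v))) :
    P.IsFeasible F ∧ ∀ y ∈ F.V.join, P.xu / P.u ≤ y := by
  obtain ⟨hv, hsv, hdm, hrt, hqt, -, -⟩ := h.type_one_counts hh
  obtain ⟨a1, a2, a3, a4⟩ := h.avg
  have he := h.entries_eq
  have hnv : P.sv * P.v = P.st * (P.t - P.qt) := by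
    zify [show P.qt ≤ P.t by omega] at hdm he ⊢
    rw [hr] at hdm
    push_cast at hdm
    linear_combination he - hdm
  refine ⟨⟨?_, ?_, ?_, ?_⟩, ?_⟩
  · rw [hT]
    refine isMatrix_replicate (by simp; omega) ?_
    rw [Multiset.sum_add, Multiset.sum_replicate, Multiset.sum_replicate, nsmul_eq_mul,
      nsmul_eq_mul]
    have hst' : (P.st : ℝ) ≠ 0 := by have := h.st_pos; positivity
    have hnv' : (P.sv : ℝ) * P.v = P.st * ((P.t - P.qt : ℕ) : ℝ) := by exact_mod_cast hnv
    have hdm' : (P.su : ℝ) * P.u = P.st * P.qt := by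
      rw [hr] at hdm
      exact_mod_cast hdm
    apply mul_left_cancel₀ hst'
    linear_combination h.sums_eq - (P.xv / P.v) * hnv' - (P.xu / P.u) * hdm' + P.su * a3 + P.sv * a4
  · rw [hU]
    exact h.replicate_U
  · rw [hV]
    exact isMatrix_replicate (by simp) (by rw [Multiset.sum_replicate, nsmul_eq_mul, a4])
  · rw [hT, hU, hV, join_replicate_replicate, join_replicate_replicate, hnv, hdm, hr,
      add_zero, Multiset.join, Multiset.sum_replicate, nsmul_add]
    simp only [← Multiset.nsmul_singleton, smul_smul]
  · intro y hy
    rw [hV] at hy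
    rw [mem_join_replicate_replicate hy]
    exact h.average_lt.le

lemma spec_large_balanced {F : Filling} (h : P.Is3MDAP) (hh : P.hh ≤ 0)
    (hq : ¬ P.qt < P.t - 2) (hrv : P.rv = 0)
    (hT : F.T = Multiset.replicate P.rt
        (P.rho ::ₘ Multiset.replicate (P.t - 1) (P.xu / P.u)) +
      Multiset.replicate (P.st - P.rt)
        (Multiset.replicate (P.t - 2) (P.xu / P.u) + {P.sigma, P.sigma}))
    (hU : F.U = Multiset.replicate P.su (Multiset.replicate P.u (P.xu / P.u)))
    (hV : F.V = Multiset.replicate P.sv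
      (Multiset.replicate P.qv P.rho + Multiset.replicate (P.v - P.qv) P.sigma)) :
    P.IsFeasible F ∧ ∀ y ∈ F.V.join, P.xu / P.u ≤ y := by
  obtain ⟨hv, hsv, hdm, hrt, hqt, -, -⟩ := h.type_one_counts hh
  obtain ⟨l1, l2, l3, l4, l5, l6, l7⟩ := h.large_counts hh hq
  obtain ⟨a1, a2, a3, a4⟩ := h.avg
  obtain ⟨r1, r2, -⟩ := h.rho_sigma hsv
  have ht2 : ((P.t - 2 : ℕ) : ℝ) = P.t - 2 := by push_cast [h.two_le_t]; ring
  have ht1 : ((P.t - 1 : ℕ) : ℝ) = P.t - 1 := by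
    push_cast [show 1 ≤ P.t by have := h.two_le_t; omega]; ring
  have hqv : ((P.v - P.qv : ℕ) : ℝ) = P.v - P.qv := by push_cast [show P.qv ≤ P.v by omega]; ring
  rw [hrv, add_zero] at l2
  refine ⟨⟨?_, ?_, ?_, ?_⟩, ?_⟩
  · rw [hT]
    have := (isMatrix_replicate (s := P.rt) (c := P.t) (x := P.xt)
      (r := P.rho ::ₘ Multiset.replicate (P.t - 1) (P.xu / P.u)) (by simp; omega) (by
        rw [Multiset.sum_cons, Multiset.sum_replicate, nsmul_eq_mul, ht1, rho]; ring)).add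
      (isMatrix_replicate (s := P.st - P.rt) (c := P.t) (x := P.xt)
      (r := Multiset.replicate (P.t - 2) (P.xu / P.u) + {P.sigma, P.sigma}) (by simp; omega) (by
        simp only [Multiset.sum_add, Multiset.sum_replicate, nsmul_eq_mul, ht2, sigma,
          Multiset.insert_eq_cons, Multiset.sum_cons, Multiset.sum_singleton]
        ring))
    rwa [Nat.add_sub_cancel' hrt.le] at this
  · rw [hU]
    exact h.replicate_U
  · rw [hV]
    refine isMatrix_replicate (by simp; omega) ?_
    rw [Multiset.sum_add, Multiset.sum_replicate, Multiset.sum_replicate, nsmul_eq_mul,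
      nsmul_eq_mul, hqv]
    have hsv' : (P.sv : ℝ) ≠ 0 := by positivity
    have l2' : (P.rt : ℝ) = P.sv * P.qv := by exact_mod_cast l2
    have l4' : (P.rt : ℝ) + 2 * (P.st - P.rt) = P.sv * P.v := by
      rw [← Nat.cast_sub hrt.le]
      exact_mod_cast l4
    have l1' : (P.qt : ℝ) + 2 = P.t := by exact_mod_cast l1
    have hdm' : (P.su : ℝ) * P.u = P.st * P.qt + P.rt := by exact_mod_cast hdm
    apply mul_left_cancel₀ hsv'
    have hs := h.sums_eq
    have e1 : (P.sv : ℝ) * (P.qv * P.rho + (P.v - P.qv) * P.sigma) =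
      P.rt * P.rho + 2 * (P.st - P.rt) * P.sigma := by
      linear_combination (P.sigma - P.rho) * l2' - P.sigma * l4'
    rw [e1]
    simp only [rho, sigma]
    linear_combination -hs - (P.su : ℝ) * a3 + (P.xu / P.u) * hdm' - (P.xu / P.u) * P.st * (-l1')
  · rw [hT, hU, hV, Multiset.join_add, join_replicate_replicate]
    have e2 : ({P.sigma, P.sigma} : Multiset ℝ) = Multiset.replicate 2 P.sigma := rfl
    rw [e2]
    have e3 : P.su * P.u = P.rt * (P.t - 1) + (P.st - P.rt) * (P.t - 2) := by
      rw [hdm, ← l1, show P.qt + 2 - 1 = P.qt + 1 by omega, Nat.add_sub_cancel]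
      zify [hrt.le]
      ring
    have e4 : P.sv * (P.v - P.qv) = (P.st - P.rt) * 2 := by
      rw [Nat.mul_sub, ← l2]
      omega
    simp only [join_replicate]
    simp only [nsmul_add, ← Multiset.nsmul_singleton,
      smul_smul, ← Multiset.singleton_add, ← l2, e3, e4, add_nsmul]
    abel
  · intro y hy
    rw [hV] at hy
    obtain ⟨r, hr, hy⟩ := Multiset.mem_join.mp hy
    rw [Multiset.eq_of_mem_replicate hr] at hy
    rcases Multiset.mem_add.mp hy with hy | hy
    · rw [Multiset.eq_of_mem_replicate hy]; linarith
    · rw [Multiset.eq_of_mem_replicate hy]; linarith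

lemma spec_large {F G : Filling} (h : P.Is3MDAP) (hh : P.hh ≤ 0)
    (hq : ¬ P.qt < P.t - 2) (hrv : P.rv ≠ 0) (hG : (subLarge P).EvenAlgorithm G)
    (hT : F.T = Multiset.replicate P.rt
        (P.rho ::ₘ Multiset.replicate (P.t - 1) (P.xu / P.u)) +
      G.T.map (fun r => r + Multiset.replicate (P.t - 2) (P.xu / P.u)))
    (hU : F.U = Multiset.replicate P.su (Multiset.replicate P.u (P.xu / P.u)))
    (hV : F.V = G.U.map (fun r => r + Multiset.replicate (P.qv + 1) P.rho) +
      G.V.map (fun r => r + Multiset.replicate P.qv P.rho)) :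
    P.IsFeasible F ∧ ∀ y ∈ F.V.join, P.xu / P.u ≤ y := by
  obtain ⟨hv, hsv, hdm, hrt, hqt, -, -⟩ := h.type_one_counts hh
  obtain ⟨l1, l2, l3, l4, l5, l6, l7⟩ := h.large_counts hh hq
  have l8 := l7 hrv
  obtain ⟨a1, a2, a3, a4⟩ := h.avg
  obtain ⟨r1, r2, r3⟩ := h.rho_sigma hsv
  have ht2 : ((P.t - 2 : ℕ) : ℝ) = P.t - 2 := by push_cast [h.two_le_t]; ring
  have ht1 : ((P.t - 1 : ℕ) : ℝ) = P.t - 1 := by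
    push_cast [show 1 ≤ P.t by have := h.two_le_t; omega]; ring
  have hqv : ((P.v - P.qv : ℕ) : ℝ) = P.v - P.qv := by push_cast [show P.qv ≤ P.v by omega]; ring
  have hqv1 : ((P.v - P.qv - 1 : ℕ) : ℝ) = P.v - P.qv - 1 := by
    rw [Nat.cast_sub (by omega), hqv]; simp
  have l2' : (P.rt : ℝ) = P.sv * P.qv + P.rv := by exact_mod_cast l2
  have l1' : (P.qt : ℝ) + 2 = P.t := by exact_mod_cast l1
  have hdm' : (P.su : ℝ) * P.u = P.st * P.qt + P.rt := by exact_mod_cast hdm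
  have hσ : (P.xt - ((P.t : ℝ) - 2) * (P.xu / P.u)) / (2 : ℕ) = P.sigma := by
    rw [sigma]
    norm_num
  obtain ⟨⟨f1, f2, f3, f4⟩, k⟩ := hG.spec even_two (by simp only [subLarge]; omega)
    (by simp only [subLarge]; omega) (by simp only [subLarge]; omega)
    (by simp only [subLarge]; omega) (h.subLarge_entries hh hq) (by
      simp only [subLarge]
      rw [Nat.cast_sub l3.le, Nat.cast_sub l5.le]
      simp only [rho]
      linear_combination h.sums_eq + (P.su : ℝ) * a3 - (P.xu / P.u) * hdm'
        + (P.xu / P.u) * P.st * (-l1') + (P.xt - (P.t - 1) * (P.xu / P.u)) * l2') (by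
      simp only [subLarge]
      rw [hσ, hqv, hqv1]
      linarith)
  refine ⟨⟨?_, ?_, ?_, ?_⟩, ?_⟩
  · rw [hT]
    have := (isMatrix_replicate (s := P.rt) (c := P.t) (x := P.xt)
      (r := P.rho ::ₘ Multiset.replicate (P.t - 1) (P.xu / P.u)) (by simp; omega) (by
        rw [Multiset.sum_cons, Multiset.sum_replicate, nsmul_eq_mul, ht1, rho]; ring)).add
      (f1.add_replicate (c' := P.t) (n := P.t - 2) (μ := P.xu / P.u) (x' := P.xt)
      (by simp only [subLarge]; omega) (by rw [ht2]; simp only [subLarge]; ring))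
    simp only [subLarge] at this
    rwa [Nat.add_sub_cancel' hrt.le] at this
  · rw [hU]
    exact h.replicate_U
  · rw [hV]
    have := (f2.add_replicate (c' := P.v) (n := P.qv + 1) (μ := P.rho) (x' := P.xv)
      (by simp only [subLarge]; omega) (by simp only [subLarge]; push_cast; ring)).add
      (f3.add_replicate (c' := P.v) (n := P.qv) (μ := P.rho) (x' := P.xv)
      (by simp only [subLarge]; omega) (by simp only [subLarge]; ring))
    simp only [subLarge] at this
    rwa [Nat.add_sub_cancel' l3.le] at this
  · have e3 : P.su * P.u = P.rt * (P.t - 1) + (P.st - P.rt) * (P.t - 2) := by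
      rw [hdm, ← l1, show P.qt + 2 - 1 = P.qt + 1 by omega, Nat.add_sub_cancel]
      zify [hrt.le]
      ring
    have e4 : P.rt = P.rv * (P.qv + 1) + (P.sv - P.rv) * P.qv := by
      rw [l2]
      zify [l3.le]
      ring
    have e5 : (Multiset.replicate P.rt (P.rho ::ₘ Multiset.replicate (P.t - 1) (P.xu / P.u)) :
        Rows).join = Multiset.replicate P.rt P.rho +
          Multiset.replicate (P.rt * (P.t - 1)) (P.xu / P.u) := by
      rw [join_replicate, ← Multiset.singleton_add, nsmul_add, Multiset.nsmul_singleton,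
        ← Multiset.nsmul_singleton _ (P.t - 1), smul_smul, Multiset.nsmul_singleton]
    rw [hT, hU, hV, Multiset.join_add, Multiset.join_add, e5, join_replicate_replicate, e3,
      join_map_add_replicate, join_map_add_replicate, join_map_add_replicate, f4, f1.1, f2.1,
      f3.1, Multiset.replicate_add]
    simp only [subLarge]
    conv_lhs => rw [e4]
    rw [Multiset.replicate_add]
    rw [← e4]
    abel
  · intro y hy
    have hk : ∀ y ∈ G.T.join, P.xu / P.u ≤ y := by
      intro y hy
      refine k _ ?_ ?_ y hy
      · simp only [subLarge]
        rw [hσ]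
        exact r1.le
      · simp only [subLarge]
        rw [hσ, hqv, hqv1]
        linarith
    rw [hV, Multiset.join_add, join_map_add_replicate, join_map_add_replicate] at hy
    simp only [Multiset.mem_add] at hy
    rcases hy with (hy | hy) | (hy | hy)
    · exact hk y (by rw [f4, Multiset.mem_add]; exact Or.inl hy)
    · rw [Multiset.eq_of_mem_replicate hy]; linarith
    · exact hk y (by rw [f4, Multiset.mem_add]; exact Or.inr hy)
    · rw [Multiset.eq_of_mem_replicate hy]; linarith

end Is3MDAP

/-- The algorithm for 0-problems of type 1 produces feasible solutions without small pieces. -/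
lemma ZeroAlgorithm₁.spec {F : Filling} (hF : P.ZeroAlgorithm₁ F) (h : P.Is3MDAP)
    (hh : P.hh ≤ 0) : P.IsFeasible F ∧
      F.U = Multiset.replicate P.su (Multiset.replicate P.u (P.xu / P.u)) ∧
      ∀ y ∈ F.V.join, P.xu / P.u ≤ y := by
  cases hF with
  | balanced hr hT hU hV =>
    have := h.spec_balanced hh hr hT hU hV
    exact ⟨this.1, hU, this.2⟩
  | small G hr hq hG hT hU hV =>
    have := h.spec_small hh hr hq hG hT hU hV
    exact ⟨this.1, hU, this.2⟩
  | large_balanced hr hq hrv hT hU hV =>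
    have := h.spec_large_balanced hh hq hrv hT hU hV
    exact ⟨this.1, hU, this.2⟩
  | large G hr hq hrv hG hT hU hV =>
    have := h.spec_large hh hq hrv hG hT hU hV
    exact ⟨this.1, hU, this.2⟩

lemma exists_zeroAlgorithm₁ (h : P.Is3MDAP) (hh : P.hh ≤ 0) : ∃ F, P.ZeroAlgorithm₁ F := by
  by_cases hr : P.rt = 0
  · exact ⟨⟨_, _, _⟩, .balanced _ hr rfl rfl rfl⟩
  by_cases hq : P.qt < P.t - 2
  · obtain ⟨G, hG⟩ := exists_succAlgorithm (h.subSmall_isSucc hh hr hq)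
    exact ⟨⟨_, _, _⟩, .small _ G hr hq hG rfl rfl rfl⟩
  by_cases hrv : P.rv = 0
  · exact ⟨⟨_, _, _⟩, .large_balanced _ hr hq hrv rfl rfl rfl⟩
  · obtain ⟨l1, l2, l3, l4, l5, l6, l7⟩ := h.large_counts hh hq
    have l8 := l7 hrv
    obtain ⟨G, hG⟩ := exists_evenAlgorithm (P := Is3MDAP.subLarge P) even_two
      (by simp only [Is3MDAP.subLarge]; omega) (by simp only [Is3MDAP.subLarge]; omega)
      (h.subLarge_entries hh hq) (by simp only [Is3MDAP.subLarge]; omega)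
    exact ⟨⟨_, _, _⟩, .large _ G hr hq hrv hG rfl rfl rfl⟩

end Problem

/-- Cutting the beginning of a list into pieces of equal length. -/
lemma sum_range_take_drop (l : List ℝ) (a c m : ℕ) :
    ∑ i ∈ Finset.range m, (((l.drop (a + i * c)).take c : List ℝ) : Multiset ℝ) =
      (((l.drop a).take (m * c) : List ℝ) : Multiset ℝ) := by
  induction m with
  | zero => simp
  | succ m ih =>
    rw [Finset.sum_range_succ, ih, Nat.succ_mul, List.take_add, List.drop_drop,
      ← Multiset.coe_add]

lemma sum_finsetSum (s : Finset ℕ) (f : ℕ → Multiset ℝ) :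
    (∑ i ∈ s, f i).sum = ∑ i ∈ s, (f i).sum :=
  map_sum Multiset.sumAddMonoidHom f s

lemma join_map_range (m : ℕ) (f : ℕ → Multiset ℝ) :
    ((Multiset.range m).map f).join = ∑ i ∈ Finset.range m, f i := rfl

lemma sum_map_singleton_range (m : ℕ) (f : ℕ → ℝ) :
    (Multiset.range m).map f = ∑ i ∈ Finset.range m, ({f i} : Multiset ℝ) :=
  (Multiset.sum_map_singleton ((Multiset.range m).map f)).symm.trans (by
    rw [Multiset.map_map]; rfl)

lemma sum_range_mul_add {M : Type*} [AddCommMonoid M] (f : ℕ → M) (b c a : ℕ) :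
    ∑ k ∈ Finset.range b, ∑ j ∈ Finset.range c, f (k * c + a + j) =
      ∑ i ∈ Finset.range (b * c), f (a + i) := by
  induction b with
  | zero => simp
  | succ b ih =>
    rw [Finset.sum_range_succ, ih, Nat.succ_mul, Finset.sum_range_add]
    congr 1
    exact Finset.sum_congr rfl fun j _ => by congr 1; ring

lemma IsMatrix.sum_join {s c : ℕ} {x : ℝ} {M : Rows} (h : IsMatrix s c x M) :
    M.join.sum = s * x := by
  rw [Multiset.sum_join, Multiset.map_congr rfl (fun r hr => (h.2 r hr).2),
    Multiset.map_const', Multiset.sum_replicate, h.1, nsmul_eq_mul]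

/-! ### Completing a pair: counts, row sums and entries -/

namespace Problem

variable {P : Problem}

lemma pairSize_eq (ht : 2 ≤ P.t) (hv : 2 ≤ P.v) {b : ℕ} (hb : 1 ≤ b) :
    P.pairSize b = P.wCount b * (P.t - 1) + (b - 1) * (P.t - 2) := by
  obtain ⟨t, rfl' : P.t = t + 2⟩ := Nat.exists_eq_add_of_le' ht
  obtain ⟨v, rfl'' : P.v = v + 2⟩ := Nat.exists_eq_add_of_le' hv
  obtain ⟨c, rfl⟩ := Nat.exists_eq_add_of_le' hb
  simp only [pairSize, wCount, rfl', rfl'']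
  simp only [Nat.add_sub_cancel, show t + 2 - 1 = t + 1 by omega, show v + 2 - 1 = v + 1 by omega]
  apply Nat.sub_eq_of_eq_add
  ring

lemma pairSize_cast {b : ℕ} (hv : 1 ≤ P.v) (hb : b * P.v ≤ ((P.v - 1) * b + 1) * P.t) :
    (P.pairSize b : ℝ) = b * P.dd + P.t := by
  rw [pairSize, Nat.cast_sub hb, dd]
  push_cast [Nat.cast_sub hv]
  ring

lemma mul_v_le (ht : 2 ≤ P.t) (hv : 2 ≤ P.v) (b : ℕ) :
    b * P.v ≤ ((P.v - 1) * b + 1) * P.t := by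
  obtain ⟨v, rfl'' : P.v = v + 2⟩ := Nat.exists_eq_add_of_le' hv
  rw [rfl'']
  simp only [show v + 2 - 1 = v + 1 by omega]
  nlinarith [mul_le_mul_of_nonneg_left ht (Nat.zero_le ((v + 1) * b + 1)), Nat.zero_le (v * b)]

section

variable {b : ℕ} {l : List ℝ}

lemma wBlock_length (ht : 2 ≤ P.t) (hv : 2 ≤ P.v) (hb : 1 ≤ b) (hl : l.length = P.pairSize b)
    {i : ℕ} (hi : i < P.wCount b) : (P.wBlock l i).length = P.t - 1 := by
  rw [pairSize_eq ht hv hb] at hl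
  rw [wBlock, List.length_take, List.length_drop, hl]
  have : (i + 1) * (P.t - 1) ≤ P.wCount b * (P.t - 1) := Nat.mul_le_mul_right _ hi
  rw [Nat.succ_mul] at this
  omega

lemma zBlock_length (ht : 2 ≤ P.t) (hv : 2 ≤ P.v) (hb : 1 ≤ b) (hl : l.length = P.pairSize b)
    {i : ℕ} (hi : i < b - 1) : (P.zBlock b l i).length = P.t - 2 := by
  rw [pairSize_eq ht hv hb] at hl
  rw [zBlock, List.length_take, List.length_drop, hl]
  have : (i + 1) * (P.t - 2) ≤ (b - 1) * (P.t - 2) := Nat.mul_le_mul_right _ hi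
  rw [Nat.succ_mul] at this
  omega

lemma sum_blocks (ht : 2 ≤ P.t) (hv : 2 ≤ P.v) (hb : 1 ≤ b) (hl : l.length = P.pairSize b) :
    ∑ i ∈ Finset.range (P.wCount b), (P.wBlock l i : Multiset ℝ) +
      ∑ k ∈ Finset.range (b - 1), (P.zBlock b l k : Multiset ℝ) = l := by
  have h1 := sum_range_take_drop l 0 (P.t - 1) (P.wCount b)
  simp only [zero_add, List.drop_zero] at h1
  simp only [wBlock, zBlock]
  rw [h1, sum_range_take_drop, Multiset.coe_add]
  congr 1
  conv_rhs => rw [← List.take_append_drop (P.wCount b * (P.t - 1)) l]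
  congr 1
  apply List.take_of_length_le
  rw [List.length_drop, hl, pairSize_eq ht hv hb]
  omega

/-- Each new entry occurs once in `A` and once in `B`. The `w_i` are split into the first one, the
middle parts of the rows of `B`, and the last one; the `y_k` and `z_k` close and open consecutive
rows of `B`. -/
lemma pair_join (ht : 2 ≤ P.t) (hv : 2 ≤ P.v) (hb : 1 ≤ b) (hl : l.length = P.pairSize b) :
    (P.pairA b l).join = (l : Multiset ℝ) + (P.pairB b l).join := by
  conv_rhs => rw [← sum_blocks ht hv hb hl]
  have hb0 : b ≠ 0 := by omega
  have hv1 : P.v ≠ 1 := by omega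
  rw [pairA, pairB, if_neg hb0, if_neg hv1, if_neg hv1, Multiset.join_add, join_map_range,
    join_map_range, join_map_range]
  simp only [← Multiset.singleton_add, Finset.sum_add_distrib]
  have hm : ∑ k ∈ Finset.range b, P.middle l k =
      ∑ i ∈ Finset.range (b * (P.v - 2)), {P.pairW l (1 + i)} := by
    simp only [middle, sum_map_singleton_range]
    exact sum_range_mul_add (fun i => ({P.pairW l i} : Multiset ℝ)) b (P.v - 2) 1
  have hw : ∑ i ∈ Finset.range (P.wCount b), ({P.pairW l i} : Multiset ℝ) =
      {P.pairW l 0} + ∑ i ∈ Finset.range (b * (P.v - 2)), {P.pairW l (1 + i)} +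
        {P.pairW l (b * (P.v - 2) + 1)} := by
    rw [wCount, Finset.sum_range_succ, Finset.sum_range_succ', add_comm {P.pairW l 0}]
    simp only [add_comm 1]
  obtain ⟨c, rfl⟩ := Nat.exists_eq_add_of_le' hb
  have hf : ∑ k ∈ Finset.range (c + 1), ({P.first (c + 1) l k} : Multiset ℝ) =
      {P.pairW l 0} + ∑ k ∈ Finset.range c, {P.first (c + 1) l (k + 1)} := by
    rw [Finset.sum_range_succ', add_comm]
    rfl
  have hla : ∑ k ∈ Finset.range (c + 1), ({P.last (c + 1) l k} : Multiset ℝ) =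
      ∑ k ∈ Finset.range c, {P.pairY (c + 1) l k} + {P.pairW l ((c + 1) * (P.v - 2) + 1)} := by
    rw [Finset.sum_range_succ]
    congr 1
    · refine Finset.sum_congr rfl fun k hk => ?_
      rw [Finset.mem_range] at hk
      rw [last, if_neg (by omega)]
    · rw [last, if_pos (by omega)]
  rw [hm, hw, hf, hla, Nat.add_sub_cancel]
  abel

lemma card_middle (k : ℕ) : (P.middle l k).card = P.v - 2 := by
  rw [middle, Multiset.card_map, Multiset.card_range]

lemma pairA_isMatrix_of_two_le (ht : 2 ≤ P.t) (hv : 2 ≤ P.v) (hb : 1 ≤ b)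
    (hl : l.length = P.pairSize b) :
    IsMatrix ((P.v - 1) * b + 1) P.t P.xt (P.pairA b l) := by
  rw [pairA, if_neg (by omega), if_neg (by omega)]
  have h1 : IsMatrix (P.wCount b) P.t P.xt ((Multiset.range (P.wCount b)).map
      (fun i => P.pairW l i ::ₘ (P.wBlock l i : Multiset ℝ))) := by
    refine ⟨by simp, fun r hr => ?_⟩
    obtain ⟨i, hi, rfl⟩ := Multiset.mem_map.mp hr
    rw [Multiset.mem_range] at hi
    refine ⟨?_, ?_⟩
    · rw [Multiset.card_cons, Multiset.coe_card, wBlock_length ht hv hb hl hi]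
      omega
    · rw [Multiset.sum_cons, Multiset.sum_coe, pairW]
      ring
  have h2 : IsMatrix (b - 1) P.t P.xt ((Multiset.range (b - 1)).map
      (fun k => P.pairY b l k ::ₘ P.first b l (k + 1) ::ₘ (P.zBlock b l k : Multiset ℝ))) := by
    refine ⟨by simp, fun r hr => ?_⟩
    obtain ⟨i, hi, rfl⟩ := Multiset.mem_map.mp hr
    rw [Multiset.mem_range] at hi
    refine ⟨?_, ?_⟩
    · rw [Multiset.card_cons, Multiset.card_cons, Multiset.coe_card,
        zBlock_length ht hv hb hl hi]
      omega
    · rw [Multiset.sum_cons, Multiset.sum_cons, Multiset.sum_coe, first, pairY]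
      ring
  have h3 := h1.add h2
  have h4 : P.wCount b + (b - 1) = (P.v - 1) * b + 1 := by
    obtain ⟨v, rfl'' : P.v = v + 2⟩ := Nat.exists_eq_add_of_le' hv
    obtain ⟨c, rfl⟩ := Nat.exists_eq_add_of_le' hb
    rw [wCount, rfl'']
    simp only [Nat.add_sub_cancel, show v + 2 - 1 = v + 1 by omega]
    ring
  rwa [h4] at h3

/-- The construction enforces the sum `xv` only in the first `b - 1` rows of `B`. The last row
follows from the total: the sum of `A` minus the sum `hs` of the given entries. -/
lemma pairB_isMatrix_of_two_le (ht : 2 ≤ P.t) (hv : 2 ≤ P.v) (hb : 1 ≤ b)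
    (hl : l.length = P.pairSize b)
    (hs : l.sum = (((P.v : ℝ) - 1) * b + 1) * P.xt - b * P.xv) :
    IsMatrix b P.v P.xv (P.pairB b l) := by
  have hA := (pairA_isMatrix_of_two_le ht hv hb hl).sum_join
  rw [pair_join ht hv hb hl, Multiset.sum_add, Multiset.sum_coe, hs] at hA
  push_cast [Nat.cast_sub (show 1 ≤ P.v by omega)] at hA
  have hB : (P.pairB b l).join.sum = b * P.xv := by linarith
  rw [pairB, if_neg (by omega), join_map_range] at hB
  rw [pairB, if_neg (by omega)]
  have hrow : ∀ k, k < b - 1 →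
      (P.first b l k ::ₘ P.last b l k ::ₘ P.middle l k).sum = P.xv := by
    intro k hk
    rw [Multiset.sum_cons, Multiset.sum_cons, last, if_neg (by omega), pairY]
    ring
  refine ⟨by simp, fun r hr => ?_⟩
  obtain ⟨i, hi, rfl⟩ := Multiset.mem_map.mp hr
  rw [Multiset.mem_range] at hi
  refine ⟨?_, ?_⟩
  · rw [Multiset.card_cons, Multiset.card_cons, card_middle]
    omega
  · by_cases hib : i < b - 1
    · exact hrow i hib
    · obtain ⟨c, rfl⟩ := Nat.exists_eq_add_of_le' hb
      have hic : i = c := by omega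
      subst hic
      rw [sum_finsetSum, Finset.sum_range_succ, Finset.sum_congr rfl fun k hk =>
        hrow k (by rw [Finset.mem_range] at hk; omega), Finset.sum_const, Finset.card_range,
        nsmul_eq_mul] at hB
      push_cast at hB
      linarith

/-- A completed pair consists of rows of `T` and rows of `V`. -/
theorem pair_spec (ht : 2 ≤ P.t) (hv : 1 ≤ P.v) (hb : b * P.v ≤ ((P.v - 1) * b + 1) * P.t)
    (hl : l.length = P.pairSize b)
    (hs : l.sum = (((P.v : ℝ) - 1) * b + 1) * P.xt - b * P.xv) :
    IsMatrix ((P.v - 1) * b + 1) P.t P.xt (P.pairA b l) ∧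
      IsMatrix b P.v P.xv (P.pairB b l) ∧
      (P.pairA b l).join = (l : Multiset ℝ) + (P.pairB b l).join := by
  rcases Nat.eq_zero_or_pos b with rfl | hb'
  · have hA : P.pairA 0 l = {(l : Multiset ℝ)} := by simp [pairA]
    have hB : P.pairB 0 l = 0 := by simp [pairB]
    rw [hA, hB]
    refine ⟨⟨by simp, fun r hr => ?_⟩, ⟨by simp, fun r hr => by simp at hr⟩, by simp⟩
    rw [Multiset.mem_singleton.mp hr]
    refine ⟨?_, ?_⟩
    · rw [Multiset.coe_card, hl, pairSize]
      simp
    · rw [Multiset.sum_coe, hs]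
      simp
  by_cases hv1 : P.v = 1
  · have hA : P.pairA b l = {(l : Multiset ℝ) + Multiset.replicate b P.xv} := by
      rw [pairA, if_neg (by omega), if_pos hv1]
    have hB : P.pairB b l = Multiset.replicate b {P.xv} := by rw [pairB, if_pos hv1]
    rw [hA, hB]
    simp only [pairSize, hv1, Nat.sub_self, zero_mul, zero_add, one_mul, mul_one,
      Nat.cast_one, sub_self] at hb hl hs ⊢
    refine ⟨⟨by simp, fun r hr => ?_⟩, isMatrix_replicate (by simp) (by simp), ?_⟩
    · rw [Multiset.mem_singleton.mp hr]
      refine ⟨?_, ?_⟩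
      · rw [Multiset.card_add, Multiset.coe_card, Multiset.card_replicate, hl]
        omega
      · rw [Multiset.sum_add, Multiset.sum_coe, Multiset.sum_replicate, hs, nsmul_eq_mul]
        ring
    · rw [join_replicate, Multiset.nsmul_singleton]
      simp [Multiset.join]
  · have hv2 : 2 ≤ P.v := by omega
    exact ⟨pairA_isMatrix_of_two_le ht hv2 hb' hl, pairB_isMatrix_of_two_le ht hv2 hb' hl hs,
      pair_join ht hv2 hb' hl⟩

/-! ### The entries of a completed pair -/

/-- The excess of the given entries in a row with one more entry. -/
noncomputable def wExc (P : Problem) (l : List ℝ) (g : ℝ) (i : ℕ) : ℝ :=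
  (P.wBlock l i).sum - (P.t - 1) * g

/-- The excess of the given entries in a row with two more entries. -/
noncomputable def zExc (P : Problem) (b : ℕ) (l : List ℝ) (g : ℝ) (k : ℕ) : ℝ :=
  (P.zBlock b l k).sum - (P.t - 2) * g

lemma list_sum_sub_nonneg {m : List ℝ} {g : ℝ} (h : ∀ y ∈ m, g ≤ y) :
    0 ≤ m.sum - m.length * g := by
  have := List.card_nsmul_le_sum m g h
  rw [nsmul_eq_mul] at this
  linarith

lemma wExc_nonneg (ht : 2 ≤ P.t) (hv : 2 ≤ P.v) (hb : 1 ≤ b) (hl : l.length = P.pairSize b)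
    {g : ℝ} (hg : ∀ y ∈ l, g ≤ y) {i : ℕ} (hi : i < P.wCount b) : 0 ≤ P.wExc l g i := by
  have h1 := list_sum_sub_nonneg (m := P.wBlock l i) (g := g)
    fun y hy => hg y (List.mem_of_mem_drop (List.mem_of_mem_take hy))
  rw [wBlock_length ht hv hb hl hi, Nat.cast_sub (by omega)] at h1
  rw [wExc]
  push_cast at h1
  exact h1

lemma zExc_nonneg (ht : 2 ≤ P.t) (hv : 2 ≤ P.v) (hb : 1 ≤ b) (hl : l.length = P.pairSize b)
    {g : ℝ} (hg : ∀ y ∈ l, g ≤ y) {i : ℕ} (hi : i < b - 1) : 0 ≤ P.zExc b l g i := by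
  have h1 := list_sum_sub_nonneg (m := P.zBlock b l i) (g := g)
    fun y hy => hg y (List.mem_of_mem_drop (List.mem_of_mem_take hy))
  rw [zBlock_length ht hv hb hl hi, Nat.cast_sub (by omega)] at h1
  rw [zExc]
  push_cast at h1
  exact h1

lemma sum_exc (ht : 2 ≤ P.t) (hv : 2 ≤ P.v) (hb : 1 ≤ b) (hl : l.length = P.pairSize b)
    (hs : l.sum = (((P.v : ℝ) - 1) * b + 1) * P.xt - b * P.xv) (g : ℝ) :
    ∑ i ∈ Finset.range (P.wCount b), P.wExc l g i +
      ∑ k ∈ Finset.range (b - 1), P.zExc b l g k = P.eT g + b * P.eD g := by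
  have h1 := congrArg Multiset.sum (sum_blocks ht hv hb hl)
  rw [Multiset.sum_add, sum_finsetSum, sum_finsetSum] at h1
  simp only [Multiset.sum_coe] at h1
  simp only [wExc, zExc, Finset.sum_sub_distrib, Finset.sum_const, Finset.card_range, nsmul_eq_mul]
  rw [hs] at h1
  have h2 : (P.wCount b : ℝ) = b * (P.v - 2) + 2 := by
    rw [wCount]
    push_cast [Nat.cast_sub hv]
    ring
  rw [h2, Nat.cast_sub hb]
  simp only [eT, eD, eV]
  push_cast
  linear_combination h1

lemma pairW_sub (g : ℝ) (i : ℕ) : P.pairW l i - g = P.eT g - P.wExc l g i := by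
  simp only [pairW, eT, wExc]
  ring

lemma sum_middle (hv : 2 ≤ P.v) (g : ℝ) (k : ℕ) : (P.middle l k).sum =
    (P.v - 2) * (g + P.eT g) - ∑ j ∈ Finset.range (P.v - 2), P.wExc l g (k * (P.v - 2) + 1 + j) := by
  have h : (P.middle l k).sum = ∑ j ∈ Finset.range (P.v - 2), P.pairW l (k * (P.v - 2) + 1 + j) :=
    rfl
  have h2 : ∀ i, P.pairW l i = (g + P.eT g) - P.wExc l g i := fun i => by
    linarith [pairW_sub (P := P) (l := l) g i]
  rw [h]
  simp only [h2, Finset.sum_sub_distrib, Finset.sum_const, Finset.card_range, nsmul_eq_mul]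
  rw [Nat.cast_sub hv]
  push_cast
  ring

/-- Cut the tree at this entry. The part before it has `k` complete rows of `V` and `(v-1)k + 1`
rows of `T`, hence excess `eT + k·eD`; what the given entries in these rows do not use up is the
excess of the cut entry. `pairY_sub` cuts at the other entry that joins two rows. -/
lemma first_sub (hv : 2 ≤ P.v) (g : ℝ) (k : ℕ) : P.first b l k - g =
    P.eT g + k * P.eD g - ∑ i ∈ Finset.range (k * (P.v - 2) + 1), P.wExc l g i -
      ∑ j ∈ Finset.range k, P.zExc b l g j := by
  induction k with
  | zero =>
    simp only [first, pairW_sub, Nat.cast_zero, zero_mul, zero_add, Finset.sum_range_one,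
      Finset.sum_range_zero]
    ring
  | succ k ih =>
    rw [first, Finset.sum_range_succ _ k, sum_middle hv g,
      show (k + 1) * (P.v - 2) + 1 = k * (P.v - 2) + 1 + (P.v - 2) by ring,
      Finset.sum_range_add]
    simp only [eT, eD, eV, zExc, wExc] at ih ⊢
    push_cast
    linear_combination ih

lemma pairY_sub (hv : 2 ≤ P.v) (g : ℝ) (k : ℕ) : P.pairY b l k - g =
    ∑ i ∈ Finset.range ((k + 1) * (P.v - 2) + 1), P.wExc l g i +
      ∑ j ∈ Finset.range k, P.zExc b l g j - (k + 1) * P.eD g := by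
  have ih := first_sub (b := b) (l := l) hv g k
  rw [pairY, sum_middle hv g,
    show (k + 1) * (P.v - 2) + 1 = k * (P.v - 2) + 1 + (P.v - 2) by ring, Finset.sum_range_add]
  simp only [eT, eD, eV] at ih ⊢
  linear_combination -ih

lemma forall_mem_pairB {g : ℝ} (hv : 2 ≤ P.v) (hb : 1 ≤ b)
    (hw : ∀ i < P.wCount b, g ≤ P.pairW l i) (hf : ∀ k < b - 1, g ≤ P.first b l (k + 1))
    (hy : ∀ k < b - 1, g ≤ P.pairY b l k) : ∀ y ∈ (P.pairB b l).join, g ≤ y := by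
  intro y hy'
  rw [pairB, if_neg (by omega)] at hy'
  obtain ⟨r, hr, hyr⟩ := Multiset.mem_join.mp hy'
  obtain ⟨k, hk, rfl⟩ := Multiset.mem_map.mp hr
  rw [Multiset.mem_range] at hk
  rcases Multiset.mem_cons.mp hyr with rfl | hyr
  · rcases k with _ | k
    · exact hw 0 (by rw [wCount]; omega)
    · exact hf k (by omega)
  rcases Multiset.mem_cons.mp hyr with rfl | hyr
  · rw [last]
    split_ifs with h
    · exact hw _ (by rw [wCount]; omega)
    · exact hy k (by omega)
  · obtain ⟨j, hj, rfl⟩ := Multiset.mem_map.mp hyr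
    rw [Multiset.mem_range] at hj
    refine hw _ ?_
    have : (k + 1) * (P.v - 2) ≤ b * (P.v - 2) := Nat.mul_le_mul_right _ hk
    rw [Nat.succ_mul] at this
    rw [wCount]
    omega

/-- If the excess does not increase when a row of `V` is added to a tree, then a pair can be
completed without small entries. -/
theorem le_of_mem_pairB (ht : 2 ≤ P.t) (hv : 2 ≤ P.v) (hb : 1 ≤ b)
    (hl : l.length = P.pairSize b)
    (hs : l.sum = (((P.v : ℝ) - 1) * b + 1) * P.xt - b * P.xv) {g : ℝ} (hg : ∀ y ∈ l, g ≤ y)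
    (hD : P.eD g ≤ 0) : ∀ y ∈ (P.pairB b l).join, g ≤ y := by
  have hW := fun i (hi : i ∈ Finset.range (P.wCount b)) =>
    wExc_nonneg ht hv hb hl hg (Finset.mem_range.mp hi)
  have hZ := fun i (hi : i ∈ Finset.range (b - 1)) =>
    zExc_nonneg ht hv hb hl hg (Finset.mem_range.mp hi)
  have hS := sum_exc ht hv hb hl hs g
  have hW0 := Finset.sum_nonneg hW
  have hZ0 := Finset.sum_nonneg hZ
  have hmul : ∀ x : ℝ, 0 ≤ x → x * P.eD g ≤ 0 := fun x hx => mul_nonpos_of_nonneg_of_nonpos hx hD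
  have hsub : ∀ k, k < b → Finset.range (k * (P.v - 2) + 1) ⊆ Finset.range (P.wCount b) := by
    intro k hk
    have : k * (P.v - 2) ≤ b * (P.v - 2) := Nat.mul_le_mul_right _ hk.le
    rw [Finset.range_subset_range, wCount]
    omega
  have hsub' : ∀ k, k < b → Finset.range ((k + 1) * (P.v - 2) + 1) ⊆ Finset.range (P.wCount b) := by
    intro k hk
    have : (k + 1) * (P.v - 2) ≤ b * (P.v - 2) := Nat.mul_le_mul_right _ hk
    rw [Finset.range_subset_range, wCount]
    omega
  -- All given excesses are nonnegative and add up to `eT + b·eD` by `hS`. So the excess of each new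
  -- entry is a sum of given excesses plus a nonpositive multiple of `eD`: the factor is `-b` for
  -- `w_i`, `-(b-k-1)` for `z_k`, and `-(k+1)` for `y_k`.
  refine forall_mem_pairB hv hb (fun i hi => ?_) (fun k hk => ?_) (fun k hk => ?_)
  · have h1 := pairW_sub (P := P) (l := l) g i
    have h2 := Finset.single_le_sum hW (Finset.mem_range.mpr hi)
    have h3 := hmul b (Nat.cast_nonneg b)
    linarith
  · have h1 := first_sub (b := b) (l := l) hv g (k + 1)
    have h2 := Finset.sum_le_sum_of_subset_of_nonneg (hsub (k + 1) (by omega))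
      fun i hi _ => hW i hi
    have h3 := Finset.sum_le_sum_of_subset_of_nonneg
      (Finset.range_subset_range.mpr (show k + 1 ≤ b - 1 by omega)) fun i hi _ => hZ i hi
    have h4 := hmul (b - (k + 1 : ℕ)) (sub_nonneg.mpr (by exact_mod_cast (by omega)))
    linarith
  · have h1 := pairY_sub (b := b) (l := l) hv g k
    have h2 := Finset.sum_nonneg fun i hi => hW i (hsub' k (by omega) hi)
    have h3 := Finset.sum_nonneg fun i hi =>
      hZ i (Finset.range_subset_range.mpr (show k ≤ b - 1 by omega) hi)
    have h4 := hmul (k + 1) (by positivity)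
    linarith

/-- A pair with a single row of `V` can be completed without small entries, if the given entries are
not too large. -/
theorem le_of_mem_pairB_one (ht : 2 ≤ P.t) (hv : 2 ≤ P.v) (hl : l.length = P.pairSize 1)
    {g : ℝ} {e : ℝ} (hg : ∀ y ∈ l, y ≤ g + e) (he : (P.t - 1) * e ≤ P.eT g) :
    ∀ y ∈ (P.pairB 1 l).join, g ≤ y := by
  refine forall_mem_pairB hv le_rfl (fun i hi => ?_) (fun k hk => by omega) (fun k hk => by omega)
  have h1 := List.sum_le_card_nsmul (P.wBlock l i) (g + e)
    fun y hy => hg y (List.mem_of_mem_drop (List.mem_of_mem_take hy))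
  rw [wBlock_length ht hv le_rfl hl hi, nsmul_eq_mul, Nat.cast_sub (by omega)] at h1
  have h2 := pairW_sub (P := P) (l := l) g i
  rw [wExc] at h2
  push_cast at h1
  linarith

end

end Problem

/-! ### The recursive step and the value of the recursion -/

namespace Problem

/-- The recursion stops at `P`. -/
def Terminal (P : Problem) : Prop := P.xu ≤ P.xInf ∨ ∃ b : ℕ, P.xu = P.xSeq b

/-- The recursion does not stop at the 3M-DAP `P`, and `b` is the size of the pairs. -/
structure IsStep (P : Problem) (b : ℕ) : Prop where
  is3MDAP : P.Is3MDAP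
  hh_pos : 0 < P.hh
  one_le : 1 ≤ b
  lt_sv : (b - 1) * P.pairCount < P.sv
  sv_lt : P.sv < b * P.pairCount

/-- The value of the solution found by the recursive algorithm. -/
inductive Value : Problem → ℝ → Prop
  | terminal (P : Problem) (hP : P.Terminal) : Value P (P.xu / P.u)
  | step (P : Problem) (g : ℝ) (hP : ¬ P.Terminal) (hg : Value (P.reduced P.bHat) g) : Value P g

variable {P : Problem} {b : ℕ}

lemma pairCount_cast (hv : 1 ≤ P.v) (hh : 0 < P.hh) : (P.pairCount : ℝ) = P.hh := by
  have : (((P.v - 1) * P.sv : ℕ) : ℝ) < P.st := by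
    push_cast [Nat.cast_sub hv]
    simp only [Problem.hh] at hh
    linarith
  rw [pairCount, Nat.cast_sub (by exact_mod_cast this.le), Problem.hh]
  push_cast [Nat.cast_sub hv]
  ring

lemma Is3MDAP.terminal_iff (h : P.Is3MDAP) :
    P.Terminal ↔ P.hh ≤ 0 ∨ ∃ b : ℕ, (P.sv : ℝ) = b * P.hh := by
  simp only [Terminal, h.xu_le_xInf_iff, h.xu_eq_xSeq_iff]

/-- The mean `sv / hh` is not an integer, so both inequalities between it and the integers next to
it are strict. The case `b = 0` excludes `sv = 0`. -/
lemma Is3MDAP.isStep (h : P.Is3MDAP) (hP : ¬ P.Terminal) : P.IsStep P.bHat := by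
  rw [h.terminal_iff] at hP
  push Not at hP
  obtain ⟨hh, hb⟩ := hP
  have hc := pairCount_cast h.one_le_v hh
  have hsv : 0 < P.sv := by
    rcases Nat.eq_zero_or_pos P.sv with h0 | h0
    · exact absurd (by simp [h0]) (hb 0)
    · exact h0
  have hsv' : (0 : ℝ) < P.sv := by exact_mod_cast hsv
  have hq : 0 < (P.sv : ℝ) / P.hh := div_pos hsv' hh
  have e : P.bHat = ⌈(P.sv : ℝ) / P.hh⌉₊ := rfl
  have h1 : 1 ≤ P.bHat := by
    rw [e, Nat.one_le_ceil_iff]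
    exact hq
  have h2 := Nat.ceil_lt_add_one hq.le
  have h3 := Nat.le_ceil ((P.sv : ℝ) / P.hh)
  rw [← e] at h2 h3
  rw [div_le_iff₀ hh] at h3
  refine ⟨h, hh, h1, ?_, ?_⟩
  · have : (P.bHat : ℝ) - 1 < (P.sv : ℝ) / P.hh := by linarith
    rw [lt_div_iff₀ hh, ← hc] at this
    rw [← Nat.cast_one, ← Nat.cast_sub h1] at this
    exact_mod_cast this
  · have := lt_of_le_of_ne h3 (hb _)
    rw [← hc] at this
    exact_mod_cast this

namespace IsStep

lemma sv_pos (s : P.IsStep b) : 0 < P.sv := lt_of_le_of_lt (Nat.zero_le _) s.lt_sv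

lemma pairCount (s : P.IsStep b) : (P.pairCount : ℝ) = P.hh :=
  pairCount_cast s.is3MDAP.one_le_v s.hh_pos

lemma lt_sv_cast (s : P.IsStep b) : ((b : ℝ) - 1) * P.hh < P.sv := by
  have := s.lt_sv
  rw [← s.pairCount, ← Nat.cast_one, ← Nat.cast_sub s.one_le]
  exact_mod_cast this

lemma sv_lt_cast (s : P.IsStep b) : (P.sv : ℝ) < b * P.hh := by
  have := s.sv_lt
  rw [← s.pairCount]
  exact_mod_cast this

/-- The extra requirement for `v = 1` gives `(b-1)·st < sv ≤ (t-2)·st`. It ensures that every pair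
leaves at least two entries for `U`, so that the reduced problem has rows of length at least two. -/
lemma add_two_le (s : P.IsStep b) (hv : P.v = 1) : b + 2 ≤ P.t := by
  have h1 := s.is3MDAP.v_eq_one hv
  have h2 := s.lt_sv
  have h3 : P.pairCount = P.st := by rw [Problem.pairCount, hv]; simp
  rw [h3] at h2
  rw [hv, mul_one] at h1
  have h4 := Nat.lt_of_mul_lt_mul_right (lt_of_lt_of_le h2 h1)
  have := s.one_le
  omega

lemma mul_v_le (s : P.IsStep b) {k : ℕ} (hk : k ≤ b) :
    k * P.v ≤ ((P.v - 1) * k + 1) * P.t := by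
  rcases Nat.lt_or_ge P.v 2 with hv | hv
  · have h1 := s.is3MDAP.one_le_v
    have h2 : P.v = 1 := by omega
    have := s.add_two_le h2
    rw [h2]
    simp only [Nat.sub_self, zero_mul, zero_add, one_mul, mul_one]
    omega
  · exact Problem.mul_v_le s.is3MDAP.two_le_t hv k

lemma pairSize_cast (s : P.IsStep b) {k : ℕ} (hk : k ≤ b) :
    (P.pairSize k : ℝ) = k * P.dd + P.t :=
  Problem.pairSize_cast s.is3MDAP.one_le_v (s.mul_v_le hk)

lemma dd_nonneg (s : P.IsStep b) (hv : 2 ≤ P.v) : 0 ≤ P.dd := by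
  obtain ⟨h1, -, -, -, -⟩ := s.is3MDAP.casts
  have : (2 : ℝ) ≤ P.v := by exact_mod_cast hv
  simp only [dd]
  nlinarith

lemma pairSize_of_v_eq_one {k : ℕ} (hv : P.v = 1) : P.pairSize k = P.t - k := by
  rw [pairSize, hv]
  simp

lemma t_le_pairSize (s : P.IsStep b) (hv : 2 ≤ P.v) {k : ℕ} (hk : k ≤ b) :
    P.t ≤ P.pairSize k := by
  have h1 := s.pairSize_cast hk
  have h2 := s.dd_nonneg hv
  have : (P.t : ℝ) ≤ P.pairSize k := by
    rw [h1]
    have : 0 ≤ (k : ℝ) * P.dd := by positivity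
    linarith
  exact_mod_cast this

lemma pairSize_le (s : P.IsStep b) (hv : 2 ≤ P.v) : P.pairSize (b - 1) ≤ P.pairSize b := by
  have h1 := s.pairSize_cast le_rfl
  have h2 := s.pairSize_cast (Nat.sub_le b 1)
  have h3 := s.dd_nonneg hv
  rw [Nat.cast_sub s.one_le] at h2
  have : (P.pairSize (b - 1) : ℝ) ≤ P.pairSize b := by
    rw [h1, h2]
    push_cast
    linarith
  exact_mod_cast this

lemma two_le_pairSize (s : P.IsStep b) {k : ℕ} (hk : k ≤ b) : 2 ≤ P.pairSize k := by
  rcases Nat.lt_or_ge P.v 2 with hv | hv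
  · have h1 := s.is3MDAP.one_le_v
    have h2 : P.v = 1 := by omega
    have := s.add_two_le h2
    rw [pairSize_of_v_eq_one h2]
    omega
  · exact le_trans s.is3MDAP.two_le_t (s.t_le_pairSize hv hk)

lemma reduced_su (s : P.IsStep b) : ((P.reduced b).su : ℝ) = P.sv - (b - 1) * P.hh := by
  simp only [reduced]
  rw [Nat.cast_sub s.lt_sv.le]
  push_cast [Nat.cast_sub s.one_le]
  rw [s.pairCount]

lemma reduced_sv (s : P.IsStep b) : ((P.reduced b).sv : ℝ) = b * P.hh - P.sv := by
  simp only [reduced]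
  rw [Nat.cast_sub s.sv_lt.le]
  push_cast
  rw [s.pairCount]

lemma reduced_u (s : P.IsStep b) : ((P.reduced b).u : ℝ) = b * P.dd + P.t :=
  s.pairSize_cast le_rfl

lemma reduced_v (s : P.IsStep b) : ((P.reduced b).v : ℝ) = (b - 1) * P.dd + P.t := by
  have := s.pairSize_cast (Nat.sub_le b 1)
  rw [Nat.cast_sub s.one_le] at this
  simpa only [reduced, Nat.cast_one] using this

lemma eU_reduced (s : P.IsStep b) (g : ℝ) : (P.reduced b).eU g = P.eT g + b * P.eD g := by
  rw [eU, s.reduced_u]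
  simp only [reduced, eT, eD, eV, dd]
  ring

lemma eV_reduced (s : P.IsStep b) (g : ℝ) : (P.reduced b).eV g = P.eT g + (b - 1) * P.eD g := by
  rw [eV, s.reduced_v]
  simp only [reduced, eT, eD, eV, dd]
  ring

lemma sv_reduced_pos (s : P.IsStep b) : 0 < (P.reduced b).sv := Nat.sub_pos_of_lt s.sv_lt

lemma two_le_v_reduced (s : P.IsStep b) : 2 ≤ (P.reduced b).v :=
  s.two_le_pairSize (Nat.sub_le b 1)

/-- The reduced problem is a 3M-DAP. -/
theorem reduced_is3MDAP (s : P.IsStep b) : (P.reduced b).Is3MDAP := by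
  have h := s.is3MDAP
  have h1 := s.reduced_u
  have h2 := s.reduced_v
  have h3 := s.reduced_su
  have h4 := s.reduced_sv
  obtain ⟨q1, hq1⟩ := h.xt_rational
  obtain ⟨q2, hq2⟩ := h.xu_rational
  obtain ⟨q3, hq3⟩ := h.xv_rational
  have hv2 := s.two_le_v_reduced
  have hu2 : 2 ≤ (P.reduced b).u := s.two_le_pairSize le_rfl
  refine ⟨⟨q2, hq2⟩, ⟨(((P.v : ℚ) - 1) * b + 1) * q1 - b * q3, ?_⟩,
    ⟨(((P.v : ℚ) - 1) * ((b : ℚ) - 1) + 1) * q1 - ((b : ℚ) - 1) * q3, ?_⟩, h.two_le_u, hu2, by omega,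
    by omega, h.su_pos, Nat.sub_pos_of_lt s.lt_sv, ?_, ?_, ?_⟩
  · push_cast
    rw [hq1, hq3]
    rfl
  · push_cast
    rw [hq1, hq3]
    rfl
  · have : ((P.reduced b).su : ℝ) * (P.reduced b).u + (P.reduced b).sv * (P.reduced b).v =
        P.su * P.u := by
      rw [h1, h2, h3, h4, h.su_u]
      ring
    exact_mod_cast this
  · rw [h3, h4]
    have := h.su_eU 0
    simp only [reduced, eU, eT, eD, eV] at this ⊢
    linarith
  · have hv0 : (0 : ℝ) < (P.reduced b).v := by exact_mod_cast (by omega : 0 < (P.reduced b).v)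
    have hu0 : (0 : ℝ) < (P.reduced b).u := by exact_mod_cast (by omega : 0 < (P.reduced b).u)
    rw [div_lt_div_iff₀ hu0 hv0, h1, h2]
    have h5 := Is3MDAP.cross_eD (P := P) 0
    have h6 := h.eT_eV 0
    simp only [reduced, eT, eD, eV] at h5 h6 ⊢
    linarith

/-- The reduced problem keeps only the entries of `U`. This is the measure for termination and for
the induction in `two_mul_eU_le_eV`. -/
lemma size_lt (s : P.IsStep b) : (P.reduced b).st * (P.reduced b).t < P.st * P.t := by
  rw [← s.is3MDAP.entries_eq]
  have : 0 < P.sv * P.v := Nat.mul_pos s.sv_pos s.is3MDAP.one_le_v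
  exact Nat.lt_add_of_pos_right this

lemma eU_eT (s : P.IsStep b) (g : ℝ) : P.t * P.eU g < P.u * P.eT g :=
  s.is3MDAP.eU_eT s.sv_pos g

/-- The source matrix of the reduced problem is `U`, so its `eT` is `eU` of `P` by definition. This
identification is used silently below. -/
lemma eT_eV_reduced (s : P.IsStep b) (g : ℝ) :
    (P.reduced b).v * P.eU g < P.u * (P.reduced b).eV g :=
  s.reduced_is3MDAP.eT_eV g

lemma eU_eT_reduced (s : P.IsStep b) (g : ℝ) :
    P.u * (P.reduced b).eU g < (P.reduced b).u * P.eU g :=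
  s.reduced_is3MDAP.eU_eT s.sv_reduced_pos g

end IsStep

lemma Is3MDAP.eU_div (h : P.Is3MDAP) : P.eU (P.xu / P.u) = 0 := by
  obtain ⟨-, h2, -, -, -⟩ := h.casts
  rw [eU, mul_div_cancel₀ _ (by linarith), sub_self]

namespace Value

variable {g : ℝ}

lemma eU_of_terminal (hg : Value P g) (h : P.Is3MDAP) (hP : P.Terminal) : P.eU g = 0 := by
  cases hg with
  | terminal _ _ => exact h.eU_div
  | step _ _ hn _ => exact absurd hP hn

lemma reduced (hg : Value P g) (hP : ¬ P.Terminal) : Value (P.reduced P.bHat) g := by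
  cases hg with
  | terminal _ hn => exact absurd hn hP
  | step _ _ hn h => exact h

/-- At the end of the recursion `g` is the average of `U` and the excess is zero. Going back a step,
`U'` has a smaller average than its source matrix `U`, so the excess of `U` becomes positive. -/
lemma eU_nonneg (hg : Value P g) (h : P.Is3MDAP) : 0 ≤ P.eU g ∧ (¬ P.Terminal → 0 < P.eU g) := by
  induction hg with
  | terminal P hP => exact ⟨h.eU_div.ge, fun hn => absurd hP hn⟩
  | step P g hP hg ih =>
    have s := h.isStep hP
    have h1 := (ih s.reduced_is3MDAP).1
    have h2 := s.eU_eT_reduced g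
    obtain ⟨-, hu, -, -, -⟩ := h.casts
    obtain ⟨-, hu', -, -, -⟩ := s.reduced_is3MDAP.casts
    have h3 : 0 < (P.reduced P.bHat).u * P.eU g := lt_of_le_of_lt (mul_nonneg (by linarith) h1) h2
    have h4 := pos_of_mul_pos_right h3 (by linarith)
    exact ⟨h4.le, fun _ => h4⟩

lemma eV_pos (hg : Value P g) (h : P.Is3MDAP) : 0 < P.eV g := by
  have h1 := (hg.eU_nonneg h).1
  have h2 := h.eU_eV g
  obtain ⟨-, hu, hv, -, -⟩ := h.casts
  have h3 : 0 < P.u * P.eV g := lt_of_le_of_lt (mul_nonneg (by linarith) h1) h2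
  exact pos_of_mul_pos_right h3 (by linarith)

end Value

end Problem

/-! ### Inequalities between excesses along the recursion -/

namespace Problem

variable {P : Problem} {b b₁ : ℕ} {g : ℝ}

namespace IsStep

lemma one_le_cast (s : P.IsStep b) : (1 : ℝ) ≤ b := by exact_mod_cast s.one_le

lemma reduced_v_of_one (s : P.IsStep 1) : ((P.reduced 1).v : ℝ) = P.t := by
  rw [s.reduced_v]
  simp

lemma reduced_u_eq (s : P.IsStep b) :
    ((P.reduced b).u : ℝ) = (P.reduced b).v + P.dd := by
  rw [s.reduced_v, s.reduced_u]
  ring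

lemma eV_eq (s : P.IsStep b) (g : ℝ) : P.eV g =
    (P.v - 1) * (P.reduced b).eV g +
      ((P.v - 1) * (b - 1) + 1) * ((P.reduced b).eV g - (P.reduced b).eU g) := by
  rw [s.eV_reduced, s.eU_reduced, eD]
  ring

lemma eD_eq (s : P.IsStep b) (g : ℝ) : P.eD g = (P.reduced b).eU g - (P.reduced b).eV g := by
  rw [s.eV_reduced, s.eU_reduced]
  ring

lemma t_le_v_reduced (s : P.IsStep b) (hv : 2 ≤ P.v) : (P.t : ℝ) ≤ (P.reduced b).v := by
  exact_mod_cast s.t_le_pairSize hv (Nat.sub_le b 1)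

/-- If the doubly reduced problem has excess zero, this determines the excess of `V` in the reduced
problem. -/
lemma tail_eq (s₁ : (P.reduced b).IsStep b₁)
    (h0 : ((P.reduced b).reduced b₁).eU g = 0) :
    b₁ * (P.reduced b).eV g = b₁ * ((P.reduced b).v - 1) * P.eU g + P.eU g := by
  rw [s₁.eU_reduced, eD] at h0
  have : (P.reduced b).eT g = P.eU g := rfl
  rw [this] at h0
  linear_combination -h0

/-- If `eU''` vanishes, then `b₁·eV'' = eU`. Inserting this into the comparison of the averages of
the source matrix and `V''` in the doubly reduced problem gives the claim. -/
lemma tail_lt (s₁ : (P.reduced b).IsStep b₁)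
    (h0 : ((P.reduced b).reduced b₁).eU g = 0) :
    b₁ * ((P.reduced b).reduced b₁).v * (P.reduced b).eU g < (P.reduced b).u * P.eU g := by
  have h1 := tail_eq s₁ h0
  have h2 := s₁.eT_eV_reduced g
  have h3 := s₁.eV_reduced g
  have h4 := s₁.eU_reduced g
  have h5 := s₁.one_le_cast
  have : (P.reduced b).eT g = P.eU g := rfl
  rw [this] at h3 h4
  rw [h0] at h4
  have h6 : b₁ * ((P.reduced b).reduced b₁).eV g = P.eU g := by
    rw [h3]
    linear_combination (1 - (b₁ : ℝ)) * h4
  have h7 := mul_lt_mul_of_pos_left h2 (show (0 : ℝ) < b₁ by linarith)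
  have h8 : b₁ * ((P.reduced b).u * ((P.reduced b).reduced b₁).eV g) =
      (P.reduced b).u * P.eU g := by
    rw [← h6]
    ring
  rw [h8] at h7
  linarith

/-- An assumed upper bound for `-2·eD` is turned into an inequality between dimensions only:
`tail_eq` replaces `eV'`, `tail_lt` bounds `eU'`, and the common factor `eU` is removed. The
applications derive a contradiction, or small dimensions, from it. -/
lemma tail_dim (s : P.IsStep b) (s₁ : (P.reduced b).IsStep b₁)
    (h0 : ((P.reduced b).reduced b₁).eU g = 0) {κ : ℝ} (hE : -2 * P.eD g < κ * P.eU g)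
    (hU : 0 ≤ P.eU g) :
    b₁ * ((P.reduced b).reduced b₁).v * (2 * (P.reduced b).v - 2 - κ) +
      2 * ((P.reduced b).reduced b₁).v < 2 * (P.reduced b).u := by
  have h1 := tail_eq s₁ h0
  have h2 := tail_lt s₁ h0
  have h5 := s₁.one_le_cast
  have h6 : (2 : ℝ) ≤ ((P.reduced b).reduced b₁).v := by exact_mod_cast s₁.two_le_v_reduced
  rw [s.eD_eq] at hE
  have h7 := mul_lt_mul_of_pos_left hE
    (show (0 : ℝ) < b₁ * ((P.reduced b).reduced b₁).v by nlinarith)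
  set v₂ : ℝ := (((P.reduced b).reduced b₁).v : ℝ)
  set v₁ : ℝ := ((P.reduced b).v : ℝ)
  set u₁ : ℝ := ((P.reduced b).u : ℝ)
  have h8 : (b₁ * v₂ * (2 * v₁ - 2 - κ) + 2 * v₂ - 2 * u₁) * P.eU g < 0 := by
    have e : b₁ * v₂ * (-2 * ((P.reduced b).eU g - (P.reduced b).eV g)) =
      2 * v₂ * (b₁ * (P.reduced b).eV g) - 2 * (b₁ * v₂ * (P.reduced b).eU g) := by ring
    rw [e, h1] at h7
    linarith
  by_contra! hc
  have := mul_nonneg (sub_nonneg.mpr hc) hU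
  linarith

/-- If `b ≥ 2`, then the excess decreases by at least half of that of `U`, provided the recursion
stops after two steps. -/
lemma eq_one_of_tail (s : P.IsStep b) (s₁ : (P.reduced b).IsStep b₁) (hv : 2 ≤ P.v)
    (h0 : ((P.reduced b).reduced b₁).eU g = 0) (hE : -2 * P.eD g < P.eU g)
    (hU : 0 ≤ P.eU g) : b = 1 := by
  have h1 := s.tail_dim s₁ h0 (κ := 1) (by linarith) hU
  have h5 := s₁.one_le_cast
  have h6 : (2 : ℝ) ≤ ((P.reduced b).reduced b₁).v := by exact_mod_cast s₁.two_le_v_reduced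
  have h7 : (2 : ℝ) ≤ (P.reduced b).v := by exact_mod_cast s.two_le_v_reduced
  have h8 := s.dd_nonneg hv
  by_contra hb
  have hb2 : (2 : ℝ) ≤ b := by
    have := s.one_le
    exact_mod_cast (by omega : 2 ≤ b)
  -- For `b ≥ 2` this gives `u' = v' + dd ≤ 2v' - 2`, too small for the inequality of `tail_dim`.
  have h9 : P.dd + 2 ≤ (P.reduced b).v := by
    rw [s.reduced_v]
    obtain ⟨h, -, -, -, -⟩ := s.is3MDAP.casts
    nlinarith
  rw [s.reduced_u_eq] at h1
  have h10 : (2 : ℝ) ≤ b₁ * ((P.reduced b).reduced b₁).v := by nlinarith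
  have h11 := mul_le_mul_of_nonneg_right h10
    (show (0 : ℝ) ≤ 2 * (P.reduced b).v - 2 - 1 by linarith)
  linarith

/-- The failure of the bound forces `b = 1`. But then `v'' ≥ u ≥ v`, and `tail_dim` is violated in
that case too. -/
lemma eU_le_neg_eD (s : P.IsStep b) (s₁ : (P.reduced b).IsStep b₁) (hv : 2 ≤ P.v)
    (hvu : P.v ≤ P.u) (h0 : ((P.reduced b).reduced b₁).eU g = 0) (hU : 0 ≤ P.eU g) :
    P.eU g ≤ -2 * P.eD g := by
  by_contra! hE
  obtain rfl := s.eq_one_of_tail s₁ hv h0 hE hU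
  have h1 := s.tail_dim s₁ h0 (κ := 1) (by linarith) hU
  have h5 := s₁.one_le_cast
  have h6 : (P.u : ℝ) ≤ ((P.reduced 1).reduced b₁).v := s₁.t_le_v_reduced s.two_le_v_reduced
  have h7 : (P.v : ℝ) ≤ P.u := by exact_mod_cast hvu
  have h8 : (2 : ℝ) ≤ P.v := by exact_mod_cast hv
  obtain ⟨ht, -, -, -, -⟩ := s.is3MDAP.casts
  rw [s.reduced_u_eq, s.reduced_v_of_one, dd] at h1
  have h9 : (P.v : ℝ) ≤ b₁ * ((P.reduced 1).reduced b₁).v := by nlinarith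
  have h10 := mul_le_mul_of_nonneg_right h9 (show (0 : ℝ) ≤ 2 * P.t - 2 - 1 by linarith)
  linarith

lemma eU_reduced_nonneg (s : P.IsStep b) (hg : Value (P.reduced b) g) :
    0 ≤ (P.reduced b).eU g := (hg.eU_nonneg s.reduced_is3MDAP).1

lemma eV_reduced_pos (s : P.IsStep b) (hg : Value (P.reduced b) g) :
    0 < (P.reduced b).eV g := hg.eV_pos s.reduced_is3MDAP

lemma eU_pos (s : P.IsStep b) (hg : Value (P.reduced b) g) : 0 < P.eU g := by
  have h1 := s.eU_eT_reduced g
  have h2 := s.eU_reduced_nonneg hg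
  obtain ⟨-, hu, -, -, -⟩ := s.is3MDAP.casts
  obtain ⟨-, hu', -, -, -⟩ := s.reduced_is3MDAP.casts
  have h3 : 0 < (P.reduced b).u * P.eU g := lt_of_le_of_lt (mul_nonneg (by linarith) h2) h1
  exact pos_of_mul_pos_right h3 (by linarith)

lemma terminal_eU (s : P.IsStep b) (hg : Value (P.reduced b) g) (hP : (P.reduced b).Terminal) :
    (P.reduced b).eU g = 0 := hg.eU_of_terminal s.reduced_is3MDAP hP

lemma hh_reduced_pos (s : P.IsStep b) (hP : ¬ (P.reduced b).Terminal) : 0 < (P.reduced b).hh :=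
  (s.reduced_is3MDAP.isStep hP).hh_pos

/-- A bound for the excess of `V` from bounds for the reduced problem. -/
lemma two_mul_eU_le (s : P.IsStep b) (hg : Value (P.reduced b) g) (hv : 2 ≤ P.v)
    (hUV : (P.reduced b).eU g ≤ (P.reduced b).eV g)
    (hV : ((P.reduced b).v - 1) * P.eU g ≤ (P.reduced b).eV g)
    (hsmall : P.v = 2 → P.t = 2 → (P.reduced b).v = 2 → (P.reduced b).u = 2 →
      2 * P.eU g ≤ 2 * (P.reduced b).eV g - (P.reduced b).eU g) :
    2 * P.eU g ≤ P.eV g := by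
  have e := s.eV_eq g
  have hV0 := s.eV_reduced_pos hg
  have hU0 := s.eU_pos hg
  have hb := s.one_le_cast
  have hv' : (2 : ℝ) ≤ P.v := by exact_mod_cast hv
  have hk : (1 : ℝ) ≤ (P.v - 1) * (b - 1) + 1 := by nlinarith
  have h1 := mul_le_mul_of_nonneg_right hk (sub_nonneg.mpr hUV)
  have h2 : (2 : ℝ) ≤ (P.reduced b).v := by exact_mod_cast s.two_le_v_reduced
  have h3 : 1 * P.eU g ≤ ((P.reduced b).v - 1) * P.eU g :=
    mul_le_mul_of_nonneg_right (by linarith) hU0.le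
  -- By `eV_eq`, `eV` is at least `(v-1)·eV' + (eV' - eU')`, and `eV' ≥ (v'-1)·eU`. The factor 2
  -- comes from `v ≥ 3` or from `v' ≥ 3`. In the remaining case all dimensions are 2 and `hsmall` is
  -- needed.
  by_cases hv3 : P.v = 2
  · by_cases hv1 : (P.reduced b).v = 2
    · have ht : P.t = 2 := by
        have h4 := s.t_le_v_reduced hv
        rw [hv1] at h4
        have := s.is3MDAP.two_le_t
        exact le_antisymm (by exact_mod_cast h4) this
      have hu : (P.reduced b).u = 2 := by
        have h4 := s.reduced_u_eq
        rw [hv1, dd, hv3, ht] at h4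
        norm_num at h4
        exact_mod_cast h4
      have := hsmall hv3 ht hv1 hu
      rw [hv3] at e h1
      push_cast at e h1
      linarith
    · have h5 : (3 : ℝ) ≤ (P.reduced b).v := by
        have := s.two_le_v_reduced
        exact_mod_cast (by omega : 3 ≤ (P.reduced b).v)
      have h6 := mul_le_mul_of_nonneg_right
        (show (2 : ℝ) ≤ (P.reduced b).v - 1 by linarith) hU0.le
      have h7 := mul_le_mul_of_nonneg_right
        (show (1 : ℝ) ≤ P.v - 1 by linarith) hV0.le
      linarith
  · have h5 : (3 : ℝ) ≤ P.v := by exact_mod_cast (by omega : 3 ≤ P.v)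
    have h7 := mul_le_mul_of_nonneg_right
      (show (2 : ℝ) ≤ P.v - 1 by linarith) hV0.le
    linarith

lemma v_le_u_reduced (s : P.IsStep b) (hv : 2 ≤ P.v) : (P.reduced b).v ≤ (P.reduced b).u :=
  s.pairSize_le hv

/-- Unless the recursion stops with an algorithm for type 1 in the next step, the excess of `V` is at
least twice that of `U`. -/
theorem two_mul_eU_le_eV (s : P.IsStep b) (hg : Value (P.reduced b) g) (hv : 2 ≤ P.v)
    (hh : 0 < (P.reduced b).hh) : 2 * P.eU g ≤ P.eV g := by
  induction hn : P.st * P.t using Nat.strong_induction_on generalizing P b with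
  | _ n ih =>
  subst hn
  have hV0 := s.eV_reduced_pos hg
  have hU0 := s.eU_pos hg
  have hb := s.one_le_cast
  have hv' : (2 : ℝ) ≤ P.v := by exact_mod_cast hv
  have hv1 : (2 : ℝ) ≤ (P.reduced b).v := by exact_mod_cast s.two_le_v_reduced
  have h1 := s.reduced_is3MDAP
  have hD1 : (P.reduced b).eD g = ((P.reduced b).v - 1) * P.eU g - (P.reduced b).eV g := rfl
  by_cases hP1 : (P.reduced b).Terminal
  · have h0 := s.terminal_eU hg hP1
    -- Since `eU' = 0`, the identity `su'·eU' = sv'·eD' + hh'·eT'` with a positive last term forces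
    -- `eD' ≤ 0`, that is `(v'-1)·eU ≤ eV'`.
    have h2 := h1.su_eU g
    rw [h0, mul_zero] at h2
    have h3 : 0 < (P.reduced b).hh * (P.reduced b).eT g := mul_pos hh hU0
    have h4 : (P.reduced b).eD g ≤ 0 := by
      by_contra! hc
      have : 0 ≤ ((P.reduced b).sv : ℝ) * (P.reduced b).eD g := by positivity
      linarith
    refine s.two_mul_eU_le hg hv (by rw [h0]; exact hV0.le) (by linarith) fun _ _ h _ => ?_
    rw [h0]
    rw [hD1, h] at h4
    push_cast at h4
    linarith
  have s₁ := h1.isStep hP1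
  set b₁ := (P.reduced b).bHat with hb1
  have hg₁ := hg.reduced hP1
  rw [← hb1] at hg₁
  have h2 := s₁.reduced_is3MDAP
  by_cases hP2 : ((P.reduced b).reduced b₁).Terminal
  · have h0 := s₁.terminal_eU hg₁ hP2
    have h3 := tail_eq s₁ h0
    have h4 := tail_lt s₁ h0
    have h5 := s₁.one_le_cast
    have hV1 : ((P.reduced b).v - 1) * P.eU g ≤ (P.reduced b).eV g := by
      refine le_of_mul_le_mul_left ?_ (show (0 : ℝ) < b₁ by linarith)
      linarith
    rcases le_or_gt (P.eD g) 0 with hD | hD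
    · rw [s.eD_eq] at hD
      refine s.two_mul_eU_le hg hv (by linarith) hV1 fun _ _ h h' => ?_
      have h6 : (2 : ℝ) ≤ ((P.reduced b).reduced b₁).v := by exact_mod_cast s₁.two_le_v_reduced
      have hU1 := s.eU_reduced_nonneg hg
      rw [h] at h3
      rw [h'] at h4
      push_cast at h3 h4
      have h7 : (b₁ : ℝ) * 2 * (P.reduced b).eU g ≤
          b₁ * ((P.reduced b).reduced b₁).v * (P.reduced b).eU g := by gcongr
      refine le_of_mul_le_mul_left ?_ (show (0 : ℝ) < b₁ by linarith)
      linarith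
    -- If `eD > 0`, then `b = 1` and `eV' = eT`. The inequality of dimensions with `κ = 0` gives `2t
    -- ≤ v(t-1)`, and the factor 2 comes from `v·eT < t·eV`.
    · obtain rfl := s.eq_one_of_tail s₁ hv h0 (by linarith) hU0.le
      have h6 := s.tail_dim s₁ h0 (κ := 0) (by linarith) hU0.le
      have h7 : (2 : ℝ) ≤ ((P.reduced 1).reduced b₁).v := by exact_mod_cast s₁.two_le_v_reduced
      have h8 := s.is3MDAP.eT_eV g
      obtain ⟨ht, -, -, -, -⟩ := s.is3MDAP.casts
      have h9 : (P.reduced 1).eV g = P.eT g := by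
        rw [s.eV_reduced]
        simp
      rw [s.reduced_u_eq, s.reduced_v_of_one, dd] at h6
      rw [s.reduced_v_of_one, h9] at hV1
      have h10 : (2 : ℝ) ≤ b₁ * ((P.reduced 1).reduced b₁).v := by nlinarith
      have h11 := mul_le_mul_of_nonneg_right h10 (show (0 : ℝ) ≤ 2 * P.t - 2 by linarith)
      have h12 : 2 * P.t ≤ P.v * ((P.t : ℝ) - 1) := by linarith
      have h13 := mul_le_mul_of_nonneg_right h12 hU0.le
      have h14 := mul_le_mul_of_nonneg_left hV1 (show (0 : ℝ) ≤ P.v by linarith)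
      refine le_of_mul_le_mul_left ?_ (show (0 : ℝ) < P.t by linarith)
      linarith
  · have hh2 := s₁.hh_reduced_pos hP2
    have h3 := ih _ s.size_lt s₁ hg₁ s.two_le_v_reduced hh2 rfl
    have hU1 := s.eU_reduced_nonneg hg
    have s₂ := h2.isStep hP2
    set b₂ := ((P.reduced b).reduced b₁).bHat with hb2
    have hg₂ := hg₁.reduced hP2
    rw [← hb2] at hg₂
    -- `eD' ≤ 0` is the bound for `eV'` that `two_mul_eU_le` requires; the second part serves the
    -- case in which all dimensions are 2. Both come from one more step of the recursion, by the
    -- tail estimate if it ends there and by induction otherwise.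
    have hD1' : (P.reduced b).eD g ≤ 0 ∧
        ((P.reduced b).u = 2 → (P.reduced b).eU g ≤ -2 * (P.reduced b).eD g) := by
      by_cases hP3 : (((P.reduced b).reduced b₁).reduced b₂).Terminal
      · have := s₁.eU_le_neg_eD s₂ s.two_le_v_reduced (s.v_le_u_reduced hv)
          (s₂.terminal_eU hg₂ hP3) hU1
        exact ⟨by linarith, fun _ => this⟩
      · have h4 := ih _ (s₁.size_lt.trans s.size_lt) s₂ hg₂ s₁.two_le_v_reduced
          (s₂.hh_reduced_pos hP3) rfl
        have h5 := s₁.eV_reduced_pos hg₁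
        have h6 := s₁.eD_eq g
        refine ⟨by linarith, fun h => ?_⟩
        have h7 := s₁.eT_eV_reduced g
        rw [h] at h7
        push_cast at h7
        have h8 : (2 : ℝ) ≤ ((P.reduced b).reduced b₁).v := by exact_mod_cast s₁.two_le_v_reduced
        have h9 := mul_le_mul_of_nonneg_right h8 hU1
        linarith
    refine s.two_mul_eU_le hg hv (by linarith) (by linarith) fun _ _ h h' => ?_
    have := hD1'.2 h'
    rw [hD1, h] at this
    push_cast at this
    linarith

/-- The excess does not increase when a row of `V` is added to a tree, or the pairs consist of single
rows of `V`. -/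
theorem eD_nonpos_or (s : P.IsStep b) (hg : Value (P.reduced b) g) (hv : 2 ≤ P.v) :
    P.eD g ≤ 0 ∨ b = 1 ∧ (P.t - 1) * P.eU g ≤ P.eT g := by
  have hV0 := s.eV_reduced_pos hg
  have hU0 := s.eU_pos hg
  by_cases hP1 : (P.reduced b).Terminal
  · left
    rw [s.eD_eq, s.terminal_eU hg hP1]
    linarith
  have s₁ := s.reduced_is3MDAP.isStep hP1
  set b₁ := (P.reduced b).bHat with hb1
  have hg₁ := hg.reduced hP1
  rw [← hb1] at hg₁
  by_cases hP2 : ((P.reduced b).reduced b₁).Terminal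
  · have h0 := s₁.terminal_eU hg₁ hP2
    rw [or_iff_not_imp_left, not_le]
    intro hD
    obtain rfl := s.eq_one_of_tail s₁ hv h0 (by linarith) hU0.le
    refine ⟨rfl, ?_⟩
    have h3 := tail_eq s₁ h0
    have h5 := s₁.one_le_cast
    have h9 : (P.reduced 1).eV g = P.eT g := by
      rw [s.eV_reduced]
      simp
    rw [s.reduced_v_of_one, h9] at h3
    refine le_of_mul_le_mul_left ?_ (show (0 : ℝ) < b₁ by linarith)
    linarith
  · left
    -- `eD = eU' - eV'`, and the inequality for the reduced problem is `2·eU' ≤ eV'`.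
    have h3 := s₁.two_mul_eU_le_eV hg₁ s.two_le_v_reduced (s₁.hh_reduced_pos hP2)
    rw [s.eD_eq]
    linarith

/-- The condition under which the trees of an optimal solution have at least `b - 1` rows of `V` in
the preceding problem. -/
theorem excess_le_or (s : P.IsStep b) (hg : Value (P.reduced b) g) (hv : 2 ≤ P.v)
    (hvu : P.v ≤ P.u + 1) :
    P.eU g ≤ (P.u - 2) * P.eT g - 2 * P.eD g ∨
      ((P.reduced b).IsStep 1 ∧ b = 1 ∧ ((P.reduced b).reduced 1).eU g = 0 ∧ P.v = P.u + 1) := by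
  have hV0 := s.eV_reduced_pos hg
  have hU0 := s.eU_pos hg
  have h1 := s.eT_eV_reduced g
  have h2 := s.eU_eT g
  obtain ⟨ht, hu, -, -, -⟩ := s.is3MDAP.casts
  have hb := s.one_le_cast
  have h4 : (2 : ℝ) ≤ (P.reduced b).v := by exact_mod_cast s.two_le_v_reduced
  have h5 := mul_le_mul_of_nonneg_right h4 hU0.le
  have h6 := mul_le_mul_of_nonneg_right ht hU0.le
  have hu2 : 0 ≤ (P.u : ℝ) - 2 := by linarith
  have hT0 : 0 < P.eT g := by
    have : 0 < P.u * P.eT g := by linarith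
    exact pos_of_mul_pos_right this (by linarith)
  have hT1 := mul_nonneg hu2 hT0.le
  by_cases hP1 : (P.reduced b).Terminal
  · left
    have h0 := s.terminal_eU hg hP1
    have h3 := s.eD_eq g
    rw [h0] at h3
    have h7 := s.eU_reduced g
    rw [h0] at h7
    have h8 : P.eT g = b * (P.reduced b).eV g := by
      rw [h3] at h7
      linarith
    rw [h8, h3]
    have h9 := mul_nonneg (mul_nonneg hu2 (sub_nonneg.mpr hb)) hV0.le
    linarith
  have s₁ := s.reduced_is3MDAP.isStep hP1
  set b₁ := (P.reduced b).bHat with hb1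
  have hg₁ := hg.reduced hP1
  rw [← hb1] at hg₁
  by_cases hP2 : ((P.reduced b).reduced b₁).Terminal
  · have h0 := s₁.terminal_eU hg₁ hP2
    rw [or_iff_not_imp_left, not_le]
    intro hD
    have hE : -2 * P.eD g < P.eU g := by linarith
    -- Once the first alternative fails, `-2·eD < eU`. By `eU_le_neg_eD` this is possible only
    -- outside the range `v ≤ u`.
    have hvu' : P.v = P.u + 1 := by
      by_contra hne
      have := s.eU_le_neg_eD s₁ hv (by omega) h0 hU0.le
      linarith
    obtain rfl := s.eq_one_of_tail s₁ hv h0 hE hU0.le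
    -- For `b₁ ≥ 2` the rows of `V''` have at least `t(u-1)` entries, which is too many for
    -- `tail_dim`.
    have hb₁ : b₁ = 1 := by
      by_contra hne
      have h7 := s.tail_dim s₁ h0 (κ := 1) (by linarith) hU0.le
      have h8 := s₁.one_le
      have h9 : (2 : ℝ) ≤ b₁ := by exact_mod_cast (by omega : 2 ≤ b₁)
      have h10 := s₁.reduced_v
      have h11 : ((P.reduced 1).t : ℝ) = P.u := rfl
      have h12 := s₁.dd_nonneg s.two_le_v_reduced
      have h13 := mul_le_mul_of_nonneg_right (show (1 : ℝ) ≤ b₁ - 1 by linarith) h12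
      rw [dd, s.reduced_v_of_one, h11] at h13
      rw [dd, s.reduced_v_of_one, h11] at h10
      have h14 : (P.t : ℝ) * (P.u - 1) ≤ ((P.reduced 1).reduced b₁).v := by linarith
      rw [s.reduced_u_eq, s.reduced_v_of_one, dd, hvu'] at h7
      push_cast at h7
      have ht1 : 0 ≤ (P.t : ℝ) - 1 := by linarith
      have hu1 : 0 ≤ (P.u : ℝ) - 1 := by linarith
      have h15 : 2 * ((P.t : ℝ) * (P.u - 1)) ≤ b₁ * ((P.reduced 1).reduced b₁).v :=
        mul_le_mul h9 h14 (by positivity) (by linarith)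
      have h16 := mul_le_mul_of_nonneg_right h15 (show (0 : ℝ) ≤ 2 * P.t - 2 - 1 by linarith)
      have h17 := mul_nonneg (sub_nonneg.mpr ht) (mul_nonneg hu1 ht1)
      have h18 := mul_nonneg ht1 hu2
      linarith
    rw [hb₁] at s₁ h0
    exact ⟨s₁, rfl, h0, hvu'⟩
  · left
    have h3 := s₁.two_mul_eU_le_eV hg₁ s.two_le_v_reduced (s₁.hh_reduced_pos hP2)
    have h7 := s.eD_eq g
    have h8 : 2 * P.eU g ≤ P.u * (P.reduced b).eV g := by linarith
    have h9 : 2 * P.eU g ≤ P.u * P.eT g := by linarith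
    refine le_of_mul_le_mul_left ?_ (show (0 : ℝ) < P.u by linarith)
    have h10 := mul_le_mul_of_nonneg_left h9 hu2
    have h11 := mul_nonneg hu2 hU0.le
    have h12 : (P.reduced b).eV g ≤ -2 * P.eD g := by linarith
    have h13 := mul_le_mul_of_nonneg_left h12 (show (0 : ℝ) ≤ P.u by linarith)
    linarith

/-- A variant of `two_mul_eU_le_eV` for problems whose reduced problem is solved directly. -/
theorem two_mul_eU_le_eV_of_terminal (s : P.IsStep b) (hg : Value (P.reduced b) g) (hv : 2 ≤ P.v)
    (hvu : P.u + 2 ≤ 2 * P.v) (hb : 2 ≤ b) (hP1 : (P.reduced b).Terminal) :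
    2 * P.eU g ≤ P.eV g := by
  have hV0 := s.eV_reduced_pos hg
  have hU0 := s.eU_pos hg
  have h0 := s.terminal_eU hg hP1
  have h1 := s.eT_eV_reduced g
  have h2 := s.eV_eq g
  rw [h0, sub_zero] at h2
  obtain ⟨ht, hu, -, -, -⟩ := s.is3MDAP.casts
  have hb' : (2 : ℝ) ≤ b := by exact_mod_cast hb
  have hv' : (2 : ℝ) ≤ P.v := by exact_mod_cast hv
  have hvu' : (P.u : ℝ) + 2 ≤ 2 * P.v := by exact_mod_cast hvu
  have h3 : (2 : ℝ) ≤ (P.reduced b).v := by exact_mod_cast s.two_le_v_reduced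
  have h4 : 2 * (P.v : ℝ) - 1 ≤ (P.v - 1) + ((P.v - 1) * (b - 1) + 1) := by nlinarith
  have h5 := mul_le_mul_of_nonneg_right h4 hV0.le
  have h6 := mul_le_mul_of_nonneg_right h3 hU0.le
  have h7 : (P.u : ℝ) * ((2 * P.v - 1) * (P.reduced b).eV g) ≤ P.u * P.eV g :=
    mul_le_mul_of_nonneg_left (by linarith) (by linarith)
  have h8 : (2 * (P.v : ℝ) - 1) * (2 * P.eU g) ≤ (2 * P.v - 1) * (P.u * (P.reduced b).eV g) :=
    mul_le_mul_of_nonneg_left (by linarith) (by linarith)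
  have h9 : (P.u : ℝ) * (2 * P.eU g) ≤ (2 * P.v - 1) * (2 * P.eU g) :=
    mul_le_mul_of_nonneg_right (by linarith) (by linarith)
  refine le_of_mul_le_mul_left ?_ (show (0 : ℝ) < P.u by linarith)
  linarith

end IsStep
end Problem

/-! ### The filling returned by the algorithm and its smallest entry -/

lemma IsMatrix.join_map {ι : Type*} {L : Multiset ι} {f : ι → Rows} {k c : ℕ} {x : ℝ}
    (h : ∀ l ∈ L, IsMatrix k c x (f l)) : IsMatrix (L.card * k) c x (L.map f).join := by
  constructor
  · rw [Multiset.card_join, Multiset.map_map,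
      Multiset.map_congr rfl (g := fun _ => k) (fun l hl => by exact (h l hl).1),
      Multiset.map_const', Multiset.sum_replicate, smul_eq_mul]
  · intro r hr
    obtain ⟨M, hM, hr⟩ := Multiset.mem_join.mp hr
    obtain ⟨l, hl, rfl⟩ := Multiset.mem_map.mp hM
    exact (h l hl).2 r hr

lemma join_join_map {ι : Type*} {L : Multiset ι} {e : ι → Multiset ℝ} {f k : ι → Rows}
    (h : ∀ l ∈ L, (f l).join = e l + (k l).join) :
    ((L.map f).join).join = (L.map e).join + ((L.map k).join).join := by
  induction L using Multiset.induction with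
  | empty => simp
  | cons a L ih =>
    simp only [Multiset.map_cons, Multiset.join_cons, Multiset.join_add]
    rw [h a (Multiset.mem_cons_self a L), ih fun l hl => h l (Multiset.mem_cons_of_mem hl)]
    abel

lemma mem_join_join_map {ι : Type*} {L : Multiset ι} {f : ι → Rows} {y : ℝ} :
    y ∈ ((L.map f).join).join ↔ ∃ l ∈ L, y ∈ (f l).join := by
  simp only [Multiset.mem_join, Multiset.mem_map]
  constructor
  · rintro ⟨r, ⟨M, ⟨l, hl, rfl⟩, hr⟩, hy⟩
    exact ⟨l, hl, r, hr, hy⟩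
  · rintro ⟨l, hl, r, hr, hy⟩
    exact ⟨r, ⟨_, ⟨l, hl, rfl⟩, hr⟩, hy⟩

lemma IsMatrix.nsmul {s c : ℕ} {x : ℝ} {M : Rows} (h : IsMatrix s c x M) (n : ℕ) :
    IsMatrix (n * s) c x (n • M) := by
  refine ⟨by rw [Multiset.card_nsmul, h.1], fun r hr => h.2 r (Multiset.mem_of_mem_nsmul hr)⟩

lemma join_nsmul (n : ℕ) (M : Rows) : (n • M).join = n • M.join := Multiset.sum_nsmul _ _

/-- An upper bound for an entry of a row from a lower bound for all of them. -/
lemma le_of_forall_le {r : Multiset ℝ} {c : ℕ} {x g : ℝ} (hr : r.card = c ∧ r.sum = x)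
    (hg : ∀ y ∈ r, g ≤ y) {y : ℝ} (hy : y ∈ r) : y ≤ g + (x - c * g) := by
  obtain ⟨r, rfl⟩ := Multiset.exists_cons_of_mem hy
  obtain ⟨h1, h2⟩ := hr
  have h3 := Multiset.card_nsmul_le_sum fun y hy => hg y (Multiset.mem_cons_of_mem hy)
  rw [Multiset.card_cons] at h1
  rw [Multiset.sum_cons] at h2
  rw [nsmul_eq_mul] at h3
  subst h1
  push_cast
  linarith

namespace Problem

variable {P : Problem} {F G : Filling} {b : ℕ} {g : ℝ}

/-- The algorithm for 0-problems of type 2 produces an optimal solution. -/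
theorem Is3MDAP.zeroAlgorithm₂_spec (h : P.Is3MDAP) (hh : 0 < P.hh) (hb : (P.sv : ℝ) = b * P.hh) :
    P.IsFeasible P.zeroAlgorithm₂ ∧
      P.zeroAlgorithm₂.U = Multiset.replicate P.su (Multiset.replicate P.u (P.xu / P.u)) ∧
      ∀ y ∈ P.zeroAlgorithm₂.V.join, P.xu / P.u ≤ y := by
  have hc := pairCount_cast h.one_le_v hh
  rw [← hc] at hb
  have hb' : P.sv = b * P.pairCount := by exact_mod_cast hb
  have hpos : 0 < P.pairCount := by
    have : (0 : ℝ) < P.pairCount := by rw [hc]; exact hh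
    exact_mod_cast this
  have hdiv : P.sv / P.pairCount = b := by rw [hb', Nat.mul_div_cancel _ hpos]
  obtain ⟨ht, hu, hv, -, hsu⟩ := h.casts
  have hmul : b * P.v ≤ ((P.v - 1) * b + 1) * P.t := by
    rcases Nat.lt_or_ge P.v 2 with hv2 | hv2
    · have h1 := h.one_le_v
      have hv1 : P.v = 1 := by omega
      have h2 := h.v_eq_one hv1
      have h3 : P.pairCount = P.st := by rw [pairCount, hv1]; simp
      rw [hb', h3, hv1, mul_one] at h2
      have := Nat.le_of_mul_le_mul_right h2 h.st_pos
      rw [hv1]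
      simp only [mul_one, Nat.sub_self, zero_mul, zero_add, one_mul]
      omega
    · exact mul_v_le h.two_le_t hv2 b
  have hsize := pairSize_cast h.one_le_v hmul
  set a := P.xu / P.u with ha
  have hU0 : P.eU a = 0 := h.eU_div
  -- `sv = b·hh` makes the entries left by a tree with `b` rows of `V` have the average `a` of `U`.
  -- So a pair can be completed with all given entries equal to `a`; together with `eT a ≥ 0` it
  -- also yields `eD a ≤ 0` for `b > 0`.
  have hS0 : P.eT a + b * P.eD a = 0 := by
    have h1 := h.su_cross a b
    rw [hU0, ← hc, hb, sub_self, zero_mul, zero_mul, zero_sub] at h1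
    have h2 : (P.su : ℝ) * P.u * (P.eT a + b * P.eD a) = 0 := by linarith
    exact (mul_eq_zero.mp h2).resolve_left (by positivity)
  set l := List.replicate (P.pairSize b) a with hl
  have hlen : l.length = P.pairSize b := List.length_replicate
  have hsum : l.sum = (((P.v : ℝ) - 1) * b + 1) * P.xt - b * P.xv := by
    rw [hl, List.sum_replicate, nsmul_eq_mul, hsize]
    simp only [eT, eD, eV, dd] at hS0 ⊢
    linarith
  obtain ⟨hA, hB, hAB⟩ := pair_spec h.two_le_t h.one_le_v hmul hlen hsum
  have hcount : P.pairCount * ((P.v - 1) * b + 1) = P.st := by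
    have : (P.pairCount : ℝ) * ((P.v - 1) * b + 1) = P.st := by
      have := hc
      rw [Problem.hh, hb] at this
      linear_combination this
    rw [← Nat.cast_one, ← Nat.cast_sub h.one_le_v] at this
    exact_mod_cast this
  have hcu : P.su * P.u = P.pairCount * P.pairSize b := by
    have : (P.su : ℝ) * P.u = P.pairCount * P.pairSize b := by
      rw [h.su_u, hsize, ← hc, hb]
      ring
    exact_mod_cast this
  have hT := hA.nsmul P.pairCount
  have hV := hB.nsmul P.pairCount
  rw [hcount] at hT
  rw [mul_comm, ← hb'] at hV
  rw [zeroAlgorithm₂, hdiv]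
  refine ⟨⟨hT, h.replicate_U, hV, ?_⟩, rfl, fun y hy => ?_⟩
  · simp only
    rw [join_nsmul, join_nsmul, hAB, nsmul_add, join_replicate_replicate, hcu, hl,
      Multiset.coe_replicate, ← Multiset.nsmul_singleton _ (P.pairSize b), smul_smul,
      Multiset.nsmul_singleton]
  · simp only at hy
    rw [join_nsmul] at hy
    replace hy := Multiset.mem_of_mem_nsmul hy
    rcases Nat.eq_zero_or_pos b with rfl | hbpos
    · simp [pairB] at hy
    by_cases hv1 : P.v = 1
    · have h1 := h.eU_eV a
      rw [hU0, mul_zero] at h1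
      have h2 := pos_of_mul_pos_right h1 (by linarith)
      rw [eV, hv1] at h2
      rw [pairB, if_pos hv1, join_replicate, Multiset.nsmul_singleton] at hy
      rw [Multiset.eq_of_mem_replicate hy]
      push_cast at h2
      linarith
    · have hv2 : 2 ≤ P.v := by have := h.one_le_v; omega
      refine le_of_mem_pairB h.two_le_t hv2 hbpos hlen hsum
        (fun y hy => (List.eq_of_mem_replicate hy).ge) ?_ y hy
      have h1 : P.t * a ≤ P.xt := h.avg.1
      have h2 : 0 ≤ P.eT a := by rw [eT]; linarith
      have h3 : (0 : ℝ) < b := by exact_mod_cast hbpos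
      by_contra! hneg
      have := mul_pos h3 hneg
      linarith

lemma IsFeasible.le_of_mem (hF : P.IsFeasible F) {y : ℝ} (hg : ∀ y ∈ F.T.join, g ≤ y)
    (hy : y ∈ F.T.join) : y ≤ g + P.eT g := by
  obtain ⟨r, hr, hy⟩ := Multiset.mem_join.mp hy
  exact le_of_forall_le (hF.1.2 r hr) (fun z hz => hg z (Multiset.mem_join.mpr ⟨r, hr, hz⟩)) hy

/-- A solution of the reduced problem yields a solution of the problem. -/
theorem IsStep.extend (s : P.IsStep b) (hg : Value (P.reduced b) g)
    (hG : (P.reduced b).IsFeasible G) (hGg : ∀ y ∈ G.T.join, g ≤ y) {LU LV : Multiset (List ℝ)}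
    (hLU : LU.map (fun l : List ℝ => (l : Multiset ℝ)) = G.U)
    (hLV : LV.map (fun l : List ℝ => (l : Multiset ℝ)) = G.V)
    (hU : F.U = G.T)
    (hT : F.T = (LU.map (P.pairA b)).join + (LV.map (P.pairA (b - 1))).join)
    (hV : F.V = (LU.map (P.pairB b)).join + (LV.map (P.pairB (b - 1))).join) :
    P.IsFeasible F ∧ ∀ y ∈ F.T.join, g ≤ y := by
  have h := s.is3MDAP
  obtain ⟨g1, g2, g3, g4⟩ := hG
  have hlU : ∀ l ∈ LU, l.length = P.pairSize b ∧
      l.sum = (((P.v : ℝ) - 1) * b + 1) * P.xt - b * P.xv := by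
    intro l hl
    have := g2.2 _ (hLU ▸ Multiset.mem_map_of_mem _ hl)
    rwa [Multiset.coe_card, Multiset.sum_coe] at this
  have hlV : ∀ l ∈ LV, l.length = P.pairSize (b - 1) ∧
      l.sum = (((P.v : ℝ) - 1) * (b - 1 : ℕ) + 1) * P.xt - (b - 1 : ℕ) * P.xv := by
    intro l hl
    have := g3.2 _ (hLV ▸ Multiset.mem_map_of_mem _ hl)
    rw [Multiset.coe_card, Multiset.sum_coe] at this
    rwa [Nat.cast_sub s.one_le, Nat.cast_one]
  have hpU := fun l hl => pair_spec h.two_le_t h.one_le_v (s.mul_v_le le_rfl) (hlU l hl).1 (hlU l hl).2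
  have hpV := fun l hl => pair_spec h.two_le_t h.one_le_v (s.mul_v_le (Nat.sub_le b 1))
    (hlV l hl).1 (hlV l hl).2
  have cU : LU.card = (P.reduced b).su := by rw [← g2.1, ← hLU, Multiset.card_map]
  have cV : LV.card = (P.reduced b).sv := by rw [← g3.1, ← hLV, Multiset.card_map]
  have e1 := s.reduced_su
  have e2 := s.reduced_sv
  have e3 : ((b - 1 : ℕ) : ℝ) = b - 1 := by rw [Nat.cast_sub s.one_le, Nat.cast_one]
  have cT : LU.card * ((P.v - 1) * b + 1) + LV.card * ((P.v - 1) * (b - 1) + 1) = P.st := by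
    have : ((LU.card * ((P.v - 1) * b + 1) + LV.card * ((P.v - 1) * (b - 1) + 1) : ℕ) : ℝ) =
        P.st := by
      push_cast
      rw [e3, Nat.cast_sub h.one_le_v, cU, cV, e1, e2, hh]
      push_cast
      ring
    exact_mod_cast this
  have cV' : LU.card * b + LV.card * (b - 1) = P.sv := by
    have : ((LU.card * b + LV.card * (b - 1) : ℕ) : ℝ) = P.sv := by
      push_cast
      rw [e3, cU, cV, e1, e2]
      ring
    exact_mod_cast this
  have mT := (IsMatrix.join_map fun l hl => (hpU l hl).1).add
    (IsMatrix.join_map fun l hl => (hpV l hl).1)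
  have mV := (IsMatrix.join_map fun l hl => (hpU l hl).2.1).add
    (IsMatrix.join_map fun l hl => (hpV l hl).2.1)
  rw [cT, ← hT] at mT
  rw [cV', ← hV] at mV
  have hjoin : F.T.join = F.U.join + F.V.join := by
    rw [hT, hV, hU, g4, Multiset.join_add, Multiset.join_add,
      join_join_map fun l hl => (hpU l hl).2.2, join_join_map fun l hl => (hpV l hl).2.2, hLU, hLV]
    abel
  refine ⟨⟨mT, hU ▸ g1, mV, hjoin⟩, fun y hy => ?_⟩
  rw [hjoin, Multiset.mem_add] at hy
  rcases hy with hy | hy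
  · exact hGg y (hU ▸ hy)
  have hmU : ∀ l ∈ LU, ∀ z ∈ l, z ∈ G.T.join := by
    intro l hl z hz
    rw [g4, Multiset.mem_add]
    exact Or.inl (Multiset.mem_join.mpr ⟨l, hLU ▸ Multiset.mem_map_of_mem _ hl, hz⟩)
  have hmV : ∀ l ∈ LV, ∀ z ∈ l, z ∈ G.T.join := by
    intro l hl z hz
    rw [g4, Multiset.mem_add]
    exact Or.inr (Multiset.mem_join.mpr ⟨l, hLV ▸ Multiset.mem_map_of_mem _ hl, hz⟩)
  -- For `v = 1` the new entries are all `xv`, and `eV > 0` suffices. For larger `v` the two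
  -- alternatives of `eD_nonpos_or` lead to the two lemmas on entries of pairs.
  have key : ∀ k l, 1 ≤ k → k ≤ b → l.length = P.pairSize k →
      l.sum = (((P.v : ℝ) - 1) * k + 1) * P.xt - k * P.xv → (∀ z ∈ l, z ∈ G.T.join) →
      ∀ y ∈ (P.pairB k l).join, g ≤ y := by
    intro k l hk hkb hl1 hl2 hl3 y hy
    by_cases hv1 : P.v = 1
    · have h1 := h.eU_eV g
      have h2 := s.eU_pos hg
      obtain ⟨-, hu, -, -, -⟩ := h.casts
      rw [hv1, Nat.cast_one, one_mul] at h1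
      have h3 : 0 < P.eV g := pos_of_mul_pos_right (h2.trans h1) (by linarith)
      rw [eV, hv1] at h3
      rw [pairB, if_pos hv1, join_replicate, Multiset.nsmul_singleton] at hy
      rw [Multiset.eq_of_mem_replicate hy]
      push_cast at h3
      linarith
    · have hv2 : 2 ≤ P.v := by have := h.one_le_v; omega
      rcases s.eD_nonpos_or hg hv2 with hD | ⟨rfl, hT'⟩
      · exact le_of_mem_pairB h.two_le_t hv2 hk hl1 hl2 (fun z hz => hGg z (hl3 z hz)) hD y hy
      · obtain rfl : k = 1 := le_antisymm hkb hk
        -- The given entries occur in rows of `U = T'`, whose entries are all at least `g`, so each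
        -- exceeds `g` by at most the excess `eU` of its row.
        refine le_of_mem_pairB_one h.two_le_t hv2 hl1 (e := P.eU g) (fun z hz => ?_) hT' y hy
        exact IsFeasible.le_of_mem ⟨g1, g2, g3, g4⟩ hGg (hl3 z hz)
  rw [hV, Multiset.join_add, Multiset.mem_add, mem_join_join_map, mem_join_join_map] at hy
  rcases hy with ⟨l, hl, hy⟩ | ⟨l, hl, hy⟩
  · exact key b l s.one_le le_rfl (hlU l hl).1 (hlU l hl).2 (hmU l hl) y hy
  · rcases Nat.eq_zero_or_pos (b - 1) with h0 | h0
    -- A 0-pair contains no row of `V`.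
    · rw [h0] at hy
      simp [pairB] at hy
    · exact key (b - 1) l h0 (Nat.sub_le b 1) (hlV l hl).1 (hlV l hl).2 (hmV l hl) y hy

lemma Is3MDAP.of_replicate (h : P.Is3MDAP) {a : ℝ} (hF : P.IsFeasible F)
    (hU : F.U = Multiset.replicate P.su (Multiset.replicate P.u a))
    (hV : ∀ y ∈ F.V.join, a ≤ y) : (∀ y ∈ F.T.join, a ≤ y) ∧ a ∈ F.T.join := by
  rw [hF.2.2.2, hU, join_replicate_replicate]
  have := h.two_le_u
  have := h.su_pos
  refine ⟨fun y hy => ?_, ?_⟩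
  · rcases Multiset.mem_add.mp hy with hy | hy
    · exact (Multiset.eq_of_mem_replicate hy).ge
    · exact hV y hy
  · exact Multiset.mem_add.mpr (Or.inl (Multiset.mem_replicate.mpr ⟨by positivity, rfl⟩))

/-- The recursive algorithm produces feasible solutions with the expected smallest entry. -/
theorem RecursiveAlgorithm.spec (hF : P.RecursiveAlgorithm F) (h : P.Is3MDAP) :
    ∃ g, Value P g ∧ P.IsFeasible F ∧ (∀ y ∈ F.T.join, g ≤ y) ∧ g ∈ F.T.join := by
  induction hF with
  | zero₁ P F hx hF =>
    obtain ⟨h1, h2, h3⟩ := hF.spec h (h.xu_le_xInf_iff.mp hx)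
    exact ⟨_, .terminal P (Or.inl hx), h1, h.of_replicate h1 h2 h3⟩
  | zero₂ P hx hb =>
    have hh := hx
    rw [h.xu_le_xInf_iff, not_le] at hh
    obtain ⟨b, hb'⟩ := hb
    obtain ⟨h1, h2, h3⟩ := h.zeroAlgorithm₂_spec hh ((h.xu_eq_xSeq_iff b).mp hb')
    exact ⟨_, .terminal P (Or.inr ⟨b, hb'⟩), h1, h.of_replicate h1 h2 h3⟩
  | step P F G LU LV hx hb hG hLU hLV hU hT hV ih =>
    have hP : ¬ P.Terminal := not_or.mpr ⟨hx, hb⟩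
    have s := h.isStep hP
    obtain ⟨g, hg, h1, h2, h3⟩ := ih s.reduced_is3MDAP
    obtain ⟨h4, h5⟩ := s.extend hg h1 h2 (by simpa using hLU) (by simpa using hLV) hU hT hV
    refine ⟨g, .step P g hP hg, h4, h5, ?_⟩
    rw [h4.2.2.2, hU]
    exact Multiset.mem_add.mpr (Or.inl h3)

/-- The recursive algorithm terminates. -/
theorem Is3MDAP.exists_recursiveAlgorithm (h : P.Is3MDAP) : ∃ F, P.RecursiveAlgorithm F := by
  induction hn : P.st * P.t using Nat.strong_induction_on generalizing P with
  | _ n ih =>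
    by_cases hx : P.xu ≤ P.xInf
    · obtain ⟨F, hF⟩ := exists_zeroAlgorithm₁ h (h.xu_le_xInf_iff.mp hx)
      exact ⟨F, .zero₁ P F hx hF⟩
    by_cases hb : ∃ b : ℕ, P.xu = P.xSeq b
    · exact ⟨_, .zero₂ P hx hb⟩
    have s := h.isStep (not_or.mpr ⟨hx, hb⟩)
    subst hn
    obtain ⟨G, hG⟩ := ih _ s.size_lt s.reduced_is3MDAP rfl
    exact ⟨⟨_, G.T, _⟩, .step P _ G (G.U.map Multiset.toList) (G.V.map Multiset.toList) hx hb hG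
      (by simp) (by simp) rfl rfl rfl⟩

end Problem

/-! ### Trees in an arbitrary solution -/

lemma sum_map_card {α β : Type*} {C : Multiset α} {f : α → Multiset β} {M : Multiset β}
    (h : (C.map f).sum = M) : (C.map fun c => ((f c).card : ℝ)).sum = M.card := by
  subst h
  induction C using Multiset.induction_on with
  | empty => simp
  | cons a C ih => simp [ih]

lemma sum_sub_card_nonneg {X : Multiset ℝ} {q : ℝ} (h : ∀ y ∈ X, q ≤ y) :
    0 ≤ X.sum - X.card * q := by
  have := Multiset.card_nsmul_le_sum h
  rw [nsmul_eq_mul] at this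
  linarith

lemma IsMatrix.card_join {s c : ℕ} {x : ℝ} {M : Rows} (h : IsMatrix s c x M) :
    M.join.card = s * c := by
  rw [Multiset.card_join, Multiset.map_congr rfl (fun r hr => (h.2 r hr).1),
    Multiset.map_const', Multiset.sum_replicate, h.1, smul_eq_mul]

/-- A bound for the excess of a multiset that is covered by several others of the same excess. -/
lemma excess_le_of_le_sum {α : Type*} {A : Multiset α} {f : α → Multiset ℝ} {X : Multiset ℝ}
    {q e : ℝ} {n : ℕ} (hX : X ≤ (A.map f).sum) (hXn : X.card ≤ n)
    (hq : ∀ a ∈ A, ∀ y ∈ f a, q ≤ y) (hf : ∀ a ∈ A, (f a).sum - (f a).card * q = e) (he : 0 ≤ e) :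
    X.sum - X.card * q ≤ n * e := by
  obtain ⟨A', hA', hcard, hle⟩ := exists_le_card_le_sum_map f A X hX
  obtain ⟨Y, hY⟩ := Multiset.le_iff_exists_add.mp hle
  have h1 : (A'.map f).sum.sum - (A'.map f).sum.card * q = A'.card * e := by
    have : ∀ A'' : Multiset α, (∀ a ∈ A'', a ∈ A) →
        (A''.map f).sum.sum - (A''.map f).sum.card * q = A''.card * e := by
      intro A'' h
      induction A'' using Multiset.induction_on with
      | empty => simp
      | cons a A'' ih =>
        have h2 := ih fun a ha => h a (Multiset.mem_cons_of_mem ha)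
        have h3 := hf a (h a (Multiset.mem_cons_self a A''))
        simp only [Multiset.map_cons, Multiset.sum_cons, Multiset.sum_add, Multiset.card_add,
          Multiset.card_cons]
        push_cast
        linarith
    exact this A' fun a ha => Multiset.mem_of_le hA' ha
  have h2 : ∀ y ∈ Y, q ≤ y := by
    intro y hy
    have : y ∈ (A'.map f).sum := by rw [hY]; exact Multiset.mem_add.mpr (Or.inr hy)
    obtain ⟨M, hM, hy⟩ := Multiset.mem_join.mp (show y ∈ (A'.map f).join from this)
    obtain ⟨a, ha, rfl⟩ := Multiset.mem_map.mp hM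
    exact hq a (Multiset.mem_of_le hA' ha) y hy
  have h3 := sum_sub_card_nonneg h2
  rw [hY, Multiset.sum_add, Multiset.card_add] at h1
  push_cast at h1
  have h4 : (A'.card : ℝ) * e ≤ n * e :=
    -- At most `n` of the multisets are needed to cover `X`, and the part `Y` of them outside `X`
    -- has nonnegative excess.
    mul_le_mul_of_nonneg_right (by exact_mod_cast hcard.trans hXn) he
  linarith

/-- The entries of the rows of `T` in `c` that are not used in the rows of `V` in `c`. -/
noncomputable def rest (c : Rows × Rows) : Multiset ℝ := c.1.join - c.2.join

namespace Problem

/-- Rows of `T` and `V`, such that all entries of the rows of `V` are contained in the rows of `T`,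
and with at most as many rows of `T` as a tree. -/
structure IsTree (P : Problem) (q : ℝ) (c : Rows × Rows) : Prop where
  le_join : c.2.join ≤ c.1.join
  left : IsMatrix c.1.card P.t P.xt c.1
  right : IsMatrix c.2.card P.v P.xv c.2
  one_le : 1 ≤ c.1.card
  card_le : c.1.card ≤ (P.v - 1) * c.2.card + 1
  le_of_mem : ∀ y ∈ c.1.join, q ≤ y

/-- A partition of the rows of `T` and `V` into trees. -/
structure IsForest (P : Problem) (q : ℝ) (X : Multiset ℝ) (C : Multiset (Rows × Rows)) : Prop where
  isTree : ∀ c ∈ C, P.IsTree q c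
  sum_fst : (C.map fun c => (c.1.card : ℝ)).sum = P.st
  sum_snd : (C.map fun c => (c.2.card : ℝ)).sum = P.sv
  sum_rest : (C.map rest).sum = X

variable {P : Problem} {F : Filling} {b b₁ : ℕ} {g q : ℝ} {c : Rows × Rows}
  {C : Multiset (Rows × Rows)} {X : Multiset ℝ}

lemma exists_isForest {T V : Rows} (hv : 1 ≤ P.v) (hT : IsMatrix P.st P.t P.xt T)
    (hV : IsMatrix P.sv P.v P.xv V) (h : V.join ≤ T.join) (hq : ∀ y ∈ T.join, q ≤ y) :
    ∃ C, P.IsForest q (T.join - V.join) C := by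
  obtain ⟨C, h1, h2, h3⟩ := exists_components hv T V (fun r hr => (hV.2 r hr).1) h
  have hmT : ∀ c ∈ C, ∀ r ∈ c.1, r ∈ T := by
    intro c hc r hr
    rw [← h1]
    exact Multiset.mem_join.mpr ⟨c.1, Multiset.mem_map_of_mem _ hc, hr⟩
  have hmV : ∀ c ∈ C, ∀ r ∈ c.2, r ∈ V := by
    intro c hc r hr
    rw [← h2]
    exact Multiset.mem_join.mpr ⟨c.2, Multiset.mem_map_of_mem _ hc, hr⟩
  refine ⟨C, fun c hc => ⟨(h3 c hc).1, ⟨rfl, fun r hr => hT.2 r (hmT c hc r hr)⟩,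
    ⟨rfl, fun r hr => hV.2 r (hmV c hc r hr)⟩, (h3 c hc).2.1, (h3 c hc).2.2, ?_⟩, ?_, ?_, ?_⟩
  · intro y hy
    obtain ⟨r, hr, hy⟩ := Multiset.mem_join.mp hy
    exact hq y (Multiset.mem_join.mpr ⟨r, hmT c hc r hr, hy⟩)
  · rw [sum_map_card h1, hT.1]
  · rw [sum_map_card h2, hV.1]
  · change (C.map fun c => c.1.join - c.2.join).sum = _
    rw [sum_map_sub C _ _ fun c hc => (h3 c hc).1, ← h1, ← h2, join_sum, join_sum,
      Multiset.map_map, Multiset.map_map]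
    rfl

namespace IsTree

lemma rest_add (hc : P.IsTree q c) : rest c + c.2.join = c.1.join :=
  tsub_add_cancel_of_le hc.le_join

lemma rest_card (hc : P.IsTree q c) : ((rest c).card : ℝ) = c.1.card * P.t - c.2.card * P.v := by
  have := congrArg Multiset.card hc.rest_add
  rw [Multiset.card_add, hc.left.card_join, hc.right.card_join] at this
  have h2 : ((rest c).card : ℝ) + c.2.card * P.v = c.1.card * P.t := by exact_mod_cast this
  linarith

lemma rest_sum (hc : P.IsTree q c) : (rest c).sum = c.1.card * P.xt - c.2.card * P.xv := by
  have := congrArg Multiset.sum hc.rest_add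
  rw [Multiset.sum_add, hc.left.sum_join, hc.right.sum_join] at this
  linarith

lemma le_of_mem_rest (hc : P.IsTree q c) : ∀ y ∈ rest c, q ≤ y := fun y hy =>
  hc.le_of_mem y (by rw [← hc.rest_add]; exact Multiset.mem_add.mpr (Or.inl hy))

lemma rest_excess (hc : P.IsTree q c) : (rest c).sum - (rest c).card * q =
    (c.1.card - (P.v - 1) * c.2.card) * P.eT q + c.2.card * P.eD q := by
  rw [hc.rest_card, hc.rest_sum, eD, eT, eV]
  ring

lemma excess_nonneg (hc : P.IsTree q c) :
    0 ≤ (c.1.card - (P.v - 1) * c.2.card) * P.eT q + c.2.card * P.eD q := by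
  rw [← hc.rest_excess]
  exact sum_sub_card_nonneg hc.le_of_mem_rest

/-- A component that is not a full tree has at least one row of `V`, and the coefficient of `eT` in
`rest_excess` is at most zero. For `eT ≥ 0` and `eD < 0` its excess would be negative. -/
lemma eq_or_le (hc : P.IsTree q c) (hv : 1 ≤ P.v) :
    (c.1.card : ℝ) = (P.v - 1) * c.2.card + 1 ∨
      (c.1.card : ℝ) ≤ (P.v - 1) * c.2.card ∧ (1 : ℝ) ≤ c.2.card := by
  have h1 := hc.card_le
  have h2 := hc.one_le
  rcases Nat.eq_or_lt_of_le h1 with h | h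
  · left
    rw [h]
    push_cast [Nat.cast_sub hv]
    ring
  · right
    have h3 : c.1.card ≤ (P.v - 1) * c.2.card := Nat.lt_succ_iff.mp h
    refine ⟨?_, ?_⟩
    · have : (c.1.card : ℝ) ≤ ((P.v - 1) * c.2.card : ℕ) := by exact_mod_cast h3
      push_cast [Nat.cast_sub hv] at this
      exact this
    · have : c.2.card ≠ 0 := by
        intro h0
        rw [h0, mul_zero] at h3
        omega
      exact_mod_cast Nat.one_le_iff_ne_zero.mpr this

end IsTree

namespace IsForest

lemma exists_lt (hC : P.IsForest q X C) {α β : ℝ} (h : 0 < α * P.st + β * P.sv) :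
    ∃ c ∈ C, 0 < α * c.1.card + β * c.2.card := by
  by_contra! hne
  have h1 : (C.map fun c => α * (c.1.card : ℝ) + β * c.2.card).sum ≤ (C.map fun _ => (0 : ℝ)).sum :=
    Multiset.sum_map_le_sum_map _ _ hne
  rw [Multiset.sum_map_add, Multiset.sum_map_mul_left, Multiset.sum_map_mul_left, hC.sum_fst,
    hC.sum_snd] at h1
  simp at h1
  linarith

lemma rest_le (hC : P.IsForest q X C) (hc : c ∈ C) : rest c ≤ X := by
  rw [← hC.sum_rest]
  exact Multiset.le_sum_of_mem (Multiset.mem_map_of_mem _ hc)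

/-- There is a tree that contains more than `b - 1` rows of `V`. -/
lemma eU_reduced_nonneg (hC : P.IsForest q X C) (s : P.IsStep b) (hT : 0 ≤ P.eT q) :
    0 ≤ (P.reduced b).eU q := by
  have h1 := s.lt_sv_cast
  rw [hh] at h1
  -- Summed over all components, `k - (b-1)(m - (v-1)k)` gives `sv - (b-1)·hh > 0`, where `m` and
  -- `k` count rows of `T` and `V`. So it is positive for some component.
  obtain ⟨c, hc, h2⟩ := hC.exists_lt (α := -((b : ℝ) - 1)) (β := 1 + (b - 1) * (P.v - 1))
    (by linarith)
  have ht := hC.isTree c hc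
  have h3 := ht.excess_nonneg
  have hb := s.one_le_cast
  have hk : (0 : ℝ) ≤ c.2.card := Nat.cast_nonneg _
  rw [s.eU_reduced]
  by_contra! hneg
  have hD : P.eD q < 0 := by
    by_contra! hD
    have := mul_nonneg (show (0 : ℝ) ≤ b by linarith) hD
    linarith
  rcases ht.eq_or_le s.is3MDAP.one_le_v with h4 | ⟨h4, h5⟩
  · rw [h4] at h2 h3
    have h6 : (b : ℝ) ≤ c.2.card := by
      have : ((b : ℝ) - 1) < c.2.card := by linarith
      have h7 : (b : ℝ) < (c.2.card + 1 : ℕ) := by push_cast; linarith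
      exact_mod_cast Nat.lt_succ_iff.mp (by exact_mod_cast h7)
    have h7 := mul_le_mul_of_nonpos_right h6 hD.le
    linarith
  · have h6 := mul_nonpos_of_nonpos_of_nonneg (show c.1.card - (P.v - 1) * (c.2.card : ℝ) ≤ 0 by
      linarith) hT
    have h7 := mul_neg_of_pos_of_neg (show (0 : ℝ) < c.2.card by linarith) hD
    linarith

/-- If the excess of `V` in the reduced problem is large, then the trees are as large as possible and
contain at most `b` rows of `V`. -/
lemma tree_eq (hC : P.IsForest q X C) (s : P.IsStep b) (hT : 0 ≤ P.eT q)
    (hA : 2 * (P.reduced b).eU q < (P.reduced b).eV q) (hc : c ∈ C) :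
    (c.1.card : ℝ) = (P.v - 1) * c.2.card + 1 ∧ c.2.card ≤ b := by
  have ht := hC.isTree c hc
  have h3 := ht.excess_nonneg
  have hb := s.one_le_cast
  rw [s.eU_reduced, s.eV_reduced] at hA
  -- `2·eU' - eV'` is the excess left by a tree with `b + 1` rows of `V`. This is the origin of the
  -- factor 2 in the estimates.
  have hA' : P.eT q + (b + 1) * P.eD q < 0 := by linarith
  have hD : P.eD q < 0 := by
    by_contra! hD
    have := mul_nonneg (show (0 : ℝ) ≤ b + 1 by linarith) hD
    linarith
  rcases ht.eq_or_le s.is3MDAP.one_le_v with h4 | ⟨h4, h5⟩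
  · refine ⟨h4, ?_⟩
    by_contra! hlt
    have h6 : (b : ℝ) + 1 ≤ c.2.card := by exact_mod_cast hlt
    have h7 := mul_le_mul_of_nonpos_right h6 hD.le
    rw [h4] at h3
    linarith
  · have h6 := mul_nonpos_of_nonpos_of_nonneg (show c.1.card - (P.v - 1) * (c.2.card : ℝ) ≤ 0 by
      linarith) hT
    have h7 := mul_neg_of_pos_of_neg (show (0 : ℝ) < c.2.card by linarith) hD
    linarith

end IsForest

/-- The entries of a tree that belong to `U` are covered by rows of `U`. -/
lemma IsTree.cover {U : Rows} (ht : P.IsTree q c) (hU : IsMatrix P.su P.u P.xu U)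
    (hle : rest c ≤ U.join) (hq : ∀ y ∈ U.join, q ≤ y) (hU0 : 0 ≤ P.eU q)
    (hfull : (c.1.card : ℝ) = (P.v - 1) * c.2.card + 1) :
    P.eT q + c.2.card * P.eD q ≤ (P.t + c.2.card * P.dd) * P.eU q := by
  have h1 := excess_le_of_le_sum (A := U) (f := id) (X := rest c) (q := q) (e := P.eU q)
    (n := (rest c).card) (by rw [Multiset.map_id]; exact hle) le_rfl
    (fun r hr y hy => hq y (Multiset.mem_join.mpr ⟨r, hr, hy⟩))
    (fun r hr => by simp only [id]; rw [(hU.2 r hr).1, (hU.2 r hr).2, eU]) hU0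
  rw [ht.rest_excess, ht.rest_card, hfull] at h1
  have e : (P.t : ℝ) + c.2.card * P.dd = ((P.v - 1) * c.2.card + 1) * P.t - c.2.card * P.v := by
    rw [dd]
    ring
  rw [e]
  linarith

namespace IsStep

lemma eU_reduced_le (s : P.IsStep b) (hU0 : 0 ≤ P.eU q) :
    (P.reduced b).eU q ≤ (P.reduced b).u * P.eU q := by
  have h1 := s.eU_eT_reduced q
  obtain ⟨-, hu, -, -, -⟩ := s.is3MDAP.casts
  have h2 : 0 ≤ ((P.reduced b).u : ℝ) * P.eU q := by positivity
  have h3 := mul_le_mul_of_nonneg_right (show (1 : ℝ) ≤ P.u by linarith) h2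
  refine le_of_mul_le_mul_left ?_ (show (0 : ℝ) < P.u by linarith)
  linarith

/-- The loss of a row of `V` in a tree is at least the gain in the number of rows of `U` needed. -/
lemma eD_le (s : P.IsStep b) (hU0 : 0 ≤ P.eU q)
    (h : (P.reduced b).v * P.eU q - (P.reduced b).eV q < 0 ∨
      (P.reduced b).v * P.eU q - (P.reduced b).eV q < P.dd * P.eU q - P.eD q) :
    0 ≤ P.dd * P.eU q - P.eD q := by
  have h1 := s.eU_reduced_le hU0
  rw [s.reduced_u_eq, ← sub_nonneg] at h1
  have h2 := s.eD_eq q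
  rcases h with h | h
  · linarith
  · rcases lt_or_ge ((P.reduced b).v * P.eU q - (P.reduced b).eV q) 0 with h3 | h3
    · linarith
    · linarith

/-- For `k = b - 1` the covering inequality reads `eV' ≤ v'·eU`. Every row of `V` that a smaller
tree lacks costs a further `dd·eU - eD`. -/
lemma cover_le (s : P.IsStep b) {k : ℝ} (h : P.eT q + k * P.eD q ≤ (P.t + k * P.dd) * P.eU q) :
    (b - 1 - k) * (P.dd * P.eU q - P.eD q) ≤ (P.reduced b).v * P.eU q - (P.reduced b).eV q := by
  rw [s.reduced_v, s.eV_reduced]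
  linarith

/-- If all trees have `b - 1` or `b` rows of `V`, then the reduced problem has a solution. -/
lemma exists_reduced {U : Rows} (s : P.IsStep b) (hU : IsMatrix P.su P.u P.xu U)
    (hC : P.IsForest q U.join C)
    (h1 : ∀ c ∈ C, (c.1.card : ℝ) = (P.v - 1) * c.2.card + 1 ∧ c.2.card ≤ b ∧ b ≤ c.2.card + 1) :
    ∃ G, (P.reduced b).IsFeasible G ∧ G.T = U := by
  classical
  set A := C.filter fun c => c.2.card = b with hA
  set B := C.filter fun c => ¬ c.2.card = b with hB
  have hAB : A + B = C := Multiset.filter_add_not _ _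
  have e3 : ((b - 1 : ℕ) : ℝ) = b - 1 := by rw [Nat.cast_sub s.one_le, Nat.cast_one]
  have hA' : ∀ c ∈ A, P.IsTree q c ∧ (c.2.card : ℝ) = b ∧ (c.1.card : ℝ) = (P.v - 1) * b + 1 := by
    intro c hc
    obtain ⟨hc, hk⟩ := Multiset.mem_filter.mp hc
    refine ⟨hC.isTree c hc, by rw [hk], ?_⟩
    rw [(h1 c hc).1, hk]
  have hB' : ∀ c ∈ B, P.IsTree q c ∧ (c.2.card : ℝ) = b - 1 ∧
      (c.1.card : ℝ) = (P.v - 1) * (b - 1) + 1 := by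
    intro c hc
    obtain ⟨hc, hk⟩ := Multiset.mem_filter.mp hc
    obtain ⟨h2, h3, h4⟩ := h1 c hc
    have h5 : c.2.card = b - 1 := by omega
    refine ⟨hC.isTree c hc, by rw [h5, e3], ?_⟩
    rw [h2, h5, e3]
  have hm := hC.sum_fst
  have hk := hC.sum_snd
  have hr := hC.sum_rest
  rw [← hAB, Multiset.map_add, Multiset.sum_add] at hm hk hr
  rw [Multiset.map_congr rfl fun c hc => (hA' c hc).2.2,
    Multiset.map_congr (s := B) rfl fun c hc => (hB' c hc).2.2] at hm
  rw [Multiset.map_congr rfl fun c hc => (hA' c hc).2.1,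
    Multiset.map_congr (s := B) rfl fun c hc => (hB' c hc).2.1] at hk
  simp only [Multiset.map_const', Multiset.sum_replicate, nsmul_eq_mul] at hm hk
  -- The numbers of large and small trees solve the two linear equations given by the numbers of
  -- rows of `T` and `V`.
  have cA : A.card = (P.reduced b).su := by
    have : (A.card : ℝ) = (P.reduced b).su := by
      rw [s.reduced_su, hh, ← hm, ← hk]
      ring
    exact_mod_cast this
  have cB : B.card = (P.reduced b).sv := by
    have : (B.card : ℝ) = (P.reduced b).sv := by
      rw [s.reduced_sv, hh, ← hm, ← hk]
      ring
    exact_mod_cast this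
  refine ⟨⟨U, A.map rest, B.map rest⟩, ⟨hU, ?_, ?_, hr.symm⟩, rfl⟩
  · rw [← cA]
    refine isMatrix_map A rest fun c hc => ?_
    obtain ⟨h2, h3, h4⟩ := hA' c hc
    constructor
    · have : ((rest c).card : ℝ) = (P.reduced b).u := by
        rw [h2.rest_card, h3, h4, s.reduced_u, dd]
        ring
      exact_mod_cast this
    · rw [h2.rest_sum, h3, h4]
      rfl
  · rw [← cB]
    refine isMatrix_map B rest fun c hc => ?_
    obtain ⟨h2, h3, h4⟩ := hB' c hc
    constructor
    · have : ((rest c).card : ℝ) = (P.reduced b).v := by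
        rw [h2.rest_card, h3, h4, s.reduced_v, dd]
        ring
      exact_mod_cast this
    · rw [h2.rest_sum, h3, h4]
      rfl

end IsStep

end Problem

/-! ### Optimality -/

namespace Problem

variable {P : Problem} {F : Filling} {b b₁ : ℕ} {g q : ℝ} {C : Multiset (Rows × Rows)}

lemma eT_sub (P : Problem) (g q : ℝ) : P.eT q = P.eT g - P.t * (q - g) := by
  rw [eT, eT]
  ring

lemma eU_sub (P : Problem) (g q : ℝ) : P.eU q = P.eU g - P.u * (q - g) := by
  rw [eU, eU]
  ring

lemma eV_sub (P : Problem) (g q : ℝ) : P.eV q = P.eV g - P.v * (q - g) := by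
  rw [eV, eV]
  ring

lemma eD_sub (P : Problem) (g q : ℝ) : P.eD q = P.eD g - P.dd * (q - g) := by
  rw [eD, eD, dd, P.eT_sub g q, P.eV_sub g q]
  ring

lemma IsMatrix.excess_nonneg {s c : ℕ} {x : ℝ} {M : Rows} (h : IsMatrix s c x M) (hs : 0 < s)
    (hq : ∀ y ∈ M.join, q ≤ y) : 0 ≤ x - c * q := by
  obtain ⟨r, hr⟩ := Multiset.card_pos_iff_exists_mem.mp (h.1 ▸ hs)
  have := sum_sub_card_nonneg (X := r) fun y hy => hq y (Multiset.mem_join.mpr ⟨r, hr, hy⟩)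
  rwa [(h.2 r hr).1, (h.2 r hr).2] at this

/-- The rows of `T` that have no entries in common with `V`. -/
lemma IsFeasible.exists_rows {k : ℕ} (hF : P.IsFeasible F) (hk : k + P.sv * P.v ≤ P.st) :
    ∃ A : Rows, IsMatrix k P.t P.xt A ∧ A.join ≤ F.U.join := by
  obtain ⟨hT, hU, hV, hj⟩ := hF
  obtain ⟨R', hR', hcard, hle⟩ := exists_le_card_le_join F.T F.V.join (by
    rw [hj]; exact Multiset.le_add_left _ _)
  obtain ⟨R'', hR''⟩ := Multiset.le_iff_exists_add.mp hR'
  have hR''U : R''.join ≤ F.U.join := by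
    rw [hR'', Multiset.join_add] at hj
    have : R''.join + F.V.join ≤ F.U.join + F.V.join := by
      rw [← hj, add_comm R'.join]
      exact add_le_add_right hle _
    exact le_of_add_le_add_right this
  rw [hV.card_join] at hcard
  have hc : k ≤ R''.card := by
    have := congrArg Multiset.card hR''
    rw [hT.1, Multiset.card_add] at this
    omega
  obtain ⟨A, B, hAB, hA⟩ := exists_add_card_eq k R'' hc
  refine ⟨A, ⟨hA, fun r hr => hT.2 r ?_⟩, le_trans ?_ hR''U⟩
  · rw [hR'', hAB]
    simp [hr]
  · rw [hAB, Multiset.join_add]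
    exact Multiset.le_add_right _ _

namespace IsStep

/-- An upper bound if the pairs consist of single rows of `V`. -/
lemma eU_reduced_reduced_nonneg (s : P.IsStep 1) (s₁ : (P.reduced 1).IsStep b₁)
    (hF : P.IsFeasible F) (hq : ∀ y ∈ F.U.join, q ≤ y) (hU0 : 0 ≤ P.eU q) :
    0 ≤ ((P.reduced 1).reduced b₁).eU q := by
  have hv := s.is3MDAP.one_le_v
  -- For `b = 1` one has `sv' = hh - sv = st - v·sv`. So at least `sv'` rows of `T` share no entry
  -- with `V`; their entries come from `U`, and they can serve as the matrix `V'` of the reduced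
  -- problem.
  have hk : (P.reduced 1).sv + P.sv * P.v ≤ P.st := by
    have h1 := s.reduced_sv
    have : (((P.reduced 1).sv + P.sv * P.v : ℕ) : ℝ) ≤ P.st := by
      push_cast
      rw [h1, hh]
      push_cast
      linarith
    exact_mod_cast this
  obtain ⟨A, hA, hle⟩ := hF.exists_rows hk
  have hA' : IsMatrix (P.reduced 1).sv (P.reduced 1).v (P.reduced 1).xv A := by
    have e1 : (P.reduced 1).v = P.t := by simp [reduced, pairSize]
    have e2 : (P.reduced 1).xv = P.xt := by simp [reduced]
    rw [e1, e2]
    exact hA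
  obtain ⟨C, hC⟩ := exists_isForest (P := P.reduced 1) (T := F.U) (V := A) (q := q)
    s₁.is3MDAP.one_le_v hF.2.1 hA' hle hq
  exact hC.eU_reduced_nonneg s₁ hU0

/-- An upper bound if the problem and the reduced problem are such that the excess of `U` in the
doubly reduced problem vanishes. -/
lemma not_forest (s : P.IsStep b) {U : Rows} (hU : IsMatrix P.su P.u P.xu U)
    (hC : P.IsForest q U.join C) (hq : ∀ y ∈ U.join, q ≤ y) (hU0 : 0 ≤ P.eU q)
    (h : (P.reduced b).v * P.eU q - (P.reduced b).eV q < 0) : False := by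
  have h1 := s.sv_lt_cast
  rw [hh] at h1
  -- As `sv < b·hh`, some component satisfies `k < b(m - (v-1)k)`. It is a full tree with at most `b
  -- - 1` rows of `V`, which `cover_le` excludes when `v'·eU - eV'` is negative.
  obtain ⟨c, hc, h2⟩ := hC.exists_lt (α := b) (β := -(1 + b * (P.v - 1))) (by linarith)
  have ht := hC.isTree c hc
  have hb := s.one_le_cast
  rcases ht.eq_or_le s.is3MDAP.one_le_v with h4 | ⟨h4, h5⟩
  · have h6 := s.cover_le (ht.cover hU (hC.rest_le hc) hq hU0 h4)
    have h7 := s.eD_le hU0 (Or.inl h)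
    rw [h4] at h2
    have h8 : (c.2.card : ℝ) < b := by linarith
    have h9 : c.2.card + 1 ≤ b := by exact_mod_cast h8
    have h10 : (c.2.card : ℝ) + 1 ≤ b := by exact_mod_cast h9
    have h11 := mul_nonneg (show 0 ≤ (b : ℝ) - 1 - c.2.card by linarith) h7
    linarith
  · have h6 := mul_nonneg (show (0 : ℝ) ≤ b by linarith) (sub_nonneg.mpr h4)
    linarith

/-- The exceptional case, in which the trees may be smaller. -/
lemma eU_le_of_exception (s : P.IsStep b) (s₁ : (P.reduced b).IsStep 1) (hv : P.v = 1) {U : Rows}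
    (hU : IsMatrix P.su P.u P.xu U) (hC : P.IsForest q U.join C)
    (h1 : ∀ c ∈ C, (c.1.card : ℝ) = (P.v - 1) * c.2.card + 1 ∧ c.2.card ≤ b) :
    P.eU q ≤ P.u * (P.reduced b).eU q := by
  classical
  set A := C.filter fun c => c.2.card = b with hA
  set B := C.filter fun c => ¬ c.2.card = b with hB
  have hAB : A + B = C := Multiset.filter_add_not _ _
  have hr := hC.sum_rest
  rw [← hAB, Multiset.map_add, Multiset.sum_add] at hr
  have hmem : ∀ c ∈ A, c ∈ C := fun c hc => Multiset.mem_of_mem_filter hc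
  have hk : ∀ c ∈ A, (c.2.card : ℝ) = b := fun c hc => by rw [(Multiset.mem_filter.mp hc).2]
  have hv1 := s.reduced_v
  have hdd : P.dd = -1 := by rw [dd, hv]; simp
  have hbt : (b : ℝ) + 2 ≤ P.t := by exact_mod_cast s.add_two_le hv
  rw [hdd] at hv1
  -- A tree with `k < b` rows of `V` leaves `t - k ≤ v'(b - k)` entries, in total at most `v'·sv'`,
  -- and this is less than `su` because the next step has `b₁ = 1`. So some row of `U` contains only
  -- entries of trees with exactly `b` rows, at most `u` of which cover it.
  have hcardB : (((B.map rest).sum.card : ℕ) : ℝ) < P.su := by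
    have h2 : (((B.map rest).sum.card : ℕ) : ℝ) =
        (B.map fun c => ((rest c).card : ℝ)).sum := (sum_map_card rfl).symm
    have h3 : (B.map fun c => ((rest c).card : ℝ)).sum ≤
        (B.map fun c => ((P.reduced b).v : ℝ) * (b - c.2.card)).sum := by
      refine Multiset.sum_map_le_sum_map _ _ fun c hc => ?_
      obtain ⟨hc, hne⟩ := Multiset.mem_filter.mp hc
      have h4 := (h1 c hc).2
      have h5 : (c.2.card : ℝ) + 1 ≤ b := by exact_mod_cast (by omega : c.2.card + 1 ≤ b)
      rw [(hC.isTree c hc).rest_card, (h1 c hc).1, hv, hv1]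
      push_cast
      nlinarith
    have h4 : (C.map fun c => ((P.reduced b).v : ℝ) * (b - c.2.card)).sum =
        (P.reduced b).v * (P.reduced b).sv := by
      have e : ∀ c ∈ C, ((P.reduced b).v : ℝ) * (b - c.2.card) =
          (P.reduced b).v * b * c.1.card + -(P.reduced b).v * c.2.card := by
        intro c hc
        rw [(h1 c hc).1, hv]
        push_cast
        ring
      rw [Multiset.map_congr rfl e, Multiset.sum_map_add, Multiset.sum_map_mul_left,
        Multiset.sum_map_mul_left, hC.sum_fst, hC.sum_snd, s.reduced_sv, hh, hv]
      push_cast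
      ring
    rw [← hAB, Multiset.map_add, Multiset.sum_add] at h4
    have h5 : 0 ≤ (A.map fun c => ((P.reduced b).v : ℝ) * (b - c.2.card)).sum := by
      refine Multiset.sum_nonneg fun x hx => ?_
      obtain ⟨c, hc, rfl⟩ := Multiset.mem_map.mp hx
      rw [hk c hc]
      simp
    have h6 := s₁.sv_lt_cast
    rw [hh] at h6
    have h7 : ((P.reduced b).st : ℝ) = P.su := rfl
    rw [h7] at h6
    push_cast at h6
    linarith
  have hcardB' : (B.map rest).sum.card < P.su := by exact_mod_cast hcardB
  obtain ⟨R', hR', hcard, hle⟩ := exists_le_card_le_join U (B.map rest).sum (by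
    rw [← hr]; exact Multiset.le_add_left _ _)
  obtain ⟨R'', hR''⟩ := Multiset.le_iff_exists_add.mp hR'
  have hpos : 0 < R''.card := by
    have := congrArg Multiset.card hR''
    rw [hU.1, Multiset.card_add] at this
    omega
  obtain ⟨r, hrm⟩ := Multiset.card_pos_iff_exists_mem.mp hpos
  have hrU : r ∈ U := by
    rw [hR'']
    exact Multiset.mem_add.mpr (Or.inr hrm)
  have hrA : r ≤ (A.map rest).sum := by
    have h2 : R''.join ≤ (A.map rest).sum := by
      have h3 := hr
      rw [hR'', Multiset.join_add] at h3
      have : R''.join + (B.map rest).sum ≤ (A.map rest).sum + (B.map rest).sum := by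
        rw [h3, add_comm R'.join]
        exact add_le_add_right hle _
      exact le_of_add_le_add_right this
    exact le_trans (Multiset.le_sum_of_mem hrm) h2
  have hexc : ∀ c ∈ A, (rest c).sum - (rest c).card * q = (P.reduced b).eU q := by
    intro c hc
    rw [(hC.isTree c (hmem c hc)).rest_excess, (h1 c (hmem c hc)).1, hk c hc, s.eU_reduced]
    ring
  have hA0 : 0 ≤ (P.reduced b).eU q := by
    rcases A.empty_or_exists_mem with h0 | ⟨c, hc⟩
    · rw [h0, Multiset.map_zero, Multiset.sum_zero] at hrA
      have h2 := (hU.2 r hrU).1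
      rw [Multiset.le_zero.mp hrA, Multiset.card_zero] at h2
      have := s.is3MDAP.two_le_u
      omega
    · rw [← hexc c hc]
      exact sum_sub_card_nonneg (hC.isTree c (hmem c hc)).le_of_mem_rest
  have h2 := excess_le_of_le_sum (n := P.u) hrA (hU.2 r hrU).1.le
    (fun c hc => (hC.isTree c (hmem c hc)).le_of_mem_rest) hexc hA0
  rwa [(hU.2 r hrU).1, (hU.2 r hrU).2] at h2

end IsStep

/-- No feasible solution is better than that of the recursive algorithm. -/
theorem Value.le (hg : Value P g) (h : P.Is3MDAP) (hF : P.IsFeasible F)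
    (hq : ∀ y ∈ F.T.join, q ≤ y) : q ≤ g := by
  induction hg generalizing F with
  | terminal P hP =>
    have h1 : 0 ≤ P.eU q := IsMatrix.excess_nonneg hF.2.1 h.su_pos fun y hy =>
      hq y (by rw [hF.2.2.2]; exact Multiset.mem_add.mpr (Or.inl hy))
    obtain ⟨-, hu, -, -, -⟩ := h.casts
    rw [le_div_iff₀ (by linarith)]
    rw [eU] at h1
    linarith
  | step P g hP hg ih =>
    have s := h.isStep hP
    set b := P.bHat with hbdef
    by_contra! hgq
    have hδ := sub_pos.mpr hgq
    have hqU : ∀ y ∈ F.U.join, q ≤ y := fun y hy =>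
      hq y (by rw [hF.2.2.2]; exact Multiset.mem_add.mpr (Or.inl hy))
    have hT0 : 0 ≤ P.eT q := IsMatrix.excess_nonneg hF.1 h.st_pos hq
    have hU0 : 0 ≤ P.eU q := IsMatrix.excess_nonneg hF.2.1 h.su_pos hqU
    obtain ⟨C, hC⟩ := exists_isForest h.one_le_v hF.1 hF.2.2.1 (by
      rw [hF.2.2.2]; exact Multiset.le_add_left _ _) hq
    rw [hF.2.2.2, add_tsub_cancel_right] at hC
    obtain ⟨-, hu, -, -, -⟩ := h.casts
    obtain ⟨-, hu1, -, -, -⟩ := s.reduced_is3MDAP.casts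
    by_cases hP1 : (P.reduced b).Terminal
    -- Here `eU'` vanishes at `g`, so it is negative at `q > g`, while some tree with more than `b -
    -- 1` rows of `V` forces it to be nonnegative.
    · have h1 := hC.eU_reduced_nonneg s hT0
      rw [eU_sub _ g q, s.terminal_eU hg hP1] at h1
      have := mul_pos (show (0 : ℝ) < (P.reduced b).u by linarith) hδ
      linarith
    have s₁ := s.reduced_is3MDAP.isStep hP1
    have hg₁ := hg.reduced hP1
    set b₁ := (P.reduced b).bHat with hb₁def
    obtain ⟨-, hu2, -, -, -⟩ := s₁.reduced_is3MDAP.casts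
    have hv1 : (2 : ℝ) ≤ (P.reduced b).v := by exact_mod_cast s.two_le_v_reduced
    have hXsub : (P.reduced b).v * P.eU q - (P.reduced b).eV q =
        (P.reduced b).v * P.eU g - (P.reduced b).eV g - (P.reduced b).v * (P.u - 1) * (q - g) := by
      rw [eU_sub P g q, eV_sub _ g q]
      ring
    have huv : (P.reduced b).v ≤ (P.reduced b).u + 1 := by
      rcases Nat.lt_or_ge P.v 2 with hv | hv
      · have := h.one_le_v
        have hv' : P.v = 1 := by omega
        have e1 : (P.reduced b).v = P.t - (b - 1) := IsStep.pairSize_of_v_eq_one hv'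
        have e2 : (P.reduced b).u = P.t - b := IsStep.pairSize_of_v_eq_one hv'
        have := s.add_two_le hv'
        omega
      · exact (s.v_le_u_reduced hv).trans (Nat.le_succ _)
    -- For `b ≥ 2` the expression `t + (b-2)·dd` is the number of entries left by a tree with `b -
    -- 2` rows of `V`.
    have hvd : (2 : ℝ) ≤ P.t + (b - 2) * P.dd ∨ b = 1 := by
      rw [or_iff_not_imp_right]
      intro hb
      have hb2 : (2 : ℝ) ≤ b := by
        have := s.one_le
        exact_mod_cast (by omega : 2 ≤ b)
      rcases Nat.lt_or_ge P.v 2 with hv | hv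
      · have := h.one_le_v
        have hv' : P.v = 1 := by omega
        have h1 : (b : ℝ) + 2 ≤ P.t := by exact_mod_cast s.add_two_le hv'
        rw [dd, hv']
        push_cast
        linarith
      · have h1 := mul_nonneg (sub_nonneg.mpr hb2) (s.dd_nonneg hv)
        obtain ⟨ht, -, -, -, -⟩ := h.casts
        linarith
    -- If the recursion stops after two steps, `eU''` vanishes at `g`. Then `b = 1` would give `eU''
    -- < 0` at `q`, and `b₁ = 1` would give `v'·eU = eV'` at `g`, hence `v'·eU < eV'` at `q`. Both
    -- contradict the existence of the better solution; otherwise the estimate for terminal problems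
    -- applies.
    have hA : 2 * (P.reduced b).eU g ≤ (P.reduced b).eV g := by
      by_cases hP2 : ((P.reduced b).reduced b₁).Terminal
      · have h0 := s₁.terminal_eU hg₁ hP2
        have hb : b ≠ 1 := by
          intro hb
          clear_value b₁ b
          subst hb
          have h1 := s.eU_reduced_reduced_nonneg s₁ hF hqU hU0
          rw [eU_sub _ g q, h0] at h1
          have := mul_pos (show (0 : ℝ) < ((P.reduced 1).reduced b₁).u by linarith) hδ
          linarith
        have hb₁ : b₁ ≠ 1 := by
          intro hb₁
          refine s.not_forest hF.2.1 hC hqU hU0 ?_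
          rw [s₁.eU_reduced, hb₁, eD] at h0
          have h1 : (P.reduced b).eT g = P.eU g := rfl
          rw [h1] at h0
          push_cast at h0
          rw [hXsub]
          have := mul_pos (mul_pos (show (0 : ℝ) < (P.reduced b).v by linarith)
            (show (0 : ℝ) < P.u - 1 by linarith)) hδ
          linarith
        have huv' : (P.reduced b).u + 2 ≤ 2 * (P.reduced b).v := by
          have h1 := hvd.resolve_right hb
          have : ((P.reduced b).u : ℝ) + 2 ≤ 2 * (P.reduced b).v := by
            rw [s.reduced_u, s.reduced_v]
            linarith
          exact_mod_cast this
        have := s₁.one_le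
        exact s₁.two_mul_eU_le_eV_of_terminal hg₁ s.two_le_v_reduced huv' (by omega) hP2
      · exact s₁.two_mul_eU_le_eV hg₁ s.two_le_v_reduced (s₁.hh_reduced_pos hP2)
    -- Passing from `g` to `q` changes the difference of the two sides by `(2u' - v')(q - g) > 0`.
    have hAq : 2 * (P.reduced b).eU q < (P.reduced b).eV q := by
      have huv' : ((P.reduced b).v : ℝ) ≤ (P.reduced b).u + 1 := by exact_mod_cast huv
      rw [eU_sub _ g q, eV_sub _ g q]
      have := mul_pos (show (0 : ℝ) < 2 * (P.reduced b).u - (P.reduced b).v by linarith) hδ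
      linarith
    have htree := fun c hc => hC.tree_eq s hT0 hAq (c := c) hc
    have hlow : ∀ c ∈ C, b ≤ c.2.card + 1 := by
      by_cases hb : b = 1
      · intro c _
        omega
      have h1 := hvd.resolve_right hb
      rcases s₁.excess_le_or hg₁ s.two_le_v_reduced huv with h2 | ⟨s₂, hb₁, h0, huv'⟩
      · have h3 : (P.reduced b).eT g = P.eU g := rfl
        rw [eD, h3, s.reduced_u_eq] at h2
        -- At `g` the non-strict inequality is `h2` rewritten with `u' = v' + dd`. Passing to `q`
        -- gains `(t + (b-2)·dd)(u-1)(q - g) > 0`. A tree with `k ≤ b - 2` would then contradict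
        -- `cover_le`.
        have hY : (P.reduced b).v * P.eU q - (P.reduced b).eV q < P.dd * P.eU q - P.eD q := by
          have h4 := s.eD_eq g
          rw [hXsub, eU_sub P g q, eD_sub P g q, s.reduced_v]
          rw [s.reduced_v] at h2
          have h5 := mul_pos (mul_pos (show (0 : ℝ) < P.t + (b - 2) * P.dd by linarith)
            (show (0 : ℝ) < P.u - 1 by linarith)) hδ
          linarith
        have hY0 := s.eD_le hU0 (Or.inr hY)
        intro c hc
        have h6 := s.cover_le ((hC.isTree c hc).cover hF.2.1 (hC.rest_le hc) hqU hU0 (htree c hc).1)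
        by_contra! hlt
        have h7 : (1 : ℝ) ≤ b - 1 - c.2.card := by
          have : (c.2.card : ℝ) + 2 ≤ b := by exact_mod_cast hlt
          linarith
        have h8 := mul_le_mul_of_nonneg_right h7 hY0
        linarith
      -- In the exceptional case `v' = u' + 1`, so `v = 1`. The vanishing of the excess three steps
      -- further on reads `eU = u·eU'` at `g`. The covering bound `eU ≤ u·eU'` at `q` would then
      -- require `u' ≤ 1`.
      · exfalso
        have hv : P.v = 1 := by
          by_contra hne
          have := h.one_le_v
          have := s.v_le_u_reduced (by omega)
          omega
        rw [hb₁] at s₁ s₂ h0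
        have h2 := s.eU_le_of_exception s₁ hv hF.2.1 hC htree
        rw [s₂.eU_reduced, eD, s₁.eV_reduced, s₁.reduced_v_of_one] at h0
        have h3 : ((P.reduced b).reduced 1).eT g = (P.reduced b).eU g := rfl
        have h4 : (P.reduced b).eT g = P.eU g := rfl
        have h5 : ((P.reduced b).t : ℝ) = P.u := rfl
        rw [h3, h4, h5] at h0
        push_cast at h0
        rw [eU_sub P g q, eU_sub _ g q] at h2
        have h6 := mul_pos (mul_pos (show (0 : ℝ) < P.u by linarith)
          (show (0 : ℝ) < (P.reduced b).u - 1 by linarith)) hδ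
        linarith
    -- Contracting the trees makes `U` the source matrix of a solution of the reduced problem with
    -- all entries at least `q`, which the induction hypothesis forbids.
    obtain ⟨G, hG, hGT⟩ := s.exists_reduced hF.2.1 hC fun c hc =>
      ⟨(htree c hc).1, (htree c hc).2, hlow c hc⟩
    exact absurd (ih s.reduced_is3MDAP hG (by rw [hGT]; exact hqU)) (not_le.mpr hgq)

end Problem

end ThreeMatrix

theorem mainTheorem1 (P : ThreeMatrix.Problem) (hP : P.Is3MDAP) :
    (∃ F : ThreeMatrix.Filling, P.RecursiveAlgorithm F) ∧
    ∀ F : ThreeMatrix.Filling, P.RecursiveAlgorithm F →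
      P.IsFeasible F ∧
      ∃ g : ℝ, F.IsSmallestPiece g ∧ IsGreatest P.objectiveValues g ∧ P.f = g := by
  refine ⟨hP.exists_recursiveAlgorithm, fun F hF => ?_⟩
  obtain ⟨g, hg, h1, h2, h3⟩ := hF.spec hP
  have h4 : F.IsSmallestPiece g := ⟨h3, fun y hy => h2 y hy⟩
  have h5 : IsGreatest P.objectiveValues g :=
    ⟨⟨F, h1, h4⟩, fun q ⟨F', h6, h7⟩ => hg.le hP h6 fun y hy => h7.2 hy⟩
  exact ⟨h1, g, h4, h5, h5.csSup_eq⟩
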